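/- Let $n\ge 2$ and $p,q\in[1,\infty]$ (with $1/\infty=0$). For a Schwartz function $f:\mathbb R^n\to\mathbb C$, $x\in\mathbb R^n$ and $t>0$ put, for $\operatorname{Re}\alpha>0$, $$\mathfrak M^\alpha_t f(x)=\frac1{\Gamma(\alpha)}\int_{|y|\le 1}(1-|y|^2)^{\alpha-1}f(x-ty)\,dy .$$ For fixed $f,t,x$ this function of $\alpha$ extends to an entire function, and $\mathfrak M^\alpha_t f(x)$ denotes the value of this extension at any $\alpha\in\mathbb C$. Put $$\mathfrak M^\alpha_{[1,2]}f(x)=\sup_{t\in[1,2]}\big|\mathfrak M^\alpha_t f(x)\big| .$$ Let $\alpha\in\mathbb C$, and suppose there is a finite constant $C$ such that $$\big\|\mathfrak M^\alpha_{[1,2]}f\big\|_{L^q(\mathbb R^n)}\le C\,\|f\|_{L^p(\mathbb R^n)}\qquad\text{for all Schwartz functions } f .$$ Then $q\ge p$ and $$\operatorname{Re}\alpha\ \ge\ \sigma_n(p,q):=\max\left\{\frac1p-\frac nq,\ \frac{n+1}{2p}-\frac{n-1}{2}\Big(\frac1q+1\Big),\ \frac np-n+1\right\}.$$ -/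

import Mathlib

open MeasureTheory Set Filter Topology
open scoped ENNReal NNReal ContDiff SchwartzMap

namespace SteinMeans

/-- The integral `Γ(α)⁻¹ ∫_{|y| ≤ 1} (1 - |y|²)^{α - 1} g(y) dy`, meaningful for `Re α > 0`. -/
noncomputable def ballIntegral (n : ℕ) (α : ℂ) (g : EuclideanSpace ℝ (Fin n) → ℂ) : ℂ :=
  (Complex.Gamma α)⁻¹ *
    ∫ y in Metric.closedBall (0 : EuclideanSpace ℝ (Fin n)) 1,
      ((1 - ‖y‖ ^ 2 : ℝ) : ℂ) ^ (α - 1) * g y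

theorem integrableOn_weight (n : ℕ) {a : ℝ} (ha : 0 < a) :
    IntegrableOn (fun y : EuclideanSpace ℝ (Fin n) => (1 - ‖y‖ ^ 2) ^ (a - 1))
      (Metric.ball 0 1) := by
  rcases Nat.eq_zero_or_pos n with rfl | hn
  · have hc : Continuous
        (fun y : EuclideanSpace ℝ (Fin 0) => (1 - ‖y‖ ^ 2) ^ (a - 1)) :=
      continuous_of_const fun x y => by rw [Subsingleton.elim x y]
    exact (hc.continuousOn.integrableOn_compact (isCompact_closedBall 0 1)).mono_set
      Metric.ball_subset_closedBall
  have : Nonempty (Fin n) := ⟨⟨0, hn⟩⟩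
  have h1 : IntegrableOn (fun r : ℝ => (1 - r) ^ (a - 1)) (Ioc 0 1) := by
    have := (intervalIntegral.intervalIntegrable_rpow' (a := 0) (b := 1) (r := a - 1)
      (by linarith)).comp_sub_left 1
    simp only [sub_zero, sub_self] at this
    exact (intervalIntegrable_iff_integrableOn_Ioc_of_le zero_le_one).1 this.symm
  have h2 : IntegrableOn
      (fun r : ℝ => (1 - r) ^ (a - 1) * ((1 + r) ^ (a - 1) * r ^ (n - 1))) (Ioc 0 1) := by
    refine h1.mul_continuousOn_of_subset (K := Icc 0 1) ?_ measurableSet_Ioc isCompact_Icc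
      Ioc_subset_Icc_self
    refine ContinuousOn.mul (ContinuousOn.rpow_const (by fun_prop) ?_) (by fun_prop)
    intro x hx
    left
    have := hx.1
    positivity
  rw [integrableOn_fun_norm_addHaar volume (f := fun r : ℝ => (1 - r ^ 2) ^ (a - 1))]
  refine (h2.mono_set Ioo_subset_Ioc_self).congr_fun ?_ measurableSet_Ioo
  intro r hr
  have e : (1 - r ^ 2 : ℝ) = (1 - r) * (1 + r) := by ring
  simp only [finrank_euclideanSpace, Fintype.card_fin, smul_eq_mul]
  rw [e, Real.mul_rpow (by linarith [hr.2]) (by linarith [hr.1])]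
  ring

/-- The same integral over the open ball, without the Gamma factor. -/
noncomputable def ballAux (n : ℕ) (α : ℂ) (g : EuclideanSpace ℝ (Fin n) → ℂ) : ℂ :=
  ∫ y in Metric.ball (0 : EuclideanSpace ℝ (Fin n)) 1,
    ((1 - ‖y‖ ^ 2 : ℝ) : ℂ) ^ (α - 1) * g y

theorem ballIntegral_eq (n : ℕ) (α : ℂ) (g : EuclideanSpace ℝ (Fin n) → ℂ) :
    ballIntegral n α g = (Complex.Gamma α)⁻¹ * ballAux n α g := by
  have h : (Metric.closedBall (0 : EuclideanSpace ℝ (Fin n)) 1 : Set _) =ᵐ[volume]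
      Metric.ball 0 1 := by
    rw [← Metric.ball_union_sphere]
    exact union_ae_eq_left_of_ae_eq_empty
      (ae_eq_empty.2 (Measure.addHaar_sphere_of_ne_zero volume 0 one_ne_zero))
  rw [ballIntegral, ballAux, setIntegral_congr_set h]

theorem one_sub_sq_pos {n : ℕ} {y : EuclideanSpace ℝ (Fin n)} (hy : y ∈ Metric.ball 0 1) :
    0 < 1 - ‖y‖ ^ 2 := by
  rw [mem_ball_zero_iff] at hy
  nlinarith [norm_nonneg y]

theorem aesm_weight {n : ℕ} (α : ℂ) {g : EuclideanSpace ℝ (Fin n) → ℂ} (hg : Continuous g)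
    (μ : Measure (EuclideanSpace ℝ (Fin n))) :
    AEStronglyMeasurable (fun y => ((1 - ‖y‖ ^ 2 : ℝ) : ℂ) ^ (α - 1) * g y) μ := by
  refine AEStronglyMeasurable.mul ?_ hg.aestronglyMeasurable
  exact (Measurable.pow_const (by fun_prop) _).aestronglyMeasurable

theorem integrableOn_mul {n : ℕ} {α : ℂ} (hα : 0 < α.re)
    {g : EuclideanSpace ℝ (Fin n) → ℂ} (hg : Continuous g) :
    IntegrableOn (fun y => ((1 - ‖y‖ ^ 2 : ℝ) : ℂ) ^ (α - 1) * g y) (Metric.ball 0 1) := by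
  have h := (integrableOn_weight n hα).mul_continuousOn_of_subset (hg.norm.continuousOn)
    measurableSet_ball (isCompact_closedBall 0 1) Metric.ball_subset_closedBall
  refine Integrable.mono' h (aesm_weight α hg _) ?_
  filter_upwards [ae_restrict_mem measurableSet_ball] with y hy
  rw [norm_mul, Complex.norm_cpow_eq_rpow_re_of_pos (one_sub_sq_pos hy)]
  simp

theorem ballAux_differentiableAt {n : ℕ} {α₀ : ℂ} (hα : 0 < α₀.re)
    {g : EuclideanSpace ℝ (Fin n) → ℂ} (hg : Continuous g) :
    DifferentiableAt ℂ (fun α => ballAux n α g) α₀ := by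
  set b : ℝ := α₀.re / 4 with hb
  have hb0 : 0 < b := by positivity
  have hs : {α : ℂ | 2 * b < α.re} ∈ 𝓝 α₀ :=
    (isOpen_lt continuous_const Complex.continuous_re).mem_nhds
      (by simp only [mem_ofPred_eq]; linarith)
  have hbd := ((integrableOn_weight n hb0).mul_continuousOn_of_subset (hg.norm.continuousOn)
    measurableSet_ball (isCompact_closedBall 0 1) Metric.ball_subset_closedBall).const_mul (1 / b)
  refine ((hasDerivAt_integral_of_dominated_loc_of_deriv_le
    (F := fun (α : ℂ) y => ((1 - ‖y‖ ^ 2 : ℝ) : ℂ) ^ (α - 1) * g y)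
    (F' := fun (α : ℂ) y => ((1 - ‖y‖ ^ 2 : ℝ) : ℂ) ^ (α - 1) *
      (Complex.log ((1 - ‖y‖ ^ 2 : ℝ) : ℂ) * g y)) hs
    (Eventually.of_forall fun α => aesm_weight α hg _)
    (integrableOn_mul hα hg) ?_ ?_ hbd ?_).2).differentiableAt
  · refine AEStronglyMeasurable.mul ?_ (AEStronglyMeasurable.mul ?_ hg.aestronglyMeasurable)
    · exact (Measurable.pow_const (by fun_prop) _).aestronglyMeasurable
    · exact (Complex.measurable_log.comp (by fun_prop)).aestronglyMeasurable
  · filter_upwards [ae_restrict_mem measurableSet_ball] with y hy α hα'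
    have hpos := one_sub_sq_pos hy
    have hle : 1 - ‖y‖ ^ 2 ≤ 1 := by nlinarith [norm_nonneg y]
    set s : ℝ := 1 - ‖y‖ ^ 2
    change 2 * b < α.re at hα'
    rw [norm_mul, norm_mul, Complex.norm_cpow_eq_rpow_re_of_pos hpos, ← Complex.ofReal_log hpos.le,
      Complex.norm_real, Real.norm_eq_abs, ← mul_assoc, ← mul_assoc]
    refine mul_le_mul_of_nonneg_right ?_ (norm_nonneg _)
    have h1 := (Real.abs_log_mul_self_rpow_lt s b hpos hle hb0).le
    rw [abs_mul, abs_of_pos (Real.rpow_pos_of_pos hpos b)] at h1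
    have h2 : s ^ (α - 1).re ≤ s ^ (b + (b - 1)) :=
      Real.rpow_le_rpow_of_exponent_ge hpos hle (by simp; linarith)
    calc s ^ (α - 1).re * |Real.log s| ≤ s ^ (b + (b - 1)) * |Real.log s| := by gcongr
      _ = (|Real.log s| * s ^ b) * s ^ (b - 1) := by rw [Real.rpow_add hpos]; ring
      _ ≤ 1 / b * s ^ (b - 1) := by gcongr
  · filter_upwards [ae_restrict_mem measurableSet_ball] with y hy α _
    have hne : ((1 - ‖y‖ ^ 2 : ℝ) : ℂ) ≠ 0 := by exact_mod_cast (one_sub_sq_pos hy).ne'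
    have := ((((hasDerivAt_id α).sub_const 1).const_cpow (Or.inl hne))).mul_const (g y)
    simpa [mul_assoc] using this

/-- `s ↦ s₊ ^ β`. -/
noncomputable def posPow (β : ℂ) (s : ℝ) : ℂ := ((max s 0 : ℝ) : ℂ) ^ β

theorem posPow_continuous {β : ℂ} (hβ : 0 < β.re) : Continuous (posPow β) :=
  (Complex.continuous_ofReal_cpow_const hβ).comp (by fun_prop)

theorem posPow_hasDerivAt {α : ℂ} (hα : 1 < α.re) (s : ℝ) :
    HasDerivAt (posPow α) (α * posPow (α - 1) s) s := by
  have hα0 : α ≠ 0 := by rintro rfl; simp at hα; linarith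
  have hα1 : α - 1 ≠ 0 := by
    intro h
    have := congrArg Complex.re h
    simp at this
    linarith
  have key : ∀ t : ℝ, t ≠ 0 → HasDerivAt (posPow α) (α * posPow (α - 1) t) t := by
    intro t ht
    rcases lt_or_gt_of_ne ht with h | h
    · have e : posPow α =ᶠ[𝓝 t] fun _ => 0 := by
        filter_upwards [Iio_mem_nhds h] with r hr
        have : max r 0 = 0 := max_eq_right (le_of_lt hr)
        simp [posPow, this, hα0]
      have e2 : posPow (α - 1) t = 0 := by
        have : max t 0 = 0 := max_eq_right h.le
        simp [posPow, this, hα1]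
      rw [e2, mul_zero]
      exact (hasDerivAt_const t (0 : ℂ)).congr_of_eventuallyEq e
    · have e : posPow α =ᶠ[𝓝 t] fun r : ℝ => (r : ℂ) ^ α := by
        filter_upwards [Ioi_mem_nhds h] with r hr
        have : max r 0 = r := max_eq_left (le_of_lt hr)
        simp only [posPow, this]
      have e2 : posPow (α - 1) t = (t : ℂ) ^ (α - 1) := by
        have : max t 0 = t := max_eq_left h.le
        simp [posPow, this]
      rw [e2]
      exact (hasDerivAt_ofReal_cpow_const ht hα0).congr_of_eventuallyEq e
  rcases eq_or_ne s 0 with rfl | hs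
  · refine hasDerivAt_of_hasDerivAt_of_ne (fun y hy => key y hy) ?_ ?_
    · exact (posPow_continuous (by linarith)).continuousAt
    · exact (continuous_const.mul (posPow_continuous (by simp; linarith))).continuousAt
  · exact key s hs

theorem posPow_eq_ite {n : ℕ} {β : ℂ} (hβ : β ≠ 0) (y : EuclideanSpace ℝ (Fin n)) (z : ℂ) :
    posPow β (1 - ‖y‖ ^ 2) * z =
      (Metric.ball (0 : EuclideanSpace ℝ (Fin n)) 1).indicator
        (fun y => ((1 - ‖y‖ ^ 2 : ℝ) : ℂ) ^ β * z) y := by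
  by_cases hy : y ∈ Metric.ball (0 : EuclideanSpace ℝ (Fin n)) 1
  · rw [indicator_of_mem hy, posPow, max_eq_left (one_sub_sq_pos hy).le]
  · rw [indicator_of_notMem hy, posPow, max_eq_right]
    · simp [hβ]
    · rw [mem_ball_zero_iff, not_lt] at hy
      nlinarith

theorem ballAux_eq_integral {n : ℕ} {α : ℂ} (hα : α - 1 ≠ 0)
    (g : EuclideanSpace ℝ (Fin n) → ℂ) :
    ballAux n α g = ∫ y, posPow (α - 1) (1 - ‖y‖ ^ 2) * g y := by
  rw [ballAux, ← integral_indicator measurableSet_ball]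
  refine integral_congr_ae (Eventually.of_forall fun y => ?_)
  simp only [posPow_eq_ite hα]
  by_cases hy : y ∈ Metric.ball (0 : EuclideanSpace ℝ (Fin n)) 1
  · simp [indicator_of_mem hy]
  · simp [indicator_of_notMem hy]

theorem integrable_posPow {n : ℕ} {β : ℂ} (hβ : 0 < β.re)
    {h : EuclideanSpace ℝ (Fin n) → ℂ} (hh : Continuous h) :
    Integrable (fun y => posPow β (1 - ‖y‖ ^ 2) * h y) := by
  have hβ0 : β ≠ 0 := by rintro rfl; simp at hβ
  refine Continuous.integrable_of_hasCompactSupport ?_ ?_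
  · exact ((posPow_continuous hβ).comp (by fun_prop)).mul hh
  · refine HasCompactSupport.intro (isCompact_closedBall 0 1) fun y hy => ?_
    rw [posPow_eq_ite hβ0, indicator_of_notMem fun h' => hy (Metric.ball_subset_closedBall h')]

theorem ibp {n : ℕ} {α : ℂ} (hα : 1 < α.re) {g : EuclideanSpace ℝ (Fin n) → ℂ}
    (hg : ContDiff ℝ ∞ g) :
    ∫ y, posPow α (1 - ‖y‖ ^ 2) * (n * g y + fderiv ℝ g y y) =
      2 * α * ∫ y, posPow (α - 1) (1 - ‖y‖ ^ 2) * ((‖y‖ ^ 2 : ℝ) * g y) := by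
  have hre : 0 < (α - 1).re := by simp; linarith
  have hgd : Differentiable ℝ g := hg.differentiable (by simp)
  have hgc := hg.continuous
  have hg' : Continuous (fderiv ℝ g) := hg.continuous_fderiv (by simp)
  set u : EuclideanSpace ℝ (Fin n) → ℂ := fun y => posPow α (1 - ‖y‖ ^ 2) with hu
  have hud : ∀ y, HasFDerivAt u
      ((ContinuousLinearMap.toSpanSingleton ℝ (α * posPow (α - 1) (1 - ‖y‖ ^ 2))).comp
        (-(2 • (innerSL ℝ y)))) y := by
    intro y
    have h1 : HasFDerivAt (fun y : EuclideanSpace ℝ (Fin n) => 1 - ‖y‖ ^ 2)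
        (-(2 • (innerSL ℝ y))) y := by
      have := ((hasStrictFDerivAt_norm_sq y).hasFDerivAt).const_sub 1
      simpa using this
    exact (posPow_hasDerivAt hα (1 - ‖y‖ ^ 2)).hasFDerivAt.comp y h1
  have huf : ∀ y (i : Fin n), fderiv ℝ u y (EuclideanSpace.single i 1) =
      -(2 * α * posPow (α - 1) (1 - ‖y‖ ^ 2) * (y i : ℂ)) := by
    intro y i
    rw [(hud y).fderiv]
    simp [EuclideanSpace.inner_single_right]
    ring
  set v : Fin n → EuclideanSpace ℝ (Fin n) → ℂ := fun i y => (y i : ℂ) * g y with hv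
  have hvd : ∀ (i : Fin n) y, HasFDerivAt (v i)
      ((y i : ℂ) • fderiv ℝ g y + g y • (Complex.ofRealCLM.comp
        (EuclideanSpace.proj (𝕜 := ℝ) i))) y := by
    intro i y
    have h1 : HasFDerivAt (fun y : EuclideanSpace ℝ (Fin n) => ((y i : ℝ) : ℂ))
        (Complex.ofRealCLM.comp (EuclideanSpace.proj (𝕜 := ℝ) i)) y :=
      (Complex.ofRealCLM.comp (EuclideanSpace.proj (𝕜 := ℝ) i)).hasFDerivAt
    exact h1.mul (hgd y).hasFDerivAt
  have hvf : ∀ y (i : Fin n), fderiv ℝ (v i) y (EuclideanSpace.single i 1) =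
      (y i : ℂ) * fderiv ℝ g y (EuclideanSpace.single i 1) + g y := by
    intro y i
    rw [(hvd i y).fderiv]
    simp
  have step : ∀ i : Fin n,
      ∫ y, u y * ((y i : ℂ) * fderiv ℝ g y (EuclideanSpace.single i 1) + g y) =
        2 * α * ∫ y, posPow (α - 1) (1 - ‖y‖ ^ 2) * ((y i : ℂ) ^ 2 * g y) := by
    intro i
    have i1 : Integrable (fun y => fderiv ℝ u y (EuclideanSpace.single i 1) * v i y) := by
      simp only [huf, hv]
      have := (integrable_posPow (n := n) hre
        (h := fun y => (y i : ℂ) * ((y i : ℂ) * g y)) (by fun_prop)).const_mul (-(2 * α))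
      refine this.congr (Eventually.of_forall fun y => ?_)
      simp only
      ring
    have i2 : Integrable (fun y => u y * fderiv ℝ (v i) y (EuclideanSpace.single i 1)) := by
      simp only [hvf]
      exact integrable_posPow (by linarith) (by fun_prop)
    have i3 : Integrable (fun y => u y * v i y) :=
      integrable_posPow (by linarith) (by fun_prop)
    have := integral_mul_fderiv_eq_neg_fderiv_mul_of_integrable i1 i2 i3
      (fun x _ => (hud x).differentiableAt) (fun x _ => (hvd i x).differentiableAt)
    simp only [hvf, huf] at this
    rw [this, ← integral_neg, ← integral_const_mul]
    refine integral_congr_ae (Eventually.of_forall fun y => ?_)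
    simp only [hv]
    ring
  have hsum : ∀ y : EuclideanSpace ℝ (Fin n),
      y = ∑ i, y i • (EuclideanSpace.single i (1 : ℝ)) := by
    intro y
    ext j
    simp [Pi.single_apply]
  have L : ∀ y, posPow α (1 - ‖y‖ ^ 2) * (n * g y + fderiv ℝ g y y) =
      ∑ i : Fin n, u y * ((y i : ℂ) * fderiv ℝ g y (EuclideanSpace.single i 1) + g y) := by
    intro y
    rw [← Finset.mul_sum, Finset.sum_add_distrib]
    have : fderiv ℝ g y y = ∑ i, (y i : ℂ) * fderiv ℝ g y (EuclideanSpace.single i 1) := by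
      have h := congrArg (fderiv ℝ g y) (hsum y)
      rw [map_sum] at h
      rw [h]
      simp
    rw [this, Finset.sum_const, Finset.card_univ, Fintype.card_fin, nsmul_eq_mul]
    simp only [hu]
    ring
  have R : ∀ y, posPow (α - 1) (1 - ‖y‖ ^ 2) * ((‖y‖ ^ 2 : ℝ) * g y) =
      ∑ i : Fin n, posPow (α - 1) (1 - ‖y‖ ^ 2) * ((y i : ℂ) ^ 2 * g y) := by
    intro y
    rw [← Finset.mul_sum, ← Finset.sum_mul, EuclideanSpace.norm_sq_eq]
    simp
  simp only [L, R]
  rw [integral_finsetSum, integral_finsetSum, Finset.mul_sum]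
  · exact Finset.sum_congr rfl fun i _ => step i
  · intro i _
    exact integrable_posPow hre (by fun_prop)
  · intro i _
    exact integrable_posPow (by linarith) (by fun_prop)

theorem ballAux_rec {n : ℕ} {α : ℂ} (hα : 1 < α.re) {g : EuclideanSpace ℝ (Fin n) → ℂ}
    (hg : ContDiff ℝ ∞ g) :
    n * ballAux n (α + 1) g + ballAux n (α + 1) (fun y => fderiv ℝ g y y) =
      2 * α * (ballAux n α g - ballAux n (α + 1) g) := by
  have hre : 0 < (α - 1).re := by simp; linarith
  have hα0 : α ≠ 0 := by rintro rfl; simp at hα; linarith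
  have hα1 : α - 1 ≠ 0 := by intro h; rw [h] at hre; simp at hre
  have hgc := hg.continuous
  have hg' : Continuous (fderiv ℝ g) := hg.continuous_fderiv (by simp)
  have hα2 : α + 1 - 1 ≠ 0 := by simpa using hα0
  simp only [ballAux_eq_integral hα1, ballAux_eq_integral hα2, add_sub_cancel_right]
  have h := ibp hα hg
  have e1 : ∫ y, posPow α (1 - ‖y‖ ^ 2) * (n * g y + fderiv ℝ g y y) =
      n * (∫ y, posPow α (1 - ‖y‖ ^ 2) * g y) +
        ∫ y, posPow α (1 - ‖y‖ ^ 2) * fderiv ℝ g y y := by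
    rw [← integral_const_mul, ← integral_add]
    · refine integral_congr_ae (Eventually.of_forall fun y => ?_)
      simp only
      ring
    · exact (integrable_posPow (by linarith) hgc).const_mul _
    · exact integrable_posPow (by linarith) (by fun_prop)
  have e2 : ∫ y, posPow (α - 1) (1 - ‖y‖ ^ 2) * ((‖y‖ ^ 2 : ℝ) * g y) =
      (∫ y, posPow (α - 1) (1 - ‖y‖ ^ 2) * g y) - ∫ y, posPow α (1 - ‖y‖ ^ 2) * g y := by
    rw [← integral_sub]
    · refine integral_congr_ae (Eventually.of_forall fun y => ?_)
      simp only [posPow_eq_ite hα0, posPow_eq_ite hα1]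
      by_cases hy : y ∈ Metric.ball (0 : EuclideanSpace ℝ (Fin n)) 1
      · simp only [indicator_of_mem hy]
        have hne : ((1 - ‖y‖ ^ 2 : ℝ) : ℂ) ≠ 0 := by exact_mod_cast (one_sub_sq_pos hy).ne'
        rw [Complex.cpow_sub _ _ hne, Complex.cpow_one]
        field_simp
        push_cast
        ring
      · simp only [indicator_of_notMem hy, sub_zero]
    · exact integrable_posPow hre hgc
    · exact integrable_posPow (by linarith) hgc
  rw [← e1, h, e2]

theorem ballIntegral_rec {n : ℕ} {α : ℂ} (hα : 1 < α.re)
    {g : EuclideanSpace ℝ (Fin n) → ℂ} (hg : ContDiff ℝ ∞ g) :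
    ballIntegral n α g = (n / 2 + α) * ballIntegral n (α + 1) g +
      1 / 2 * ballIntegral n (α + 1) (fun y => fderiv ℝ g y y) := by
  have hα0 : α ≠ 0 := by rintro rfl; simp at hα; linarith
  have hΓ : Complex.Gamma α ≠ 0 := Complex.Gamma_ne_zero_of_re_pos (by linarith)
  simp only [ballIntegral_eq, Complex.Gamma_add_one α hα0]
  have := ballAux_rec hα hg
  field_simp
  linear_combination (-1 : ℂ) * this

theorem isOpen_halfPlane (a : ℝ) : IsOpen {α : ℂ | a < α.re} :=
  isOpen_lt continuous_const Complex.continuous_re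

theorem eqOn_halfPlane {a b : ℝ} {F G : ℂ → ℂ}
    (hF : DifferentiableOn ℂ F {α | a < α.re}) (hG : DifferentiableOn ℂ G {α | a < α.re})
    (h : ∀ α : ℂ, b < α.re → F α = G α) : EqOn F G {α | a < α.re} := by
  set z : ℂ := ((max a b + 1 : ℝ) : ℂ) with hz
  have hza : a < z.re := by simp [hz]; linarith [le_max_left a b]
  have hzb : b < z.re := by simp [hz]; linarith [le_max_right a b]
  refine (hF.analyticOnNhd (isOpen_halfPlane a)).eqOn_of_preconnected_of_eventuallyEq
    (hG.analyticOnNhd (isOpen_halfPlane a)) (convex_halfSpace_re_gt a).isPreconnected hza ?_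
  filter_upwards [(isOpen_halfPlane b).mem_nhds hzb] with α hα using h α hα

theorem ballIntegral_differentiableOn {n : ℕ} {g : EuclideanSpace ℝ (Fin n) → ℂ}
    (hg : Continuous g) : DifferentiableOn ℂ (fun α => ballIntegral n α g) {α | 0 < α.re} := by
  intro α hα
  simp only [ballIntegral_eq]
  exact ((Complex.differentiable_one_div_Gamma α).mul
    (ballAux_differentiableAt hα hg)).differentiableWithinAt

theorem exists_halfPlane {n : ℕ} (k : ℕ) : ∀ g : EuclideanSpace ℝ (Fin n) → ℂ,
    ContDiff ℝ ∞ g → ∃ F : ℂ → ℂ, DifferentiableOn ℂ F {α | -(k : ℝ) < α.re} ∧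
      ∀ α : ℂ, 0 < α.re → F α = ballIntegral n α g := by
  induction k with
  | zero =>
    intro g hg
    exact ⟨fun α => ballIntegral n α g,
      by simpa using ballIntegral_differentiableOn hg.continuous, fun _ _ => rfl⟩
  | succ k ih =>
    intro g hg
    have hEg : ContDiff ℝ ∞ (fun y => fderiv ℝ g y y) :=
      (hg.fderiv_right (m := ∞) (by simp)).clm_apply contDiff_id
    obtain ⟨F₁, hF₁, e₁⟩ := ih g hg
    obtain ⟨F₂, hF₂, e₂⟩ := ih _ hEg
    have hmap : MapsTo (fun α : ℂ => α + 1) {α | -((k + 1 : ℕ) : ℝ) < α.re}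
        {α | -(k : ℝ) < α.re} := by
      intro α hα
      simp at hα ⊢
      linarith
    have hd : DifferentiableOn ℂ
        (fun α : ℂ => (n / 2 + α) * F₁ (α + 1) + 1 / 2 * F₂ (α + 1))
        {α | -((k + 1 : ℕ) : ℝ) < α.re} := by
      have hF₁' := hF₁.comp (f := fun α : ℂ => α + 1) (by fun_prop) hmap
      have hF₂' := hF₂.comp (f := fun α : ℂ => α + 1) (by fun_prop) hmap
      exact (DifferentiableOn.mul (by fun_prop) hF₁').add (hF₂'.const_mul (1 / 2))
    refine ⟨_, hd, ?_⟩
    refine eqOn_halfPlane (a := 0) (b := 1) (hd.mono fun α hα => ?_)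
      (ballIntegral_differentiableOn hg.continuous) fun α hα => ?_
    · simp only [mem_ofPred_eq] at hα ⊢
      push_cast
      linarith [(Nat.cast_nonneg k : (0 : ℝ) ≤ k)]
    · have hre : 0 < (α + 1).re := by simp; linarith
      rw [e₁ _ hre, e₂ _ hre, ballIntegral_rec hα hg]

/-- For smooth `g`, the function `α ↦ Γ(α)⁻¹ ∫_{|y| ≤ 1} (1 - |y|²)^{α - 1} g(y) dy` on
`Re α > 0` has an analytic continuation to the whole complex plane. -/
theorem exists_continuation {n : ℕ} {g : EuclideanSpace ℝ (Fin n) → ℂ}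
    (hg : ContDiff ℝ ∞ g) :
    ∃ F : ℂ → ℂ, Differentiable ℂ F ∧ ∀ α : ℂ, 0 < α.re → F α = ballIntegral n α g := by
  choose F hF e using fun k : ℕ => exists_halfPlane (n := n) k g hg
  have hle : ∀ (k l : ℕ) (α : ℂ), -(k : ℝ) < α.re → -(l : ℝ) < α.re → F k α = F l α := by
    intro k l α hk hl
    have key : EqOn (F k) (F l) {α : ℂ | max (-(k : ℝ)) (-(l : ℝ)) < α.re} :=
      eqOn_halfPlane (b := 0)
        ((hF k).mono fun z (hz : max (-(k : ℝ)) (-(l : ℝ)) < z.re) =>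
          show -(k : ℝ) < z.re from lt_of_le_of_lt (le_max_left _ _) hz)
        ((hF l).mono fun z (hz : max (-(k : ℝ)) (-(l : ℝ)) < z.re) =>
          show -(l : ℝ) < z.re from lt_of_le_of_lt (le_max_right _ _) hz)
        fun z hz => by rw [e k z hz, e l z hz]
    exact key (show max (-(k : ℝ)) (-(l : ℝ)) < α.re from max_lt hk hl)
  have hN : ∀ α : ℂ, -((⌈-α.re⌉₊ + 1 : ℕ) : ℝ) < α.re := by
    intro α
    have := Nat.le_ceil (-α.re)
    push_cast
    linarith
  refine ⟨fun α => F (⌈-α.re⌉₊ + 1) α, fun α => ?_, fun α hα => e _ α hα⟩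
  have hop := (isOpen_halfPlane (-((⌈-α.re⌉₊ + 1 : ℕ) : ℝ))).mem_nhds (hN α)
  refine ((hF (⌈-α.re⌉₊ + 1)).differentiableAt hop).congr_of_eventuallyEq ?_
  filter_upwards [hop] with z hz using hle _ _ z (hN z) hz

end SteinMeans

/-- `n`-dimensional Euclidean space. -/
abbrev En (n : ℕ) : Type := EuclideanSpace ℝ (Fin n)

/-- Stein's spherical mean for `Re α > 0`:
`Γ(α)⁻¹ ∫_{|y| ≤ 1} (1 - |y|²)^{α - 1} f(x - t y) dy`. -/
noncomputable def steinIntegral (n : ℕ) (α : ℂ) (t : ℝ) (f : En n → ℂ) (x : En n) : ℂ :=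
  (Complex.Gamma α)⁻¹ *
    ∫ y in Metric.closedBall (0 : En n) 1, ((1 - ‖y‖ ^ 2 : ℝ) : ℂ) ^ (α - 1) * f (x - t • y)

/-- For `f` Schwartz, `α ↦ steinIntegral n α t f x` extends from `Re α > 0` to an entire
function. -/
theorem steinIntegral_exists_continuation (n : ℕ) (t : ℝ) (f : 𝓢(En n, ℂ)) (x : En n) :
    ∃ F : ℂ → ℂ, Differentiable ℂ F ∧ ∀ α : ℂ, 0 < α.re → F α = steinIntegral n α t f x :=
  SteinMeans.exists_continuation (g := fun y => f (x - t • y))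
    ((f.smooth _).comp (contDiff_const.sub (contDiff_id.const_smul t)))

/-- Stein's spherical mean `𝔐^α_t f(x)` of complex order `α`: the value at `α` of the (unique)
entire function of the order variable that agrees with `steinIntegral` on `Re α > 0`. -/
noncomputable def steinMean (n : ℕ) (α : ℂ) (t : ℝ) (f : 𝓢(En n, ℂ)) (x : En n) : ℂ :=
  Classical.choose (steinIntegral_exists_continuation n t f x) α

theorem steinMean_differentiable (n : ℕ) (t : ℝ) (f : 𝓢(En n, ℂ)) (x : En n) :
    Differentiable ℂ fun α => steinMean n α t f x :=
  (Classical.choose_spec (steinIntegral_exists_continuation n t f x)).1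

theorem steinMean_eq (n : ℕ) {α : ℂ} (hα : 0 < α.re) (t : ℝ) (f : 𝓢(En n, ℂ)) (x : En n) :
    steinMean n α t f x = steinIntegral n α t f x :=
  (Classical.choose_spec (steinIntegral_exists_continuation n t f x)).2 α hα

/-- The local maximal function `sup_{t ∈ [1,2]} |𝔐^α_t f(x)|`, with values in `[0, ∞]`. -/
noncomputable def localSteinMaximal (n : ℕ) (α : ℂ) (f : 𝓢(En n, ℂ)) (x : En n) : ℝ≥0∞ :=
  ⨆ t ∈ Icc (1 : ℝ) 2, ‖steinMean n α t f x‖ₑ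

/-- `1 / p` as a real number, with `1 / ∞ = 0`. -/
noncomputable def recip (p : ℝ≥0∞) : ℝ := (p⁻¹).toReal

/-- `σ_n(p,q) = max {1/p - n/q, (n+1)/(2p) - (n-1)/2 (1/q + 1), n/p - n + 1}`. -/
noncomputable def steinSigma (n : ℕ) (p q : ℝ≥0∞) : ℝ :=
  max (recip p - n * recip q)
    (max (((n : ℝ) + 1) / 2 * recip p - ((n : ℝ) - 1) / 2 * (recip q + 1))
      (n * recip p - n + 1))

/-!
Each inequality is obtained by testing the maximal estimate on one family of functions and comparing
powers of a small parameter `δ` (or, for `p ≤ q`, of a large number of translates).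

The spherical mean of `f` at `x` is the ball mean `ballMean` of `y ↦ f (x - t y)`, whose order `α`
may have very negative real part. Two recursions, entire in `α`, give access to it: `ballMean_euler`,
with the Euler operator, and `ballMean_laplacian`, with the Laplacian. They express a mean of order
`α` by means of higher order, which are absolutely convergent integrals. The test functions are
exponentials in the variable that measures the distance to the sphere, because the continued
distribution `s₊ ^ (α - 1) / Γ(α)` takes the value `1` on `exp (-s)` for every `α`: the leading
coefficient never vanishes, whatever the order. Cutoffs that make the functions Schwartz are placed
where the relevant balls do not see them.

* `re_ge_of_shell`: for `exp (-(1 - |z|²) / δ)`, of mass `δ`, the mean with `t = 1` has size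
  `δ ^ Re α` on a ball of radius comparable to `δ` about the origin. The Euler recursion shows that
  orders `α` and `α + 1` have the same normalized limit (`shellMean_sub_succ`), and for large `Re α`
  the limit is computed in polar coordinates.
* `re_ge_of_knapp` and `re_ge_of_bump`: for the plates `exp (-z₀ / δ) b(z' / ε)`, of mass
  `δ ε ^ (n - 1)`, the mean has size `δ ^ Re α * ε ^ (n - 1)` at every `x` for which a sphere of
  radius `t ∈ [1, 2]` about `x` is nearly tangent to the plate (`plateMean_lower`). With `ε = √δ`
  such `x` fill a tube of length `1` and width `√δ`; with `ε` a large multiple of `δ` they fill a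
  set of fixed size. Both regimes are covered by one limit theorem, `normalizedPlateMean_tendsto`:
  its case `Re α > 1` is continuity of an explicit integral in its parameters, and the Laplacian
  recursion extends it to all `α`, since `∂₀²` reproduces a plate and the other derivatives cost only
  `(δ / ε)²`.
* `recip_le_of_translates`: the ball means are local, so `N` far translates of one plate act
  independently, and `N ^ (1 / q)` is bounded by a multiple of `N ^ (1 / p)`.
-/

namespace SteinMeans

variable {n m : ℕ}

/-! ### The analytically continued ball average and its recursions -/

open scoped Classical in
/-- The value at `α` of the entire function extending `α ↦ ballIntegral n α g` from `Re α > 0`;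
the junk value is `0` if `g` is not smooth. -/
noncomputable def ballMean (n : ℕ) (α : ℂ) (g : En n → ℂ) : ℂ :=
  if h : ContDiff ℝ ∞ g then Classical.choose (exists_continuation h) α else 0

theorem ballMean_differentiable {g : En n → ℂ} (hg : ContDiff ℝ ∞ g) :
    Differentiable ℂ fun α => ballMean n α g := by
  simp only [ballMean, dif_pos hg]
  exact (Classical.choose_spec (exists_continuation hg)).1

theorem ballMean_eq {g : En n → ℂ} (hg : ContDiff ℝ ∞ g) {α : ℂ} (hα : 0 < α.re) :
    ballMean n α g = ballIntegral n α g := by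
  simp only [ballMean, dif_pos hg]
  exact (Classical.choose_spec (exists_continuation hg)).2 α hα

/-- Entire functions that agree on `Re α > 1` are equal. -/
theorem entire_ext {F G : ℂ → ℂ} (hF : Differentiable ℂ F) (hG : Differentiable ℂ G)
    (h : ∀ α : ℂ, 1 < α.re → F α = G α) (α : ℂ) : F α = G α :=
  eqOn_halfPlane (a := α.re - 1) (b := 1) hF.differentiableOn hG.differentiableOn h
    (show α.re - 1 < α.re by linarith)

theorem ballMean_eq_integral {g : En n → ℂ} (hg : ContDiff ℝ ∞ g) {α : ℂ} (hα : 1 < α.re) :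
    ballMean n α g = (Complex.Gamma α)⁻¹ * ∫ y, posPow (α - 1) (1 - ‖y‖ ^ 2) * g y := by
  rw [ballMean_eq hg (by linarith), ballIntegral_eq, ballAux_eq_integral]
  intro h
  have := congrArg Complex.re h
  simp at this
  linarith

theorem ballMean_congr {g h : En n → ℂ} (hg : ContDiff ℝ ∞ g) (hh : ContDiff ℝ ∞ h)
    (e : ∀ y, ‖y‖ ≤ 1 → g y = h y) (α : ℂ) : ballMean n α g = ballMean n α h := by
  refine entire_ext (ballMean_differentiable hg) (ballMean_differentiable hh) (fun α hα => ?_) α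
  rw [ballMean_eq hg (by linarith), ballMean_eq hh (by linarith), ballIntegral, ballIntegral]
  congr 1
  refine setIntegral_congr_fun Metric.isClosed_closedBall.measurableSet fun y hy => ?_
  simp only [e y (by simpa using hy)]

theorem integrable_posPow_mul {α : ℂ} (hα : 1 < α.re) {g : En n → ℂ} (hg : Continuous g) :
    Integrable fun y => posPow (α - 1) (1 - ‖y‖ ^ 2) * g y :=
  integrable_posPow (by simpa using hα) hg

theorem ballMean_add {g h : En n → ℂ} (hg : ContDiff ℝ ∞ g) (hh : ContDiff ℝ ∞ h) (α : ℂ) :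
    ballMean n α (fun y => g y + h y) = ballMean n α g + ballMean n α h := by
  refine entire_ext (ballMean_differentiable (hg.add hh))
    ((ballMean_differentiable hg).add (ballMean_differentiable hh)) (fun α hα => ?_) α
  rw [Pi.add_apply, ballMean_eq_integral (hg.add hh) hα, ballMean_eq_integral hg hα,
    ballMean_eq_integral hh hα, ← mul_add, ← integral_add (integrable_posPow_mul hα hg.continuous)
    (integrable_posPow_mul hα hh.continuous)]
  simp only [mul_add]

theorem ballMean_const_mul {g : En n → ℂ} (hg : ContDiff ℝ ∞ g) (c α : ℂ) :
    ballMean n α (fun y => c * g y) = c * ballMean n α g := by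
  have hcg : ContDiff ℝ ∞ fun y => c * g y := contDiff_const.mul hg
  refine entire_ext (ballMean_differentiable hcg)
    ((ballMean_differentiable hg).const_mul c) (fun α hα => ?_) α
  rw [ballMean_eq_integral hcg hα, ballMean_eq_integral hg hα, mul_left_comm c,
    ← integral_const_mul c]
  congr 2
  funext y
  ring

theorem ballMean_sum {ι : Type*} (s : Finset ι) {g : ι → En n → ℂ}
    (hg : ∀ i, ContDiff ℝ ∞ (g i)) (α : ℂ) :
    ballMean n α (fun y => ∑ i ∈ s, g i y) = ∑ i ∈ s, ballMean n α (g i) := by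
  classical
  induction s using Finset.induction_on with
  | empty =>
    simpa using ballMean_const_mul (n := n) (g := fun _ => 0) contDiff_const 0 α
  | insert a s ha ih =>
    simp only [Finset.sum_insert ha]
    rw [ballMean_add (hg a) (ContDiff.sum fun i _ => hg i), ih]

theorem steinMean_eq_ballMean (α : ℂ) (t : ℝ) (f : 𝓢(En n, ℂ)) (x : En n) :
    steinMean n α t f x = ballMean n α (fun y => f (x - t • y)) := by
  have hf : ContDiff ℝ ∞ fun y : En n => f (x - t • y) :=
    (f.smooth _).comp (contDiff_const.sub (contDiff_id.const_smul t))
  refine entire_ext (steinMean_differentiable n t f x) (ballMean_differentiable hf)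
    (fun α hα => ?_) α
  rw [steinMean_eq n (by linarith), ballMean_eq hf (by linarith), steinIntegral, ballIntegral]

theorem contDiff_euler {g : En n → ℂ} (hg : ContDiff ℝ ∞ g) :
    ContDiff ℝ ∞ fun y => fderiv ℝ g y y :=
  (hg.fderiv_right (m := ∞) (by simp)).clm_apply contDiff_id

theorem contDiff_partial {g : En n → ℂ} (hg : ContDiff ℝ ∞ g) (v : En n) :
    ContDiff ℝ ∞ fun y => fderiv ℝ g y v :=
  (hg.fderiv_right (m := ∞) (by simp)).clm_apply contDiff_const

theorem differentiable_ballMean_add {g : En n → ℂ} (hg : ContDiff ℝ ∞ g) (c : ℂ) :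
    Differentiable ℂ fun α => ballMean n (α + c) g :=
  (ballMean_differentiable hg).comp (differentiable_id.add_const c)

/-- Recursion with the Euler operator `g ↦ y · ∇g(y)`, from integration by parts. -/
theorem ballMean_euler {g : En n → ℂ} (hg : ContDiff ℝ ∞ g) (α : ℂ) :
    ballMean n α g = (n / 2 + α) * ballMean n (α + 1) g +
      1 / 2 * ballMean n (α + 1) (fun y => fderiv ℝ g y y) := by
  refine entire_ext (ballMean_differentiable hg) (G := fun α => (n / 2 + α) * ballMean n (α + 1) g +
      1 / 2 * ballMean n (α + 1) (fun y => fderiv ℝ g y y)) ?_ (fun α hα => ?_) α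
  · exact ((differentiable_const _).add differentiable_id).mul (differentiable_ballMean_add hg 1)
      |>.add ((differentiable_ballMean_add (contDiff_euler hg) 1).const_mul _)
  · have h0 : 0 < α.re := by linarith
    have h1 : 0 < (α + 1).re := by simp; linarith
    simp only [ballMean_eq hg h0, ballMean_eq hg h1, ballMean_eq (contDiff_euler hg) h1]
    exact ballIntegral_rec hα hg

theorem integral_posPow_partial {α : ℂ} (hα : 1 < α.re) {h : En n → ℂ} (hh : ContDiff ℝ ∞ h)
    (i : Fin n) :
    ∫ y : En n, posPow α (1 - ‖y‖ ^ 2) * fderiv ℝ h y (EuclideanSpace.single i 1) =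
      2 * α * ∫ y : En n, posPow (α - 1) (1 - ‖y‖ ^ 2) * ((y i : ℂ) * h y) := by
  have hre : 0 < (α - 1).re := by simp; linarith
  set u : En n → ℂ := fun y => posPow α (1 - ‖y‖ ^ 2) with hu
  have hud : ∀ y, HasFDerivAt u
      ((ContinuousLinearMap.toSpanSingleton ℝ (α * posPow (α - 1) (1 - ‖y‖ ^ 2))).comp
        (-(2 • (innerSL ℝ y)))) y := by
    intro y
    have h1 : HasFDerivAt (fun y : En n => 1 - ‖y‖ ^ 2) (-(2 • (innerSL ℝ y))) y := by
      have := ((hasStrictFDerivAt_norm_sq y).hasFDerivAt).const_sub 1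
      simpa using this
    exact (posPow_hasDerivAt hα (1 - ‖y‖ ^ 2)).hasFDerivAt.comp y h1
  have huf : ∀ y, fderiv ℝ u y (EuclideanSpace.single i 1) =
      -(2 * α * posPow (α - 1) (1 - ‖y‖ ^ 2) * (y i : ℂ)) := by
    intro y
    rw [(hud y).fderiv]
    simp [EuclideanSpace.inner_single_right]
    ring
  have hhc := hh.continuous
  have hhd : Differentiable ℝ h := hh.differentiable (by simp)
  have i1 : Integrable (fun y => fderiv ℝ u y (EuclideanSpace.single i 1) * h y) := by
    simp only [huf]
    have := (integrable_posPow (n := n) hre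
      (h := fun y => (y i : ℂ) * h y) (by fun_prop)).const_mul (-(2 * α))
    refine this.congr (Eventually.of_forall fun y => ?_)
    simp only
    ring
  have := integral_mul_fderiv_eq_neg_fderiv_mul_of_integrable i1
    (integrable_posPow (by linarith) (contDiff_partial hh _).continuous)
    (integrable_posPow (by linarith) hhc)
    (fun x _ => (hud x).differentiableAt) (fun x _ => (hhd x))
  simp only [huf] at this
  rw [this, ← integral_neg, ← integral_const_mul]
  refine integral_congr_ae (Eventually.of_forall fun y => ?_)
  simp only
  ring

theorem contDiff_coord (i : Fin n) : ContDiff ℝ ∞ fun y : En n => (y i : ℂ) :=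
  (Complex.ofRealCLM.comp (EuclideanSpace.proj (𝕜 := ℝ) i)).contDiff

/-- Multiplication by a coordinate raises the order by one, at the price of a derivative. -/
theorem ballMean_coord_mul {h : En n → ℂ} (hh : ContDiff ℝ ∞ h) (i : Fin n) (α : ℂ) :
    ballMean n α (fun y => (y i : ℂ) * h y) =
      1 / 2 * ballMean n (α + 1) (fun y => fderiv ℝ h y (EuclideanSpace.single i 1)) := by
  have hp := contDiff_partial hh (EuclideanSpace.single i 1)
  have hm := (contDiff_coord i).mul hh
  refine entire_ext (ballMean_differentiable hm) (G := fun α => 1 / 2 * ballMean n (α + 1)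
    (fun y => fderiv ℝ h y (EuclideanSpace.single i 1)))
    ((differentiable_ballMean_add hp 1).const_mul _) (fun α hα => ?_) α
  have h1 : 1 < (α + 1).re := by simp; linarith
  have hα0 : α ≠ 0 := by rintro rfl; simp at hα; linarith
  have hΓ : Complex.Gamma α ≠ 0 := Complex.Gamma_ne_zero_of_re_pos (by linarith)
  simp only [ballMean_eq_integral hm hα, ballMean_eq_integral hp h1, add_sub_cancel_right,
    integral_posPow_partial hα hh, Complex.Gamma_add_one α hα0]
  field_simp

/-- Recursion with the Laplacian in place of the Euler operator. -/
theorem ballMean_laplacian {g : En n → ℂ} (hg : ContDiff ℝ ∞ g) (α : ℂ) :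
    ballMean n α g = (n / 2 + α) * ballMean n (α + 1) g +
      1 / 4 * ∑ i, ballMean n (α + 2) (fun y =>
        fderiv ℝ (fun z => fderiv ℝ g z (EuclideanSpace.single i 1)) y
          (EuclideanSpace.single i 1)) := by
  have hsum : ∀ y : En n, fderiv ℝ g y y =
      ∑ i, (y i : ℂ) * fderiv ℝ g y (EuclideanSpace.single i 1) := by
    intro y
    have e : y = ∑ i, y i • (EuclideanSpace.single i (1 : ℝ)) := by
      ext j
      simp [Pi.single_apply]
    have h := congrArg (fderiv ℝ g y) e
    rw [map_sum] at h
    rw [h]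
    simp
  have hp := fun i : Fin n => contDiff_partial hg (EuclideanSpace.single i 1)
  rw [ballMean_euler hg α]
  simp only [hsum]
  rw [ballMean_sum _ fun i => (contDiff_coord i).mul (hp i)]
  simp only [ballMean_coord_mul (hp _), ← Finset.mul_sum]
  rw [show α + 1 + 1 = α + 2 by ring, ← mul_assoc]
  norm_num

theorem posPow_succ {α : ℂ} (hα : α ≠ 0) (hα1 : α + 1 ≠ 0) (s : ℝ) :
    posPow (α + 1) s = (s : ℂ) * posPow α s := by
  rcases le_or_gt s 0 with h | h
  · simp [posPow, max_eq_right h, hα, hα1]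
  · have h' : (s : ℂ) ≠ 0 := by exact_mod_cast h.ne'
    rw [posPow, posPow, max_eq_left h.le, Complex.cpow_add _ _ h', Complex.cpow_one, mul_comm]

theorem contDiff_normSq : ContDiff ℝ ∞ fun y : En n => ((‖y‖ ^ 2 : ℝ) : ℂ) :=
  Complex.ofRealCLM.contDiff.comp (contDiff_norm_sq ℝ)

theorem ballMean_normSq_mul {g : En n → ℂ} (hg : ContDiff ℝ ∞ g) (α : ℂ) :
    ballMean n α (fun y => ((‖y‖ ^ 2 : ℝ) : ℂ) * g y) =
      ballMean n α g - α * ballMean n (α + 1) g := by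
  have hm := contDiff_normSq.mul hg
  refine entire_ext (ballMean_differentiable hm) (G := fun α => ballMean n α g -
      α * ballMean n (α + 1) g) ((ballMean_differentiable hg).sub
      (differentiable_id.mul (differentiable_ballMean_add hg 1))) (fun α hα => ?_) α
  have h1 : 1 < (α + 1).re := by simp; linarith
  have hα0 : α ≠ 0 := by rintro rfl; simp at hα; linarith
  have hα1 : α - 1 ≠ 0 := by
    intro h
    have := congrArg Complex.re h
    simp at this
    linarith
  have hΓ : Complex.Gamma α ≠ 0 := Complex.Gamma_ne_zero_of_re_pos (by linarith)
  simp only [ballMean_eq_integral hm hα, ballMean_eq_integral hg hα, ballMean_eq_integral hg h1,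
    Complex.Gamma_add_one α hα0]
  have e : ∫ y : En n, posPow (α - 1) (1 - ‖y‖ ^ 2) * (((‖y‖ ^ 2 : ℝ) : ℂ) * g y) =
      (∫ y, posPow (α - 1) (1 - ‖y‖ ^ 2) * g y) -
        ∫ y, posPow (α + 1 - 1) (1 - ‖y‖ ^ 2) * g y := by
    rw [← integral_sub (integrable_posPow_mul hα hg.continuous)
      (integrable_posPow_mul h1 hg.continuous)]
    refine integral_congr_ae (Eventually.of_forall fun y => ?_)
    simp only
    rw [show α + 1 - 1 = α - 1 + 1 by ring, posPow_succ hα1 (by simpa using hα0)]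
    push_cast
    ring
  rw [e]
  field_simp

/-! ### Testing the maximal inequality -/

theorem recip_eq (p : ℝ≥0∞) : recip p = 1 / p.toReal := by
  rw [recip, ENNReal.toReal_inv, one_div]

theorem recip_nonneg (p : ℝ≥0∞) : 0 ≤ recip p := ENNReal.toReal_nonneg

/-- A function bounded by `K ≥ 1` with `L¹` norm at most `I` has `Lᵖ` norm at most
`K I ^ (1 / p)`. -/
theorem eLpNorm_le_of_bound {X : Type*} [MeasurableSpace X] {μ : Measure X} {p : ℝ≥0∞}
    (hp : 1 ≤ p) {f : X → ℂ} {K I : ℝ} (hK : 1 ≤ K) (hI : 0 < I) (hfK : ∀ y, ‖f y‖ ≤ K)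
    (hfI : ∫⁻ y, ‖f y‖ₑ ∂μ ≤ ENNReal.ofReal I) :
    eLpNorm f p μ ≤ ENNReal.ofReal (K * I ^ recip p) := by
  have hfK' : ∀ y, ‖f y‖ₑ ≤ ENNReal.ofReal K := fun y => by
    rw [← ofReal_norm]
    exact ENNReal.ofReal_le_ofReal (hfK y)
  rcases eq_or_ne p ∞ with rfl | hpt
  · simp only [recip, ENNReal.inv_top, ENNReal.toReal_zero, Real.rpow_zero, mul_one,
      eLpNorm_exponent_top]
    exact eLpNormEssSup_le_of_ae_enorm_bound (Eventually.of_forall hfK')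
  have hp0 : p ≠ 0 := (zero_lt_one.trans_le hp).ne'
  have hr : 1 ≤ p.toReal := by
    simpa using (ENNReal.toReal_le_toReal ENNReal.one_ne_top hpt).2 hp
  have hr0 : 0 < p.toReal := by linarith
  rw [eLpNorm_eq_lintegral_rpow_enorm_toReal hp0 hpt, recip_eq,
    ENNReal.ofReal_mul (by linarith), ← ENNReal.ofReal_rpow_of_pos hI]
  have key : ∫⁻ y, ‖f y‖ₑ ^ p.toReal ∂μ ≤ ENNReal.ofReal K ^ p.toReal * ENNReal.ofReal I := by
    refine le_trans ?_ (mul_le_mul_right hfI _)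
    rw [← lintegral_const_mul' _ _ (ENNReal.rpow_ne_top_of_nonneg hr0.le ENNReal.ofReal_ne_top)]
    refine lintegral_mono fun y => ?_
    have e : ‖f y‖ₑ ^ p.toReal = ‖f y‖ₑ ^ (p.toReal - 1) * ‖f y‖ₑ := by
      conv_rhs => rw [← ENNReal.rpow_one (‖f y‖ₑ)]
      rw [← ENNReal.rpow_mul, one_mul, ← ENNReal.rpow_add_of_nonneg _ _ (by linarith) (by simp)]
      congr 1
      ring
    simp only
    rw [e]
    gcongr
    calc ‖f y‖ₑ ^ (p.toReal - 1) ≤ ENNReal.ofReal K ^ (p.toReal - 1) :=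
          ENNReal.rpow_le_rpow (hfK' y) (by linarith)
      _ ≤ ENNReal.ofReal K ^ p.toReal :=
          ENNReal.rpow_le_rpow_of_exponent_le (by simpa using hK) (by linarith)
  calc (∫⁻ y, ‖f y‖ₑ ^ p.toReal ∂μ) ^ (1 / p.toReal)
      ≤ (ENNReal.ofReal K ^ p.toReal * ENNReal.ofReal I) ^ (1 / p.toReal) :=
        ENNReal.rpow_le_rpow key (by positivity)
    _ = ENNReal.ofReal K * ENNReal.ofReal I ^ (1 / p.toReal) := by
        rw [ENNReal.mul_rpow_of_nonneg _ _ (by positivity), ← ENNReal.rpow_mul,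
          mul_one_div_cancel hr0.ne', ENNReal.rpow_one]

/-- What the maximal inequality says for a test function `f` of known size whose maximal
function is at least `c` on a set of measure at least `τ`. -/
theorem test_bound {n : ℕ} {p q : ℝ≥0∞} (hp : 1 ≤ p) (hq : 1 ≤ q) {α : ℂ} {C : ℝ≥0}
    (hC : ∀ f : 𝓢(En n, ℂ), eLpNorm (localSteinMaximal n α f) q volume ≤ C * eLpNorm f p volume)
    (f : 𝓢(En n, ℂ)) {K I c τ : ℝ} (hK : 1 ≤ K) (hI : 0 < I) (hfK : ∀ y, ‖f y‖ ≤ K)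
    (hfI : ∫⁻ y, ‖f y‖ₑ ≤ ENNReal.ofReal I) (hc : 0 ≤ c) {T : Set (En n)} (hT : MeasurableSet T)
    (hτ : 0 < τ) (hTτ : ENNReal.ofReal τ ≤ volume T)
    (hM : ∀ x ∈ T, ∃ t ∈ Icc (1 : ℝ) 2, c ≤ ‖steinMean n α t f x‖) :
    c * τ ^ recip q ≤ C * (K * I ^ recip p) := by
  have hlow : ENNReal.ofReal (c * τ ^ recip q) ≤ eLpNorm (localSteinMaximal n α f) q volume := by
    have h1 : eLpNorm (T.indicator fun _ => ENNReal.ofReal c) q volume ≤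
        eLpNorm (localSteinMaximal n α f) q volume := by
      refine eLpNorm_mono_enorm fun x => ?_
      by_cases hx : x ∈ T
      · obtain ⟨t, ht, hct⟩ := hM x hx
        simp only [indicator_of_mem hx, enorm_eq_self, localSteinMaximal]
        refine le_trans ?_ (le_iSup₂ (f := fun t _ => ‖steinMean n α t f x‖ₑ) t ht)
        rw [← ofReal_norm]
        exact ENNReal.ofReal_le_ofReal hct
      · simp [indicator_of_notMem hx]
    refine le_trans ?_ h1
    have hT0 : volume T ≠ 0 := (lt_of_lt_of_le (by simpa using hτ) hTτ).ne'
    rw [eLpNorm_indicator_const' hT hT0 (zero_lt_one.trans_le hq).ne', enorm_eq_self,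
      ENNReal.ofReal_mul hc, ← recip_eq, ← ENNReal.ofReal_rpow_of_pos hτ]
    gcongr
    exact recip_nonneg q
  have h := hlow.trans ((hC f).trans (mul_le_mul_right (eLpNorm_le_of_bound hp hK hI hfK hfI) _))
  rw [← ENNReal.ofReal_coe_nnreal, ← ENNReal.ofReal_mul (NNReal.coe_nonneg C)] at h
  refine (ENNReal.ofReal_le_ofReal_iff ?_).1 h
  have : 0 ≤ K := by linarith
  positivity

theorem exponent_le_of_atTop {a b u v : ℝ} (ha : 0 < a)
    (h : ∀ᶠ k : ℕ in atTop, a * (k : ℝ) ^ u ≤ b * (k : ℝ) ^ v) : u ≤ v := by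
  by_contra! hlt
  have h1 : Tendsto (fun k : ℕ => (k : ℝ) ^ (u - v)) atTop atTop :=
    (tendsto_rpow_atTop (by linarith)).comp tendsto_natCast_atTop_atTop
  obtain ⟨k, hk, hk1, hk2⟩ := (h.and ((eventually_gt_atTop 0).and
    (h1.eventually_gt_atTop (b / a)))).exists
  have hk0 : (0 : ℝ) < k := by exact_mod_cast hk1
  rw [div_lt_iff₀ ha, Real.rpow_sub hk0, div_mul_eq_mul_div,
    lt_div_iff₀ (Real.rpow_pos_of_pos hk0 v)] at hk2
  linarith

/-- If `a δ ^ u ≤ b δ ^ v` for all small `δ > 0`, then `v ≤ u`. -/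
theorem exponent_le_of_small {a b u v δ₀ : ℝ} (ha : 0 < a) (hδ₀ : 0 < δ₀)
    (h : ∀ δ, 0 < δ → δ ≤ δ₀ → a * δ ^ u ≤ b * δ ^ v) : v ≤ u := by
  have : -u ≤ -v := by
    refine exponent_le_of_atTop (b := b) ha ?_
    filter_upwards [eventually_gt_atTop 0, tendsto_natCast_atTop_atTop.eventually_ge_atTop (1 / δ₀)]
      with k hk hk2
    have hk0 : (0 : ℝ) < k := by exact_mod_cast hk
    have := h (k : ℝ)⁻¹ (by positivity) (by
      rw [inv_le_comm₀ hk0 hδ₀]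
      simpa using hk2)
    simpa only [Real.inv_rpow hk0.le, ← Real.rpow_neg hk0.le] using this
  linarith

/-! ### Exponential weights concentrated at the unit sphere -/

theorem posPow_mul {β : ℂ} {a : ℝ} (ha : 0 < a) (s : ℝ) :
    posPow β (a * s) = (a : ℂ) ^ β * posPow β s := by
  have : max (a * s) 0 = a * max s 0 := by
    rw [mul_max_of_nonneg _ _ ha.le, mul_zero]
  rw [posPow, posPow, this, Complex.ofReal_mul,
    Complex.mul_cpow_ofReal_nonneg ha.le (le_max_right _ _)]

theorem norm_posPow {β : ℂ} (hβ : 0 < β.re) (s : ℝ) : ‖posPow β s‖ = (max s 0) ^ β.re := by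
  rw [posPow, Complex.norm_cpow_eq_rpow_re_of_nonneg (le_max_right _ _) hβ.ne']

theorem norm_posPow_le {β : ℂ} (hβ : 0 < β.re) {s r : ℝ} (hsr : s ≤ r) (hr : 0 ≤ r) :
    ‖posPow β s‖ ≤ r ^ β.re := by
  rw [norm_posPow hβ]
  exact Real.rpow_le_rpow (le_max_right _ _) (max_le hsr hr) hβ.le

theorem posPow_of_nonpos {β : ℂ} (hβ : β ≠ 0) {s : ℝ} (hs : s ≤ 0) : posPow β s = 0 := by
  simp [posPow, max_eq_right hs, hβ]

theorem ne_zero_of_re_pos {β : ℂ} (hβ : 0 < β.re) : β ≠ 0 := by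
  rintro rfl
  simp at hβ

/-- Polar coordinates, with the radius written as `1 - δ s`. -/
theorem integral_radial_scaled (hn : 0 < n) {E : Type*} [NormedAddCommGroup E] [NormedSpace ℝ E]
    (F : ℝ → E) {δ : ℝ} (hδ : 0 < δ) :
    ∫ y : En n, F ‖y‖ =
      (n * volume.real (Metric.ball (0 : En n) 1) * δ) •
        ∫ s : ℝ, {s : ℝ | δ * s < 1}.indicator
          (fun s => (1 - δ * s) ^ (n - 1) • F (1 - δ * s)) s := by
  have : Nonempty (Fin n) := ⟨⟨0, hn⟩⟩
  rw [integral_fun_norm_addHaar, finrank_euclideanSpace_fin, ← Nat.cast_smul_eq_nsmul ℝ,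
    ← integral_indicator measurableSet_Ioi, smul_smul, mul_smul _ δ]
  congr 1
  set G : ℝ → E := (Ioi (0 : ℝ)).indicator fun y => y ^ (n - 1) • F y with hG
  have h1 : ∫ s : ℝ, G s = ∫ s : ℝ, G (1 - s) := (integral_sub_left_eq_self G volume 1).symm
  have h2 := Measure.integral_comp_mul_left (fun s => G (1 - s)) δ
  rw [abs_of_pos (inv_pos.2 hδ)] at h2
  have h3 : ∫ s : ℝ, G (1 - s) = δ • ∫ s : ℝ, G (1 - δ * s) := by
    rw [h2, smul_smul, mul_inv_cancel₀ hδ.ne', one_smul]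
  rw [h1, h3]
  congr 2
  funext s
  by_cases hs : δ * s < 1
  · rw [indicator_of_mem (show s ∈ {s : ℝ | δ * s < 1} from hs), hG,
      indicator_of_mem (show 1 - δ * s ∈ Ioi (0 : ℝ) by simpa using hs)]
  · rw [indicator_of_notMem (show s ∉ {s : ℝ | δ * s < 1} from hs), hG,
      indicator_of_notMem (show 1 - δ * s ∉ Ioi (0 : ℝ) by simpa using hs)]

/-- The integrand of the weight `(1 - |y|²)₊ ^ γ exp (-(1 - |y|²) / δ)` in the scaled radial
variable. -/
noncomputable def radialDensity (n : ℕ) (γ : ℂ) (δ s : ℝ) : ℂ :=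
  {s : ℝ | δ * s < 1}.indicator (fun s => (((1 - δ * s) ^ (n - 1) : ℝ) : ℂ) *
    (posPow γ (2 * s - δ * s ^ 2) * Real.exp (-(2 * s - δ * s ^ 2)))) s

theorem norm_radialDensity_le {γ : ℂ} (hγ : 0 < γ.re) {δ : ℝ} (hδ : 0 < δ) (s : ℝ) :
    ‖radialDensity n γ δ s‖ ≤
      (Ioi (0 : ℝ)).indicator (fun s => (2 * s) ^ γ.re * Real.exp (-s)) s := by
  by_cases hs : δ * s < 1
  · rw [radialDensity, indicator_of_mem (show s ∈ {s : ℝ | δ * s < 1} from hs)]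
    rcases le_or_gt s 0 with h0 | h0
    · have : 2 * s - δ * s ^ 2 ≤ 0 := by nlinarith [mul_nonneg hδ.le (sq_nonneg s)]
      rw [posPow_of_nonpos (ne_zero_of_re_pos hγ) this]
      simp [indicator_of_notMem (show s ∉ Ioi (0 : ℝ) by simpa using h0)]
    · rw [indicator_of_mem (show s ∈ Ioi (0 : ℝ) from h0), norm_mul, norm_mul, Complex.norm_real,
        Complex.norm_real, Real.norm_eq_abs, Real.norm_eq_abs, Real.abs_exp, abs_pow,
        abs_of_pos (show 0 < 1 - δ * s by linarith)]
      have h1 : (1 - δ * s) ^ (n - 1) ≤ 1 :=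
        pow_le_one₀ (by linarith) (by nlinarith)
      have h2 : ‖posPow γ (2 * s - δ * s ^ 2)‖ ≤ (2 * s) ^ γ.re :=
        norm_posPow_le hγ (by nlinarith [mul_nonneg hδ.le (sq_nonneg s)]) (by positivity)
      have h3 : Real.exp (-(2 * s - δ * s ^ 2)) ≤ Real.exp (-s) :=
        Real.exp_le_exp.2 (by nlinarith)
      have h4 : (0 : ℝ) ≤ (1 - δ * s) ^ (n - 1) := pow_nonneg (by linarith) _
      calc (1 - δ * s) ^ (n - 1) *
            (‖posPow γ (2 * s - δ * s ^ 2)‖ * Real.exp (-(2 * s - δ * s ^ 2)))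
          ≤ 1 * ((2 * s) ^ γ.re * Real.exp (-s)) := by gcongr
        _ = _ := one_mul _
  · rw [radialDensity, indicator_of_notMem (show s ∉ {s : ℝ | δ * s < 1} from hs), norm_zero]
    refine indicator_nonneg (fun s hs => ?_) s
    have : 0 < s := hs
    positivity

theorem integrable_radialBound {a : ℝ} (ha : 0 < a) :
    Integrable ((Ioi (0 : ℝ)).indicator fun s => (2 * s) ^ a * Real.exp (-s)) := by
  rw [integrable_indicator_iff measurableSet_Ioi]
  have h : IntegrableOn (fun s : ℝ => 2 ^ a * (Real.exp (-s) * s ^ (a + 1 - 1))) (Ioi 0) :=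
    (Real.GammaIntegral_convergent (s := a + 1) (by linarith)).const_mul (2 ^ a)
  refine h.congr_fun (fun s hs => ?_) measurableSet_Ioi
  have : (0 : ℝ) < s := hs
  simp only [add_sub_cancel_right]
  rw [Real.mul_rpow (by norm_num) this.le]
  ring

theorem aesm_radialDensity {γ : ℂ} (hγ : 0 < γ.re) (δ : ℝ) :
    AEStronglyMeasurable (radialDensity n γ δ) := by
  refine AEStronglyMeasurable.indicator (Continuous.aestronglyMeasurable ?_)
    (measurableSet_lt (by fun_prop) measurable_const)
  have := posPow_continuous hγ
  fun_prop

theorem tendsto_integral_radialDensity {γ : ℂ} (hγ : 0 < γ.re) :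
    Tendsto (fun δ => ∫ s, radialDensity n γ δ s) (𝓝[>] 0)
      (𝓝 (1 / 2 * Complex.Gamma (γ + 1))) := by
  have hlim : ∫ s : ℝ, posPow γ (2 * s) * Real.exp (-(2 * s)) =
      1 / 2 * Complex.Gamma (γ + 1) := by
    have h := Measure.integral_comp_mul_left
      (fun s : ℝ => posPow γ s * (Real.exp (-s) : ℂ)) 2
    rw [h, Complex.Gamma_eq_integral (by simp; linarith), Complex.GammaIntegral,
      ← integral_indicator measurableSet_Ioi]
    have e : (fun s : ℝ => posPow γ s * (Real.exp (-s) : ℂ)) = (Ioi (0 : ℝ)).indicator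
        fun x => ((Real.exp (-x) : ℝ) : ℂ) * (x : ℂ) ^ (γ + 1 - 1) := by
      funext s
      rcases le_or_gt s 0 with h0 | h0
      · rw [posPow_of_nonpos (ne_zero_of_re_pos hγ) h0,
          indicator_of_notMem (show s ∉ Ioi (0 : ℝ) by simpa using h0), zero_mul]
      · rw [indicator_of_mem (show s ∈ Ioi (0 : ℝ) from h0), posPow, max_eq_left h0.le,
          add_sub_cancel_right, mul_comm]
    rw [e, Complex.real_smul]
    norm_num
  rw [← hlim]
  refine tendsto_integral_filter_of_dominated_convergence _
    (Eventually.of_forall fun δ => aesm_radialDensity hγ δ) ?_ (integrable_radialBound hγ) ?_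
  · filter_upwards [self_mem_nhdsWithin] with δ hδ
    exact Eventually.of_forall fun s => norm_radialDensity_le hγ hδ s
  · refine Eventually.of_forall fun s => ?_
    have hc : Continuous fun δ : ℝ => (((1 - δ * s) ^ (n - 1) : ℝ) : ℂ) *
        (posPow γ (2 * s - δ * s ^ 2) * Real.exp (-(2 * s - δ * s ^ 2))) := by
      have := posPow_continuous hγ
      fun_prop
    have h0 := (hc.tendsto 0).mono_left (nhdsWithin_le_nhds (s := Ioi 0))
    simp only [zero_mul, sub_zero, one_pow, Complex.ofReal_one, one_mul] at h0
    refine h0.congr' ?_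
    have hev : ∀ᶠ δ : ℝ in 𝓝[>] 0, δ * s < 1 := by
      have : Tendsto (fun δ : ℝ => δ * s) (𝓝[>] 0) (𝓝 (0 * s)) :=
        ((continuous_id.mul continuous_const).tendsto 0).mono_left nhdsWithin_le_nhds
      exact this.eventually_lt_const (by simp)
    filter_upwards [hev] with δ hδ
    rw [radialDensity, indicator_of_mem (show s ∈ {s : ℝ | δ * s < 1} from hδ)]

/-- `h` multiplied by the weight `exp (-(1 - |y|²) / δ)`. -/
noncomputable def expWeight (δ : ℝ) (h : En n → ℂ) (y : En n) : ℂ :=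
  (Real.exp (-((1 - ‖y‖ ^ 2) / δ)) : ℂ) * h y

theorem contDiff_expWeight (δ : ℝ) {h : En n → ℂ} (hh : ContDiff ℝ ∞ h) :
    ContDiff ℝ ∞ (expWeight δ h) := by
  refine ContDiff.mul (Complex.ofRealCLM.contDiff.comp ?_) hh
  exact Real.contDiff_exp.comp (((contDiff_const.sub (contDiff_norm_sq ℝ)).div_const δ).neg)

/-- The ball mean of `expWeight δ h`, normalized to have a limit as `δ → 0`. -/
noncomputable def shellMean (n : ℕ) (δ : ℝ) (α : ℂ) (h : En n → ℂ) : ℂ :=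
  (δ : ℂ) ^ (-α) * ballMean n α (expWeight δ h)

theorem fderiv_expWeight {δ : ℝ} (hδ : 0 < δ) {h : En n → ℂ} (hh : ContDiff ℝ ∞ h) (y : En n) :
    fderiv ℝ (expWeight δ h) y y = 2 / δ * (((‖y‖ ^ 2 : ℝ) : ℂ) * expWeight δ h y) +
      expWeight δ (fun y => fderiv ℝ h y y) y := by
  have h1 : HasFDerivAt (fun y : En n => -((1 - ‖y‖ ^ 2) / δ))
      ((2 / δ) • innerSL ℝ y) y := by
    have h0 := ((hasStrictFDerivAt_norm_sq y).hasFDerivAt.sub_const (1 : ℝ)).const_mul (1 / δ)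
    refine (h0.congr_fderiv ?_).congr_of_eventuallyEq (Eventually.of_forall fun z => ?_)
    · ext v
      simp
      ring
    · simp only
      field_simp
      ring
  have h2 := (Complex.ofRealCLM.hasFDerivAt.comp y h1.exp).mul
    (hh.differentiable (by simp) y).hasFDerivAt
  have h3 : HasFDerivAt (expWeight δ h) _ y := h2
  rw [h3.fderiv]
  simp [expWeight]
  ring

/-- The Euler recursion for shell means. The Euler operator applied to the weight produces
`2 |y|² / δ`, whose main part turns order `α` into order `α + 1` without loss; all other terms
carry a factor `δ`. -/
theorem shellMean_rec {δ : ℝ} (hδ : 0 < δ) {h : En n → ℂ} (hh : ContDiff ℝ ∞ h) (α : ℂ) :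
    shellMean n δ α h = shellMean n δ (α + 1) h + δ * ((n / 2 + α) * shellMean n δ (α + 1) h -
      (α + 1) * shellMean n δ (α + 2) h +
      1 / 2 * shellMean n δ (α + 1) (fun y => fderiv ℝ h y y)) := by
  have hg := contDiff_expWeight δ hh
  have hE := contDiff_expWeight δ (contDiff_euler hh)
  have hm := contDiff_normSq.mul hg
  have hδ0 : (δ : ℂ) ≠ 0 := by exact_mod_cast hδ.ne'
  have e1 : (δ : ℂ) ^ (-α) = δ * (δ : ℂ) ^ (-(α + 1)) := by
    rw [neg_add, Complex.cpow_add _ _ hδ0, Complex.cpow_neg_one]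
    field_simp
  have e2 : (δ : ℂ) ^ (-(α + 1)) = δ * (δ : ℂ) ^ (-(α + 2)) := by
    rw [show -(α + 2) = -(α + 1) + -1 by ring, Complex.cpow_add _ _ hδ0, Complex.cpow_neg_one]
    field_simp
  simp only [shellMean]
  rw [ballMean_euler hg]
  simp only [fderiv_expWeight hδ hh]
  rw [ballMean_add (contDiff_const.mul hm) hE, ballMean_const_mul hm, ballMean_normSq_mul hg,
    e1, show α + 1 + 1 = α + 2 by ring, e2]
  field_simp
  ring

theorem shellMean_eq_integral (hn : 0 < n) {δ : ℝ} (hδ : 0 < δ) {β : ℂ} (hβ : 1 < β.re) :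
    shellMean n δ β (fun _ => 1) = (n * volume.real (Metric.ball (0 : En n) 1) : ℝ) *
      ((Complex.Gamma β)⁻¹ * ∫ s, radialDensity n (β - 1) δ s) := by
  have hδ0 : (δ : ℂ) ≠ 0 := by exact_mod_cast hδ.ne'
  have hF := integral_radial_scaled hn (fun r : ℝ => posPow (β - 1) (1 - r ^ 2) *
    ((Real.exp (-((1 - r ^ 2) / δ)) : ℂ) * 1)) hδ
  rw [shellMean, ballMean_eq_integral (contDiff_expWeight δ contDiff_const) hβ]
  simp only [expWeight]
  rw [hF]
  have e : (fun s : ℝ => {s : ℝ | δ * s < 1}.indicator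
      (fun s => (1 - δ * s) ^ (n - 1) • (posPow (β - 1) (1 - (1 - δ * s) ^ 2) *
        ((Real.exp (-((1 - (1 - δ * s) ^ 2) / δ)) : ℂ) * 1))) s) =
      fun s => (δ : ℂ) ^ (β - 1) * radialDensity n (β - 1) δ s := by
    funext s
    by_cases hs : δ * s < 1
    · rw [radialDensity, indicator_of_mem (show s ∈ {s : ℝ | δ * s < 1} from hs),
        indicator_of_mem (show s ∈ {s : ℝ | δ * s < 1} from hs)]
      have h1 : 1 - (1 - δ * s) ^ 2 = δ * (2 * s - δ * s ^ 2) := by ring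
      rw [h1, posPow_mul hδ, mul_div_cancel_left₀ _ hδ.ne', Complex.real_smul]
      ring
    · rw [radialDensity, indicator_of_notMem (show s ∉ {s : ℝ | δ * s < 1} from hs),
        indicator_of_notMem (show s ∉ {s : ℝ | δ * s < 1} from hs), mul_zero]
  rw [e, integral_const_mul, Complex.real_smul, Complex.cpow_neg, Complex.cpow_sub _ _ hδ0,
    Complex.cpow_one]
  have : (δ : ℂ) ^ β ≠ 0 := by simp [Complex.cpow_eq_zero_iff, hδ0]
  push_cast
  field_simp

/-- Uniform bound for the normalized shell means in the range of absolute convergence. -/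
theorem shellMean_bound_of_re (hn : 0 < n) {β : ℂ} (hβ : 1 < β.re) :
    ∃ C, 0 ≤ C ∧ ∀ δ, 0 < δ → ∀ (h : En n → ℂ) (S : ℝ), ContDiff ℝ ∞ h →
      (∀ y, ‖y‖ ≤ 1 → ‖h y‖ ≤ S) → ‖shellMean n δ β h‖ ≤ C * S := by
  have hre : 0 < (β - 1).re := by simpa using hβ
  set B : ℝ := ∫ s, (Ioi (0 : ℝ)).indicator (fun s => (2 * s) ^ (β - 1).re * Real.exp (-s)) s
    with hB
  have hB0 : 0 ≤ B := integral_nonneg fun s => indicator_nonneg (fun s hs => by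
    have : (0 : ℝ) < s := hs
    positivity) s
  refine ⟨‖(Complex.Gamma β)⁻¹‖ * (n * volume.real (Metric.ball (0 : En n) 1) * B),
    by positivity, fun δ hδ h S hh hS => ?_⟩
  have hS0 : 0 ≤ S := (norm_nonneg _).trans (hS 0 (by simp))
  have hδ0 : (δ : ℂ) ≠ 0 := by exact_mod_cast hδ.ne'
  have hF := integral_radial_scaled hn (fun r : ℝ => ‖posPow (β - 1) (1 - r ^ 2)‖ *
    Real.exp (-((1 - r ^ 2) / δ))) hδ
  have e : (fun s : ℝ => {s : ℝ | δ * s < 1}.indicator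
      (fun s => (1 - δ * s) ^ (n - 1) • (‖posPow (β - 1) (1 - (1 - δ * s) ^ 2)‖ *
        Real.exp (-((1 - (1 - δ * s) ^ 2) / δ)))) s) =
      fun s => δ ^ (β.re - 1) * ‖radialDensity n (β - 1) δ s‖ := by
    funext s
    by_cases hs : δ * s < 1
    · rw [radialDensity, indicator_of_mem (show s ∈ {s : ℝ | δ * s < 1} from hs),
        indicator_of_mem (show s ∈ {s : ℝ | δ * s < 1} from hs)]
      have h1 : 1 - (1 - δ * s) ^ 2 = δ * (2 * s - δ * s ^ 2) := by ring
      rw [h1, posPow_mul hδ, mul_div_cancel_left₀ _ hδ.ne', norm_mul, norm_mul, norm_mul,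
        Complex.norm_real, Complex.norm_real, Real.norm_eq_abs, Real.norm_eq_abs, Real.abs_exp,
        Complex.norm_cpow_eq_rpow_re_of_pos hδ, smul_eq_mul,
        abs_of_nonneg (pow_nonneg (by linarith) _)]
      simp
      ring
    · rw [radialDensity, indicator_of_notMem (show s ∉ {s : ℝ | δ * s < 1} from hs),
        indicator_of_notMem (show s ∉ {s : ℝ | δ * s < 1} from hs), norm_zero, mul_zero]
  rw [e, integral_const_mul] at hF
  have hle : ∫ s, ‖radialDensity n (β - 1) δ s‖ ≤ B :=
    integral_mono_of_nonneg (Eventually.of_forall fun s => norm_nonneg _)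
      (integrable_radialBound hre) (Eventually.of_forall fun s => norm_radialDensity_le hre hδ s)
  have hint : Integrable fun y : En n => ‖posPow (β - 1) (1 - ‖y‖ ^ 2)‖ *
      Real.exp (-((1 - ‖y‖ ^ 2) / δ)) := by
    refine ((integrable_posPow_mul hβ (contDiff_expWeight (n := n) δ
      (h := fun _ => 1) contDiff_const).continuous).norm).congr (Eventually.of_forall fun y => ?_)
    simp only [expWeight, norm_mul, Complex.norm_real, Real.norm_eq_abs, Real.abs_exp,
      mul_one]
  rw [shellMean, ballMean_eq_integral (contDiff_expWeight δ hh) hβ, norm_mul, norm_mul,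
    Complex.norm_cpow_eq_rpow_re_of_pos hδ, Complex.neg_re]
  have h2 : ‖∫ y : En n, posPow (β - 1) (1 - ‖y‖ ^ 2) * expWeight δ h y‖ ≤
      S * ∫ y : En n, ‖posPow (β - 1) (1 - ‖y‖ ^ 2)‖ * Real.exp (-((1 - ‖y‖ ^ 2) / δ)) := by
    rw [← integral_const_mul]
    refine norm_integral_le_of_norm_le (hint.const_mul S) (Eventually.of_forall fun y => ?_)
    rw [expWeight, norm_mul, norm_mul, Complex.norm_real, Real.norm_eq_abs, Real.abs_exp]
    rcases le_or_gt ‖y‖ 1 with hy | hy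
    · have := hS y hy
      calc _ ≤ ‖posPow (β - 1) (1 - ‖y‖ ^ 2)‖ * (Real.exp (-((1 - ‖y‖ ^ 2) / δ)) * S) := by gcongr
        _ = _ := by ring
    · rw [posPow_of_nonpos (ne_zero_of_re_pos hre) (by nlinarith)]
      simp
  rw [hF] at h2
  have e3 : δ ^ (-β.re) * (δ * δ ^ (β.re - 1)) = 1 := by
    rw [Real.rpow_neg hδ.le, Real.rpow_sub hδ, Real.rpow_one]
    have := (Real.rpow_pos_of_pos hδ β.re).ne'
    field_simp
  calc δ ^ (-β.re) * (‖(Complex.Gamma β)⁻¹‖ *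
        ‖∫ y : En n, posPow (β - 1) (1 - ‖y‖ ^ 2) * expWeight δ h y‖)
      ≤ δ ^ (-β.re) * (‖(Complex.Gamma β)⁻¹‖ *
        (S * ((n * volume.real (Metric.ball (0 : En n) 1) * δ) • (δ ^ (β.re - 1) * B)))) := by
        refine mul_le_mul_of_nonneg_left (mul_le_mul_of_nonneg_left (h2.trans ?_) (norm_nonneg _))
          (by positivity)
        rw [smul_eq_mul, smul_eq_mul]
        gcongr
    _ = ‖(Complex.Gamma β)⁻¹‖ * (n * volume.real (Metric.ball (0 : En n) 1) * B) * S *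
        (δ ^ (-β.re) * (δ * δ ^ (β.re - 1))) := by
        rw [smul_eq_mul]
        ring
    _ = _ := by rw [e3, mul_one]

/-! ### Focusing at the centre of a sphere -/

theorem fderiv_slice {H : En n × En n → ℂ} (hH : ContDiff ℝ ∞ H) (w y : En n) :
    fderiv ℝ (fun y => H (w, y)) y y = fderiv ℝ H (w, y) (0, y) := by
  have h1 : HasFDerivAt (fun y : En n => (w, y)) (ContinuousLinearMap.inr ℝ (En n) (En n)) y :=
    hasFDerivAt_prodMk_right w y
  have h2 := ((hH.differentiable (by simp) (w, y)).hasFDerivAt.comp y h1)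
  have h3 : HasFDerivAt (fun y => H (w, y)) _ y := h2
  rw [h3.fderiv]
  simp

theorem contDiff_slice {H : En n × En n → ℂ} (hH : ContDiff ℝ ∞ H) (w : En n) :
    ContDiff ℝ ∞ fun y => H (w, y) := hH.comp (contDiff_const.prodMk contDiff_id)

theorem contDiff_euler_slice {H : En n × En n → ℂ} (hH : ContDiff ℝ ∞ H) :
    ContDiff ℝ ∞ fun z : En n × En n => fderiv ℝ H z (0, z.2) :=
  (hH.fderiv_right (m := ∞) (by simp)).clm_apply (contDiff_const.prodMk contDiff_snd)

/-- Normalized shell means of every order are bounded on smooth families; the recursion carries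
the bound down from the range of absolute convergence. -/
theorem shellMean_family_bound (hn : 0 < n) (α : ℂ) {H : En n × En n → ℂ}
    (hH : ContDiff ℝ ∞ H) :
    ∃ C, 0 ≤ C ∧ ∀ δ, 0 < δ → δ ≤ 1 → ∀ w : En n, ‖w‖ ≤ 1 →
      ‖shellMean n δ α (fun y => H (w, y))‖ ≤ C := by
  obtain ⟨k, hk⟩ := exists_nat_gt (1 - α.re)
  induction k generalizing α H with
  | zero =>
    obtain ⟨C, hC0, hC⟩ := shellMean_bound_of_re hn (β := α) (by simp at hk; linarith)
    obtain ⟨S, hS⟩ := ((isCompact_closedBall (0 : En n) 1).prod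
      (isCompact_closedBall (0 : En n) 1)).exists_bound_of_continuousOn hH.continuous.continuousOn
    have hS' : ∀ w y : En n, ‖w‖ ≤ 1 → ‖y‖ ≤ 1 → ‖H (w, y)‖ ≤ S := fun w y hw hy =>
      hS (w, y) ⟨by simpa using hw, by simpa using hy⟩
    have hS0 : 0 ≤ S := (norm_nonneg _).trans (hS' 0 0 (by simp) (by simp))
    exact ⟨C * S, by positivity, fun δ hδ _ w hw =>
      hC δ hδ _ S (contDiff_slice hH w) fun y hy => hS' w y hw hy⟩
  | succ k ih =>
    push_cast at hk
    obtain ⟨C₁, h₁, hC₁⟩ := ih (α + 1) hH (by simp; linarith)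
    obtain ⟨C₂, h₂, hC₂⟩ := ih (α + 2) hH (by simp; linarith)
    obtain ⟨C₃, h₃, hC₃⟩ := ih (α + 1) (contDiff_euler_slice hH) (by simp; linarith)
    refine ⟨C₁ + 1 * (‖(n / 2 + α : ℂ)‖ * C₁ + ‖α + 1‖ * C₂ + 1 / 2 * C₃), by positivity,
      fun δ hδ hδ1 w hw => ?_⟩
    rw [shellMean_rec hδ (contDiff_slice hH w)]
    simp only [fderiv_slice hH]
    have b₁ := hC₁ δ hδ hδ1 w hw
    have b₂ := hC₂ δ hδ hδ1 w hw
    have b₃ := hC₃ δ hδ hδ1 w hw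
    refine (norm_add_le _ _).trans (add_le_add b₁ ?_)
    rw [norm_mul, Complex.norm_real, Real.norm_eq_abs, abs_of_pos hδ]
    gcongr
    refine (norm_add_le _ _).trans (add_le_add ((norm_sub_le _ _).trans (add_le_add ?_ ?_)) ?_)
    · rw [norm_mul]
      gcongr
    · rw [norm_mul]
      gcongr
    · rw [norm_mul]
      norm_num
      linarith

theorem shellMean_sub_succ (hn : 0 < n) (α : ℂ) {H : En n × En n → ℂ} (hH : ContDiff ℝ ∞ H) :
    ∃ C, 0 ≤ C ∧ ∀ δ, 0 < δ → δ ≤ 1 → ∀ w : En n, ‖w‖ ≤ 1 →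
      ‖shellMean n δ α (fun y => H (w, y)) - shellMean n δ (α + 1) (fun y => H (w, y))‖
        ≤ C * δ := by
  obtain ⟨C₁, h₁, hC₁⟩ := shellMean_family_bound hn (α + 1) hH
  obtain ⟨C₂, h₂, hC₂⟩ := shellMean_family_bound hn (α + 2) hH
  obtain ⟨C₃, h₃, hC₃⟩ := shellMean_family_bound hn (α + 1) (contDiff_euler_slice hH)
  refine ⟨‖(n / 2 + α : ℂ)‖ * C₁ + ‖α + 1‖ * C₂ + 1 / 2 * C₃, by positivity,
    fun δ hδ hδ1 w hw => ?_⟩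
  rw [shellMean_rec hδ (contDiff_slice hH w), add_sub_cancel_left]
  simp only [fderiv_slice hH]
  have b₁ := hC₁ δ hδ hδ1 w hw
  have b₂ := hC₂ δ hδ hδ1 w hw
  have b₃ := hC₃ δ hδ hδ1 w hw
  rw [norm_mul, Complex.norm_real, Real.norm_eq_abs, abs_of_pos hδ, mul_comm]
  gcongr
  refine (norm_add_le _ _).trans (add_le_add ((norm_sub_le _ _).trans (add_le_add ?_ ?_)) ?_)
  · rw [norm_mul]
    gcongr
  · rw [norm_mul]
    gcongr
  · rw [norm_mul]
    norm_num
    linarith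

/-- Shell means of orders differing by an integer have the same limit as `δ → 0`. -/
theorem shellMean_sub_nat (hn : 0 < n) (α : ℂ) {H : En n × En n → ℂ} (hH : ContDiff ℝ ∞ H)
    (k : ℕ) : ∃ C, 0 ≤ C ∧ ∀ δ, 0 < δ → δ ≤ 1 → ∀ w : En n, ‖w‖ ≤ 1 →
      ‖shellMean n δ α (fun y => H (w, y)) - shellMean n δ (α + k) (fun y => H (w, y))‖
        ≤ C * δ := by
  induction k with
  | zero => exact ⟨0, le_rfl, fun δ _ _ w _ => by simp⟩
  | succ k ih =>
    obtain ⟨C, hC0, hC⟩ := ih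
    obtain ⟨C', hC0', hC'⟩ := shellMean_sub_succ hn (α + k) hH
    refine ⟨C + C', by positivity, fun δ hδ hδ1 w hw => ?_⟩
    rw [show α + ((k + 1 : ℕ) : ℂ) = α + k + 1 by push_cast; ring, add_mul]
    exact (norm_sub_le_norm_sub_add_norm_sub _ _ _).trans
      (add_le_add (hC δ hδ hδ1 w hw) (hC' δ hδ hδ1 w hw))

/-- The exponential `(w, y) ↦ exp (-2 w · y)`, by which translating the centre of the spherical
shell by `δ w` changes the weight. -/
noncomputable def expPair (z : En n × En n) : ℂ := (Real.exp (-2 * inner ℝ z.1 z.2) : ℂ)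

theorem contDiff_expPair : ContDiff ℝ ∞ (expPair (n := n)) :=
  Complex.ofRealCLM.contDiff.comp
    (Real.contDiff_exp.comp (contDiff_const.mul (contDiff_fst.inner ℝ contDiff_snd)))

theorem norm_expPair_sub_one_le {w y : En n} (hw : ‖w‖ ≤ 1 / 2) (hy : ‖y‖ ≤ 1) :
    ‖expPair (w, y) - 1‖ ≤ 4 * ‖w‖ := by
  have h1 : |inner ℝ w y| ≤ ‖w‖ := (abs_real_inner_le_norm w y).trans
    (mul_le_of_le_one_right (norm_nonneg _) hy)
  have h2 : |(-2 : ℝ) * inner ℝ w y| ≤ 2 * ‖w‖ := by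
    rw [abs_mul]
    norm_num
    exact h1
  have h3 := Real.abs_exp_sub_one_le (x := -2 * inner ℝ w y) (by linarith)
  rw [expPair, ← Complex.ofReal_one, ← Complex.ofReal_sub, Complex.norm_real, Real.norm_eq_abs]
  simp only
  linarith

/-- The normalized shell means of the perturbed weights stay away from zero, for every order. -/
theorem shellMean_lower (hn : 0 < n) (α : ℂ) :
    ∃ w₀ c δ₀ : ℝ, 0 < w₀ ∧ w₀ ≤ 1 ∧ 0 < c ∧ 0 < δ₀ ∧ δ₀ ≤ 1 ∧ ∀ δ, 0 < δ → δ ≤ δ₀ →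
      ∀ w : En n, ‖w‖ ≤ w₀ → c ≤ ‖shellMean n δ α (fun y => expPair (w, y))‖ := by
  obtain ⟨k, hk⟩ := exists_nat_gt (1 - α.re)
  set β : ℂ := α + k with hβ
  have hre : 1 < β.re := by simp [hβ]; linarith
  have hre' : 0 < (β - 1).re := by simpa using hre
  obtain ⟨C, hC0, hC⟩ := shellMean_sub_nat hn α contDiff_expPair k
  obtain ⟨B, hB0, hB⟩ := shellMean_bound_of_re hn hre
  set L : ℝ := n * volume.real (Metric.ball (0 : En n) 1) / 2 with hL
  have hL0 : 0 < L := by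
    have : 0 < volume.real (Metric.ball (0 : En n) 1) :=
      ENNReal.toReal_pos (Metric.measure_ball_pos volume 0 one_pos).ne' measure_ball_lt_top.ne
    have : (0 : ℝ) < n := by exact_mod_cast hn
    positivity
  have hΓ : Complex.Gamma β ≠ 0 := Complex.Gamma_ne_zero_of_re_pos (by linarith)
  have hlim : Tendsto (fun δ => shellMean n δ β (fun _ => 1)) (𝓝[>] 0) (𝓝 (L : ℂ)) := by
    have h := ((tendsto_integral_radialDensity (n := n) hre').const_mul
      (Complex.Gamma β)⁻¹).const_mul
      ((n * volume.real (Metric.ball (0 : En n) 1) : ℝ) : ℂ)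
    have e : ((n * volume.real (Metric.ball (0 : En n) 1) : ℝ) : ℂ) * ((Complex.Gamma β)⁻¹ *
        (1 / 2 * Complex.Gamma (β - 1 + 1))) = L := by
      rw [sub_add_cancel, hL]
      push_cast
      field_simp
    rw [e] at h
    refine h.congr' ?_
    filter_upwards [self_mem_nhdsWithin] with δ hδ
    rw [shellMean_eq_integral hn hδ hre]
  have hev : ∀ᶠ δ : ℝ in 𝓝[>] 0, 3 / 4 * L < ‖shellMean n δ β (fun _ => 1)‖ := by
    refine hlim.norm.eventually_const_lt ?_
    rw [Complex.norm_real, Real.norm_eq_abs, abs_of_pos hL0]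
    linarith
  obtain ⟨δ₁, hδ₁, hδ₁'⟩ := mem_nhdsGT_iff_exists_Ioo_subset.1 hev
  have hδ₁0 : (0 : ℝ) < δ₁ := hδ₁
  refine ⟨min (1 / 2) (L / (16 * (B + 1))), L / 4, min 1 (min (δ₁ / 2) (L / (4 * (C + 1)))),
    by positivity, (min_le_left _ _).trans (by norm_num), by positivity, by positivity,
    min_le_left _ _, fun δ hδ hδ' w hw => ?_⟩
  have hw1 : ‖w‖ ≤ 1 / 2 := hw.trans (min_le_left _ _)
  have hw2 : ‖w‖ ≤ L / (16 * (B + 1)) := hw.trans (min_le_right _ _)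
  have hδ1 : δ ≤ 1 := hδ'.trans (min_le_left _ _)
  have hδ2 : δ ≤ δ₁ / 2 := hδ'.trans ((min_le_right _ _).trans (min_le_left _ _))
  have hδ3 : δ ≤ L / (4 * (C + 1)) := hδ'.trans ((min_le_right _ _).trans (min_le_right _ _))
  have a1 : 3 / 4 * L < ‖shellMean n δ β (fun _ => 1)‖ := hδ₁' ⟨hδ, by linarith⟩
  have hsm := contDiff_slice (contDiff_expPair (n := n)) w
  have a2 : ‖shellMean n δ β (fun y => expPair (w, y) - 1)‖ ≤ L / 4 := by
    refine (hB δ hδ _ (4 * ‖w‖) (hsm.sub contDiff_const)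
      fun y hy => norm_expPair_sub_one_le hw1 hy).trans ?_
    rw [le_div_iff₀ (by positivity)] at hw2
    nlinarith [norm_nonneg w]
  have a3 : shellMean n δ β (fun y => expPair (w, y)) =
      shellMean n δ β (fun _ => 1) + shellMean n δ β (fun y => expPair (w, y) - 1) := by
    rw [shellMean, shellMean, shellMean, ← mul_add, ← ballMean_add
      (contDiff_expWeight δ contDiff_const) (contDiff_expWeight δ (hsm.sub contDiff_const))]
    congr 2
    funext y
    simp only [expWeight]
    ring
  have a4 := hC δ hδ hδ1 w (hw1.trans (by norm_num))
  have a5 : C * δ ≤ L / 4 := by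
    rw [le_div_iff₀ (by positivity)] at hδ3
    nlinarith
  have b1 : ‖shellMean n δ β (fun _ => 1)‖ ≤ ‖shellMean n δ β (fun y => expPair (w, y))‖ +
      ‖shellMean n δ β (fun y => expPair (w, y) - 1)‖ := by
    rw [a3]
    exact norm_le_add_norm_add _ _
  have b2 := norm_sub_norm_le (shellMean n δ β (fun y => expPair (w, y)))
    (shellMean n δ α (fun y => expPair (w, y)))
  rw [norm_sub_rev] at b2
  linarith

/-- A smooth cutoff equal to `1` on `[-3, ∞)` and to `0` on `(-∞, -4]`. -/
noncomputable def leftCutoff (s : ℝ) : ℝ := Real.smoothTransition (s + 4)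

theorem contDiff_leftCutoff : ContDiff ℝ ∞ leftCutoff :=
  Real.smoothTransition.contDiff.comp (contDiff_id.add contDiff_const)

theorem leftCutoff_eq_one {s : ℝ} (hs : -3 ≤ s) : leftCutoff s = 1 :=
  Real.smoothTransition.one_of_one_le (by linarith)

theorem leftCutoff_eq_zero {s : ℝ} (hs : s ≤ -4) : leftCutoff s = 0 :=
  Real.smoothTransition.zero_of_nonpos (by linarith)

theorem leftCutoff_nonneg (s : ℝ) : 0 ≤ leftCutoff s := Real.smoothTransition.nonneg _

theorem leftCutoff_le_one (s : ℝ) : leftCutoff s ≤ 1 := Real.smoothTransition.le_one _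

/-- The radial profile of the test function concentrated in a `δ`-neighbourhood of the unit
sphere. -/
noncomputable def shellProfile (δ u : ℝ) : ℝ :=
  leftCutoff ((1 - u) / δ) * Real.exp (-((1 - u) / δ))

theorem shellProfile_nonneg (δ u : ℝ) : 0 ≤ shellProfile δ u :=
  mul_nonneg (leftCutoff_nonneg _) (Real.exp_pos _).le

theorem shellProfile_le (δ u : ℝ) : shellProfile δ u ≤ Real.exp 4 := by
  rcases le_or_gt ((1 - u) / δ) (-4) with h | h
  · rw [shellProfile, leftCutoff_eq_zero h, zero_mul]
    positivity
  · calc shellProfile δ u ≤ 1 * Real.exp 4 :=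
        mul_le_mul (leftCutoff_le_one _) (Real.exp_le_exp.2 (by linarith)) (Real.exp_pos _).le
          zero_le_one
      _ = _ := one_mul _

theorem contDiff_shell (δ : ℝ) :
    ContDiff ℝ ∞ fun y : En n => (shellProfile δ (‖y‖ ^ 2) : ℂ) := by
  have h : ContDiff ℝ ∞ fun y : En n => (1 - ‖y‖ ^ 2) / δ :=
    (contDiff_const.sub (contDiff_norm_sq ℝ)).div_const δ
  exact Complex.ofRealCLM.contDiff.comp
    ((contDiff_leftCutoff.comp h).mul (Real.contDiff_exp.comp h.neg))

theorem shellProfile_eq_zero {δ r : ℝ} (hδ : 0 < δ) (hδ1 : δ ≤ 1) (hr : 3 ≤ r) :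
    shellProfile δ (r ^ 2) = 0 := by
  rw [shellProfile, leftCutoff_eq_zero, zero_mul]
  rw [div_le_iff₀ hδ]
  nlinarith

theorem hasCompactSupport_shell {δ : ℝ} (hδ : 0 < δ) (hδ1 : δ ≤ 1) :
    HasCompactSupport fun y : En n => (shellProfile δ (‖y‖ ^ 2) : ℂ) := by
  refine HasCompactSupport.intro (isCompact_closedBall 0 3) fun y hy => ?_
  rw [mem_closedBall_zero_iff, not_le] at hy
  rw [shellProfile_eq_zero hδ hδ1 hy.le, Complex.ofReal_zero]

theorem shellProfile_le_exp_abs {δ r : ℝ} (hδ : 0 < δ) (hr : 0 ≤ r) :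
    shellProfile δ (r ^ 2) ≤ Real.exp 6 * Real.exp (-|(r - 1) / δ|) := by
  rw [← Real.exp_add]
  rcases le_or_gt ((1 - r ^ 2) / δ) (-4) with h | h
  · rw [shellProfile, leftCutoff_eq_zero h, zero_mul]
    positivity
  · have h1 : shellProfile δ (r ^ 2) ≤ 1 * Real.exp (-((1 - r ^ 2) / δ)) :=
      mul_le_mul_of_nonneg_right (leftCutoff_le_one _) (Real.exp_pos _).le
    rw [one_mul] at h1
    refine h1.trans (Real.exp_le_exp.2 ?_)
    rw [abs_div, abs_of_pos hδ]
    rw [lt_div_iff₀ hδ] at h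
    rcases le_total r 1 with hr1 | hr1
    · rw [abs_of_nonpos (by linarith)]
      have : -(r - 1) / δ ≤ (1 - r ^ 2) / δ := by
        gcongr
        nlinarith
      linarith
    · rw [abs_of_nonneg (by linarith)]
      have : (r - 1) / δ - (1 - r ^ 2) / δ ≤ 6 := by
        rw [← sub_div, div_le_iff₀ hδ]
        nlinarith
      linarith

theorem integral_exp_neg_abs : ∫ s : ℝ, Real.exp (-|s|) = 2 := by
  rw [integral_comp_abs (f := fun s => Real.exp (-s)), integral_exp_neg_Ioi_zero, mul_one]

theorem integrable_exp_neg_abs : Integrable fun s : ℝ => Real.exp (-|s|) := by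
  by_contra h
  have := integral_exp_neg_abs
  rw [integral_undef h] at this
  norm_num at this

theorem lintegral_shell_le (hn : 0 < n) {δ : ℝ} (hδ : 0 < δ) (hδ1 : δ ≤ 1) :
    ∫⁻ y : En n, ‖(shellProfile δ (‖y‖ ^ 2) : ℂ)‖ₑ ≤
      ENNReal.ofReal (n * volume.real (Metric.ball (0 : En n) 1) *
        (3 ^ (n - 1) * Real.exp 6 * 2) * δ) := by
  have : Nonempty (Fin n) := ⟨⟨0, hn⟩⟩
  have hint : Integrable fun y : En n => (shellProfile δ (‖y‖ ^ 2) : ℂ) :=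
    (contDiff_shell δ).continuous.integrable_of_hasCompactSupport
      (hasCompactSupport_shell hδ hδ1)
  rw [← ofReal_integral_norm_eq_lintegral_enorm hint]
  refine ENNReal.ofReal_le_ofReal ?_
  simp only [Complex.norm_real, Real.norm_eq_abs, abs_of_nonneg (shellProfile_nonneg _ _)]
  rw [integral_fun_norm_addHaar volume (fun r => shellProfile δ (r ^ 2)),
    finrank_euclideanSpace_fin, nsmul_eq_mul, smul_eq_mul]
  have hG : Integrable fun r : ℝ => Real.exp (-|(r - 1) / δ|) :=
    (integrable_exp_neg_abs.comp_div hδ.ne').comp_sub_right 1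
  have hGi : ∫ r : ℝ, Real.exp (-|(r - 1) / δ|) = δ * 2 := by
    rw [integral_sub_right_eq_self (fun r : ℝ => Real.exp (-|r / δ|)) 1,
      Measure.integral_comp_div (fun r : ℝ => Real.exp (-|r|)), integral_exp_neg_abs,
      abs_of_pos hδ, smul_eq_mul]
  have key : ∫ r in Ioi (0 : ℝ), r ^ (n - 1) • shellProfile δ (r ^ 2) ≤
      3 ^ (n - 1) * Real.exp 6 * (δ * 2) := by
    rw [← hGi, ← integral_const_mul]
    refine le_trans ?_ (setIntegral_le_integral (s := Ioi 0) (hG.const_mul _)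
      (Eventually.of_forall fun r => by positivity))
    refine integral_mono_of_nonneg ?_ (hG.const_mul _).integrableOn ?_
    · filter_upwards [ae_restrict_mem measurableSet_Ioi] with r hr
      have : (0 : ℝ) < r := hr
      exact mul_nonneg (by positivity) (shellProfile_nonneg _ _)
    · filter_upwards [ae_restrict_mem measurableSet_Ioi] with r hr
      have hr0 : (0 : ℝ) < r := hr
      rw [smul_eq_mul, mul_assoc]
      rcases le_or_gt 3 r with h3 | h3
      · rw [shellProfile_eq_zero hδ hδ1 h3, mul_zero]
        positivity
      · exact mul_le_mul (pow_le_pow_left₀ hr0.le h3.le _) (shellProfile_le_exp_abs hδ hr0.le)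
          (shellProfile_nonneg _ _) (by positivity)
  calc _ ≤ n * (volume.real (Metric.ball (0 : En n) 1) * (3 ^ (n - 1) * Real.exp 6 * (δ * 2))) := by
        gcongr
    _ = _ := by ring

/-- The test function concentrated in a `δ`-neighbourhood of the unit sphere. -/
noncomputable def shellFun (n : ℕ) {δ : ℝ} (hδ : 0 < δ) (hδ1 : δ ≤ 1) : 𝓢(En n, ℂ) :=
  (hasCompactSupport_shell hδ hδ1).toSchwartzMap (contDiff_shell δ)

/-- Near the origin the ball means of the shell function are shell means: the cutoff is not seen
by the unit ball about `δ w`. -/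
theorem steinMean_shellFun {δ : ℝ} (hδ : 0 < δ) (hδ1 : δ ≤ 1) (α : ℂ) {w : En n}
    (hw : ‖w‖ ≤ 1) :
    steinMean n α 1 (shellFun n hδ hδ1) (δ • w) =
      (Real.exp (δ * ‖w‖ ^ 2) : ℂ) * ((δ : ℂ) ^ α * shellMean n δ α (fun y => expPair (w, y))) := by
  have hsm := contDiff_expWeight δ (contDiff_slice (contDiff_expPair (n := n)) w)
  have hδ0 : (δ : ℂ) ≠ 0 := by exact_mod_cast hδ.ne'
  rw [steinMean_eq_ballMean, shellMean, Complex.cpow_neg, ← mul_assoc ((δ : ℂ) ^ α),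
    mul_inv_cancel₀ (by simp [Complex.cpow_eq_zero_iff, hδ0]), one_mul, ← ballMean_const_mul hsm]
  refine ballMean_congr ((shellFun n hδ hδ1).smooth ⊤ |>.comp
    (contDiff_const.sub (contDiff_id.const_smul (1 : ℝ)))) (contDiff_const.mul hsm)
    (fun y hy => ?_) α
  have e : ‖δ • w - (1 : ℝ) • y‖ ^ 2 = ‖y‖ ^ 2 - 2 * δ * inner ℝ w y + δ ^ 2 * ‖w‖ ^ 2 := by
    rw [one_smul, norm_sub_sq_real, norm_smul, Real.norm_eq_abs, abs_of_pos hδ,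
      real_inner_smul_left]
    ring
  have h1 : ‖δ • w - (1 : ℝ) • y‖ ≤ 1 + δ := by
    refine (norm_sub_le _ _).trans ?_
    rw [norm_smul, Real.norm_eq_abs, abs_of_pos hδ, one_smul]
    nlinarith
  have h2 : -3 ≤ (1 - ‖δ • w - (1 : ℝ) • y‖ ^ 2) / δ := by
    rw [le_div_iff₀ hδ]
    nlinarith [norm_nonneg (δ • w - (1 : ℝ) • y)]
  have h3 : -((1 - ‖δ • w - (1 : ℝ) • y‖ ^ 2) / δ) =
      δ * ‖w‖ ^ 2 + (-((1 - ‖y‖ ^ 2) / δ) + -2 * inner ℝ w y) := by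
    rw [e]
    field_simp
    ring
  change (shellProfile δ (‖δ • w - (1 : ℝ) • y‖ ^ 2) : ℂ) = _
  rw [shellProfile, leftCutoff_eq_one h2, one_mul, h3, Real.exp_add, Real.exp_add, expWeight,
    expPair]
  push_cast
  rfl

/-- The necessary condition given by a neighbourhood of the unit sphere: the spherical means focus
at the origin. -/
theorem re_ge_of_shell (hn : 0 < n) {p q : ℝ≥0∞} (hp : 1 ≤ p) (hq : 1 ≤ q) {α : ℂ} {C : ℝ≥0}
    (hC : ∀ f : 𝓢(En n, ℂ),
      eLpNorm (localSteinMaximal n α f) q volume ≤ C * eLpNorm f p volume) :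
    recip p - n * recip q ≤ α.re := by
  have : Nonempty (Fin n) := ⟨⟨0, hn⟩⟩
  obtain ⟨w₀, c, δ₀, hw₀, hw₁, hc, hδ₀, hδ₁, hlow⟩ := shellMean_lower hn α
  set v : ℝ := volume.real (Metric.closedBall (0 : En n) w₀) with hv
  have hv0 : 0 < v := ENNReal.toReal_pos
    (Metric.measure_closedBall_pos volume 0 hw₀).ne' measure_closedBall_lt_top.ne
  have hω : 0 < volume.real (Metric.ball (0 : En n) 1) :=
    ENNReal.toReal_pos (Metric.measure_ball_pos volume 0 one_pos).ne' measure_ball_lt_top.ne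
  have hn' : (0 : ℝ) < n := by exact_mod_cast hn
  set I₀ : ℝ := n * volume.real (Metric.ball (0 : En n) 1) * (3 ^ (n - 1) * Real.exp 6 * 2)
    with hI₀
  have hI0 : 0 < I₀ := by positivity
  have key : recip p ≤ α.re + n * recip q := by
    refine exponent_le_of_small (a := c * v ^ recip q) (b := C * (Real.exp 4 * I₀ ^ recip p))
      (by positivity) hδ₀ fun δ hδ hδ' => ?_
    have hδ1 : δ ≤ 1 := hδ'.trans hδ₁
    have h := test_bound hp hq hC (shellFun n hδ hδ1) (K := Real.exp 4) (I := I₀ * δ)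
      (c := c * δ ^ α.re) (τ := δ ^ n * v) (T := Metric.closedBall 0 (δ * w₀))
      (Real.one_le_exp (by norm_num)) (by positivity) (fun y => ?_)
      (lintegral_shell_le hn hδ hδ1) (by positivity) Metric.isClosed_closedBall.measurableSet
      (by positivity) ?_ fun x hx => ⟨1, by norm_num, ?_⟩
    · rw [Real.mul_rpow (by positivity) hv0.le, Real.mul_rpow hI0.le hδ.le, ← Real.rpow_natCast,
        ← Real.rpow_mul hδ.le] at h
      rw [Real.rpow_add hδ]
      linarith
    · change ‖(shellProfile δ (‖y‖ ^ 2) : ℂ)‖ ≤ _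
      rw [Complex.norm_real, Real.norm_eq_abs, abs_of_nonneg (shellProfile_nonneg _ _)]
      exact shellProfile_le _ _
    · rw [ENNReal.ofReal_mul (by positivity), hv, measureReal_def,
        ENNReal.ofReal_toReal measure_closedBall_lt_top.ne,
        Measure.addHaar_closedBall_mul volume 0 hδ.le hw₀.le, finrank_euclideanSpace_fin]
    · set w : En n := δ⁻¹ • x with hw
      have hxw : x = δ • w := by rw [hw, smul_smul, mul_inv_cancel₀ hδ.ne', one_smul]
      have hw' : ‖w‖ ≤ w₀ := by
        rw [mem_closedBall_zero_iff] at hx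
        rw [hw, norm_smul, norm_inv, Real.norm_eq_abs, abs_of_pos hδ, inv_mul_le_iff₀ hδ]
        exact hx
      rw [hxw, steinMean_shellFun hδ hδ1 α (hw'.trans hw₁), norm_mul, norm_mul,
        Complex.norm_cpow_eq_rpow_re_of_pos hδ, Complex.norm_real, Real.norm_eq_abs, Real.abs_exp]
      have h1 : 1 ≤ Real.exp (δ * ‖w‖ ^ 2) := Real.one_le_exp (by positivity)
      have h2 := hlow δ hδ hδ' w hw'
      have h3 := Real.rpow_pos_of_pos hδ α.re
      calc c * δ ^ α.re = 1 * (δ ^ α.re * c) := by ring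
        _ ≤ _ := by gcongr
  linarith

/-! ### Splitting off the first coordinate -/

/-- The point of `En (m + 1)` with first coordinate `z.1` and remaining coordinates `z.2`. -/
def consE (z : ℝ × En m) : En (m + 1) := WithLp.toLp 2 (Fin.cons z.1 (WithLp.ofLp z.2))

/-- The coordinates of a vector after the first one. -/
noncomputable def tailE : En (m + 1) →L[ℝ] En m :=
  LinearMap.toContinuousLinearMap
    { toFun := fun z => WithLp.toLp 2 fun i => z i.succ
      map_add' := fun _ _ => rfl
      map_smul' := fun _ _ => rfl }

@[simp] theorem tailE_apply (z : En (m + 1)) (i : Fin m) : tailE z i = z i.succ := rfl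

@[simp] theorem consE_zero (z : ℝ × En m) : consE z 0 = z.1 := rfl

@[simp] theorem tailE_consE (z : ℝ × En m) : tailE (consE z) = z.2 := by
  ext i
  simp [consE]

theorem norm_sq_split (z : En (m + 1)) : ‖z‖ ^ 2 = z 0 ^ 2 + ‖tailE z‖ ^ 2 := by
  rw [EuclideanSpace.real_norm_sq_eq, EuclideanSpace.real_norm_sq_eq, Fin.sum_univ_succ]
  rfl

theorem inner_split (x z : En (m + 1)) :
    inner ℝ x z = x 0 * z 0 + inner ℝ (tailE x) (tailE z) := by
  simp only [PiLp.inner_apply, Fin.sum_univ_succ, RCLike.inner_apply, conj_trivial, tailE_apply]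
  ring

theorem measurePreserving_consE : MeasurePreserving (consE (m := m)) := by
  have h1 := (MeasurePreserving.id (volume : Measure ℝ)).prod (PiLp.volume_preserving_ofLp (Fin m))
  have h2 := (volume_preserving_piFinSuccAbove (fun _ : Fin (m + 1) => ℝ) 0).symm
  have h3 := PiLp.volume_preserving_toLp (Fin (m + 1))
  have h : MeasurePreserving (WithLp.toLp 2 ∘
      (MeasurableEquiv.piFinSuccAbove (fun _ : Fin (m + 1) => ℝ) 0).symm ∘
      Prod.map id WithLp.ofLp) ((volume : Measure ℝ).prod (volume : Measure (En m))) volume :=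
    h3.comp (h2.comp h1)
  have e : consE (m := m) = WithLp.toLp 2 ∘
      (MeasurableEquiv.piFinSuccAbove (fun _ : Fin (m + 1) => ℝ) 0).symm ∘
      Prod.map id WithLp.ofLp := by
    funext z
    ext i
    simp [consE, MeasurableEquiv.piFinSuccAbove, Fin.insertNthEquiv]
  rw [e]
  exact h

theorem consE_injective : Function.Injective (consE (m := m)) := by
  intro z z' h
  have h0 : z.1 = z'.1 := by rw [← consE_zero z, h, consE_zero]
  have h1 : z.2 = z'.2 := by rw [← tailE_consE z, h, tailE_consE]
  exact Prod.ext h0 h1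

theorem measurableEmbedding_consE : MeasurableEmbedding (consE (m := m)) :=
  measurePreserving_consE.measurable.measurableEmbedding consE_injective

theorem map_scale_prod {δ ε : ℝ} (hδ : 0 < δ) (hε : 0 < ε) :
    Measure.map (Prod.map (δ • ·) (ε • ·)) (volume : Measure (ℝ × En m)) =
      ENNReal.ofReal (δ * ε ^ m)⁻¹ • volume := by
  rw [Measure.volume_eq_prod, ← Measure.map_prod_map _ _ (by fun_prop) (by fun_prop),
    Measure.map_addHaar_smul _ hδ.ne', Measure.map_addHaar_smul _ hε.ne',
    Measure.prod_smul_left, Measure.prod_smul_right, smul_smul, ← ENNReal.ofReal_mul (abs_nonneg _),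
    finrank_euclideanSpace_fin, Module.finrank_self, ← abs_mul, abs_of_nonneg (by positivity)]
  congr 2
  rw [pow_one, mul_inv]

/-- Integration over `En (m + 1)` in coordinates scaled by `δ` in the first and by `ε` in the
remaining directions. -/
theorem integral_consE_scaled {E : Type*} [NormedAddCommGroup E] [NormedSpace ℝ E]
    (F : En (m + 1) → E) {δ ε : ℝ} (hδ : 0 < δ) (hε : 0 < ε) :
    ∫ z, F z = (δ * ε ^ m) • ∫ z : ℝ × En m, F (consE (δ * z.1, ε • z.2)) := by
  have hemb : MeasurableEmbedding (Prod.map (δ • ·) (ε • ·) : ℝ × En m → ℝ × En m) :=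
    (Measurable.prodMap (by fun_prop) (by fun_prop)).measurableEmbedding
      ((smul_right_injective ℝ hδ.ne').prodMap (smul_right_injective (En m) hε.ne'))
  have h := hemb.integral_map (μ := volume) fun z => F (consE z)
  rw [map_scale_prod hδ hε, integral_smul_measure, ENNReal.toReal_ofReal (by positivity),
    measurePreserving_consE.integral_comp measurableEmbedding_consE] at h
  rw [← one_smul ℝ (∫ z, F z), ← mul_inv_cancel₀ (show δ * ε ^ m ≠ 0 by positivity), mul_smul, h]
  rfl

theorem volume_split (s : Set ℝ) (B : Set (En m)) :
    volume {x : En (m + 1) | x 0 ∈ s ∧ tailE x ∈ B} = volume s * volume B := by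
  have h : consE ⁻¹' {x : En (m + 1) | x 0 ∈ s ∧ tailE x ∈ B} = s ×ˢ B := by
    ext z
    simp
  rw [← Measure.prod_prod, ← Measure.volume_eq_prod, ← h,
    measurePreserving_consE.measure_preimage_emb measurableEmbedding_consE]

/-! ### Exponential plates -/

/-- The function `exp (-z₀ / δ) b(z' / ε)`, where `z₀` is the first coordinate of `z` and `z'` the
vector of the others. -/
noncomputable def plate (δ ε : ℝ) (b : En m → ℂ) (z : En (m + 1)) : ℂ :=
  (Real.exp (-(z 0 / δ)) : ℂ) * b (ε⁻¹ • tailE z)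

theorem contDiff_plate (δ ε : ℝ) {b : En m → ℂ} (hb : ContDiff ℝ ∞ b) :
    ContDiff ℝ ∞ (plate δ ε b) := by
  refine ContDiff.mul (Complex.ofRealCLM.contDiff.comp (Real.contDiff_exp.comp ?_)) (hb.comp ?_)
  · exact ((EuclideanSpace.proj (𝕜 := ℝ) (0 : Fin (m + 1))).contDiff.div_const δ).neg
  · exact (tailE (m := m)).contDiff.const_smul ε⁻¹

theorem fderiv_plate (δ ε : ℝ) {b : En m → ℂ} (hb : ContDiff ℝ ∞ b) (z v : En (m + 1)) :
    fderiv ℝ (plate δ ε b) z v = -(v 0 / δ : ℝ) * plate δ ε b z +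
      (Real.exp (-(z 0 / δ)) : ℂ) * fderiv ℝ b (ε⁻¹ • tailE z) (ε⁻¹ • tailE v) := by
  have h1 : HasFDerivAt (fun z : En (m + 1) => -(z 0 / δ))
      (-(δ⁻¹ • EuclideanSpace.proj (𝕜 := ℝ) (0 : Fin (m + 1)))) z := by
    have := ((EuclideanSpace.proj (𝕜 := ℝ) (0 : Fin (m + 1))).hasFDerivAt (x := z)).const_smul δ⁻¹
    refine this.neg.congr_of_eventuallyEq (Eventually.of_forall fun z => ?_)
    simp
    ring
  have h2 : HasFDerivAt (fun z : En (m + 1) => ε⁻¹ • tailE z) (ε⁻¹ • tailE) z :=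
    (tailE.hasFDerivAt (x := z)).const_smul ε⁻¹
  have h3 := (Complex.ofRealCLM.hasFDerivAt.comp z h1.exp).mul
    ((hb.differentiable (by simp) (ε⁻¹ • tailE z)).hasFDerivAt.comp z h2)
  have h4 : HasFDerivAt (plate δ ε b) _ z := h3
  rw [h4.fderiv]
  simp [plate]
  ring

theorem fderiv_plate_zero (δ ε : ℝ) {b : En m → ℂ} (hb : ContDiff ℝ ∞ b) (z : En (m + 1)) :
    fderiv ℝ (plate δ ε b) z (EuclideanSpace.single 0 1) = -(δ⁻¹ : ℝ) * plate δ ε b z := by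
  have : tailE (EuclideanSpace.single (0 : Fin (m + 1)) (1 : ℝ)) = 0 := by
    ext i
    simp
  rw [fderiv_plate δ ε hb, this]
  simp

theorem fderiv_plate_succ (δ ε : ℝ) {b : En m → ℂ} (hb : ContDiff ℝ ∞ b) (z : En (m + 1))
    (i : Fin m) :
    fderiv ℝ (plate δ ε b) z (EuclideanSpace.single i.succ 1) =
      (ε⁻¹ : ℝ) * plate δ ε (fun w => fderiv ℝ b w (EuclideanSpace.single i 1)) z := by
  have : tailE (EuclideanSpace.single i.succ (1 : ℝ)) = EuclideanSpace.single i 1 := by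
    ext j
    simp
  rw [fderiv_plate δ ε hb, this]
  simp [plate]
  ring

theorem contDiff_plate_translate (δ ε t : ℝ) (x : En (m + 1)) {b : En m → ℂ}
    (hb : ContDiff ℝ ∞ b) : ContDiff ℝ ∞ fun y => plate δ ε b (x - t • y) :=
  (contDiff_plate δ ε hb).comp (contDiff_const.sub (contDiff_id.const_smul t))

theorem fderiv_comp_sub_smul {k : En (m + 1) → ℂ} (hk : ContDiff ℝ ∞ k) (t : ℝ)
    (x y v : En (m + 1)) :
    fderiv ℝ (fun y => k (x - t • y)) y v = -(t : ℂ) * fderiv ℝ k (x - t • y) v := by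
  have h1 : HasFDerivAt (fun y : En (m + 1) => x - t • y)
      (-(t • ContinuousLinearMap.id ℝ (En (m + 1)))) y :=
    ((hasFDerivAt_id y).const_smul t).const_sub x
  have h2 : HasFDerivAt (fun y => k (x - t • y)) _ y :=
    (hk.differentiable (by simp) (x - t • y)).hasFDerivAt.comp y h1
  rw [h2.fderiv]
  simp

/-- The Laplacian, as the sum of the second partial derivatives. -/
noncomputable def lap (b : En m → ℂ) (w : En m) : ℂ :=
  ∑ i, fderiv ℝ (fun z => fderiv ℝ b z (EuclideanSpace.single i 1)) w (EuclideanSpace.single i 1)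

theorem contDiff_lap {b : En m → ℂ} (hb : ContDiff ℝ ∞ b) : ContDiff ℝ ∞ (lap b) :=
  ContDiff.sum fun _ _ => contDiff_partial (contDiff_partial hb _) _

theorem lap_eq_zero {b : En m → ℂ} (hb : ∀ w, 1 < ‖w‖ → b w = 0) (w : En m) (hw : 1 < ‖w‖) :
    lap b w = 0 := by
  have hop : IsOpen {w : En m | 1 < ‖w‖} := isOpen_lt continuous_const continuous_norm
  have aux : ∀ {f : En m → ℂ}, (∀ w, 1 < ‖w‖ → f w = 0) → ∀ w, 1 < ‖w‖ → fderiv ℝ f w = 0 := by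
    intro f hf w hw
    have : f =ᶠ[𝓝 w] fun _ => 0 := by
      filter_upwards [hop.mem_nhds hw] with z hz using hf z hz
    rw [this.fderiv_eq, fderiv_fun_const, Pi.zero_apply]
  refine Finset.sum_eq_zero fun i _ => ?_
  rw [aux (fun z hz => by rw [aux hb z hz]; rfl) w hw]
  rfl

/-- The ball mean of a translated and dilated plate. -/
noncomputable def plateMean (δ ε t : ℝ) (x : En (m + 1)) (α : ℂ) (b : En m → ℂ) : ℂ :=
  ballMean (m + 1) α fun y => plate δ ε b (x - t • y)

/-- The Laplacian recursion for plates: differentiating twice in the first coordinate reproduces the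
plate, and the other second derivatives fall on `b`. -/
theorem plateMean_rec (δ ε t : ℝ) (x : En (m + 1)) (α : ℂ) {b : En m → ℂ}
    (hb : ContDiff ℝ ∞ b) :
    plateMean δ ε t x α b = (((m + 1 : ℕ) : ℂ) / 2 + α) * plateMean δ ε t x (α + 1) b +
      1 / 4 * (((t / δ) ^ 2 : ℝ) * plateMean δ ε t x (α + 2) b +
        ((t / ε) ^ 2 : ℝ) * plateMean δ ε t x (α + 2) (lap b)) := by
  have hg := contDiff_plate_translate δ ε t x hb
  have hpi := fun i : Fin m => contDiff_partial hb (EuclideanSpace.single i 1)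
  have hpii := fun i : Fin m => contDiff_partial (hpi i) (EuclideanSpace.single i 1)
  have e0 : (fun y => fderiv ℝ (fun z => fderiv ℝ (fun y => plate δ ε b (x - t • y)) z
      (EuclideanSpace.single 0 1)) y (EuclideanSpace.single 0 1)) =
      fun y => ((t / δ) ^ 2 : ℝ) * plate δ ε b (x - t • y) := by
    funext y
    simp only [fderiv_comp_sub_smul (contDiff_plate δ ε hb), fderiv_plate_zero δ ε hb]
    rw [fderiv_const_mul (((contDiff_const.mul hg).differentiable (by simp)) y),
      fderiv_const_mul (hg.differentiable (by simp) y), _root_.smul_apply,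
      _root_.smul_apply, fderiv_comp_sub_smul (contDiff_plate δ ε hb),
      fderiv_plate_zero δ ε hb]
    simp
    ring
  have ei : ∀ i : Fin m, (fun y => fderiv ℝ (fun z => fderiv ℝ (fun y => plate δ ε b (x - t • y)) z
      (EuclideanSpace.single i.succ 1)) y (EuclideanSpace.single i.succ 1)) =
      fun y => ((t / ε) ^ 2 : ℝ) * plate δ ε (fun w => fderiv ℝ (fun z => fderiv ℝ b z
        (EuclideanSpace.single i 1)) w (EuclideanSpace.single i 1)) (x - t • y) := by
    intro i
    have hgi := contDiff_plate_translate δ ε t x (hpi i)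
    funext y
    simp only [fderiv_comp_sub_smul (contDiff_plate δ ε hb), fderiv_plate_succ δ ε hb]
    rw [fderiv_const_mul (((contDiff_const.mul hgi).differentiable (by simp)) y),
      fderiv_const_mul (hgi.differentiable (by simp) y), _root_.smul_apply,
      _root_.smul_apply, fderiv_comp_sub_smul (contDiff_plate δ ε (hpi i)),
      fderiv_plate_succ δ ε (hpi i)]
    simp
    ring
  have elap : (fun y => plate δ ε (lap b) (x - t • y)) = fun y => ∑ i, plate δ ε
      (fun w => fderiv ℝ (fun z => fderiv ℝ b z (EuclideanSpace.single i 1)) w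
        (EuclideanSpace.single i 1)) (x - t • y) := by
    funext y
    simp only [plate, lap, Finset.mul_sum]
  simp only [plateMean]
  rw [ballMean_laplacian hg, Fin.sum_univ_succ, e0, ballMean_const_mul hg, elap,
    ballMean_sum _ fun i => contDiff_plate_translate δ ε t x (hpii i)]
  simp only [ei, ballMean_const_mul (contDiff_plate_translate δ ε t x (hpii _)), Finset.mul_sum]

/-! ### The limiting profile of a plate -/

/-- Parameters `(δ, ξ, A, v, κ)` of the quadratic phase below. -/
abbrev PhaseParam (m : ℕ) : Type := ℝ × ℝ × ℝ × En m × ℝ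

/-- The quadratic polynomial `A + 2 ξ s + 2 v · w - κ |w|² - δ s²` of `(s, w)`. -/
noncomputable def phase (P : PhaseParam m) (z : ℝ × En m) : ℝ :=
  P.2.2.1 + 2 * P.2.1 * z.1 + 2 * inner ℝ P.2.2.2.1 z.2 - P.2.2.2.2 * ‖z.2‖ ^ 2 - P.1 * z.1 ^ 2

/-- The compact set of parameters for which the phase is used. -/
def phaseDomain (m : ℕ) : Set (PhaseParam m) :=
  Icc 0 1 ×ˢ Icc (1 / 2) 3 ×ˢ Icc (-1) 1 ×ˢ Metric.closedBall 0 1 ×ˢ Icc 0 1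

theorem isCompact_phaseDomain : IsCompact (phaseDomain m) :=
  isCompact_Icc.prod (isCompact_Icc.prod (isCompact_Icc.prod
    ((isCompact_closedBall _ _).prod isCompact_Icc)))

theorem continuous_phase : Continuous fun q : PhaseParam m × (ℝ × En m) => phase q.1 q.2 := by
  unfold phase
  fun_prop

/-- The integrand of `plateProfile`. -/
noncomputable def plateDensity (γ : ℂ) (b : En m → ℂ) (P : PhaseParam m) (z : ℝ × En m) : ℂ :=
  posPow γ (phase P z) * (Real.exp (-z.1) : ℂ) * b z.2

/-- The scaled ball mean of a plate, as a function of the parameters of the phase. -/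
noncomputable def plateProfile (α : ℂ) (b : En m → ℂ) (P : PhaseParam m) : ℂ :=
  (Complex.Gamma α)⁻¹ * ∫ z, plateDensity (α - 1) b P z

/-- An integrable bound for `plateDensity`. -/
noncomputable def plateBound (a : ℝ) (b : En m → ℂ) (z : ℝ × En m) : ℝ :=
  (14 ^ a * Real.exp 4 * (Ioi (0 : ℝ)).indicator (fun s => (2 * s) ^ a * Real.exp (-s)) (z.1 + 4)) *
    ‖b z.2‖

theorem integrable_of_unit_support {b : En m → ℂ} (hb : Continuous b)
    (hsupp : ∀ w, 1 < ‖w‖ → b w = 0) : Integrable b :=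
  hb.integrable_of_hasCompactSupport (HasCompactSupport.intro (isCompact_closedBall 0 1)
    fun w hw => hsupp w (by simpa using hw))

theorem integrable_plateBound {a : ℝ} (ha : 0 < a) {b : En m → ℂ} (hb : Continuous b)
    (hsupp : ∀ w, 1 < ‖w‖ → b w = 0) : Integrable (plateBound a b) :=
  (((integrable_radialBound ha).comp_add_right 4).const_mul _).mul_prod
    (integrable_of_unit_support hb hsupp).norm

theorem phase_le {P : PhaseParam m} (hP : P ∈ phaseDomain m) {z : ℝ × En m} (hz : ‖z.2‖ ≤ 1) :
    phase P z ≤ 3 + 2 * P.2.1 * z.1 := by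
  obtain ⟨δ, ξ, A, v, κ⟩ := P
  obtain ⟨⟨hδ, -⟩, -, ⟨-, hA⟩, hv, ⟨hκ, -⟩⟩ := hP
  simp only [mem_closedBall_zero_iff] at hv
  have h1 : inner ℝ v z.2 ≤ 1 := (real_inner_le_norm v z.2).trans
    (mul_le_one₀ hv (norm_nonneg _) hz)
  simp only [phase] at *
  nlinarith [mul_nonneg hδ (sq_nonneg z.1), mul_nonneg hκ (sq_nonneg ‖z.2‖)]

theorem norm_plateDensity_le {γ : ℂ} (hγ : 0 < γ.re) {b : En m → ℂ}
    (hsupp : ∀ w, 1 < ‖w‖ → b w = 0) {P : PhaseParam m} (hP : P ∈ phaseDomain m) (z : ℝ × En m) :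
    ‖plateDensity γ b P z‖ ≤ plateBound γ.re b z := by
  rw [plateDensity, plateBound, norm_mul, norm_mul, Complex.norm_real, Real.norm_eq_abs,
    Real.abs_exp]
  rcases lt_or_ge 1 ‖z.2‖ with hz | hz
  · simp [hsupp _ hz]
  refine mul_le_mul_of_nonneg_right ?_ (norm_nonneg _)
  have hle := phase_le hP hz
  have hξ1 : 1 / 2 ≤ P.2.1 := hP.2.1.1
  have hξ2 : P.2.1 ≤ 3 := hP.2.1.2
  -- the phase is nonpositive for `s ≤ -3`, because `ξ ≥ 1 / 2`
  rcases le_or_gt z.1 (-3) with hs | hs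
  · rw [posPow_of_nonpos (ne_zero_of_re_pos hγ) (hle.trans (by nlinarith)), norm_zero, zero_mul]
    refine mul_nonneg (by positivity) (indicator_nonneg (fun s hs => ?_) _)
    have : (0 : ℝ) < s := hs
    positivity
  · rw [indicator_of_mem (show z.1 + 4 ∈ Ioi (0 : ℝ) by simp only [mem_Ioi]; linarith)]
    have h1 : ‖posPow γ (phase P z)‖ ≤ (14 * (2 * (z.1 + 4))) ^ γ.re := by
      refine norm_posPow_le hγ (hle.trans ?_) (by linarith)
      rcases le_or_gt 0 z.1 with h0 | h0 <;> nlinarith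
    have h2 : Real.exp (-z.1) = Real.exp 4 * Real.exp (-(z.1 + 4)) := by
      rw [← Real.exp_add]
      congr 1
      ring
    rw [Real.mul_rpow (by norm_num) (by linarith)] at h1
    rw [h2]
    calc _ ≤ (14 ^ γ.re * (2 * (z.1 + 4)) ^ γ.re) * (Real.exp 4 * Real.exp (-(z.1 + 4))) := by
          gcongr
      _ = _ := by ring

theorem continuous_plateDensity {γ : ℂ} (hγ : 0 < γ.re) {b : En m → ℂ} (hb : Continuous b) :
    Continuous fun q : PhaseParam m × (ℝ × En m) => plateDensity γ b q.1 q.2 := by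
  have h1 := (posPow_continuous hγ).comp (continuous_phase (m := m))
  unfold plateDensity
  refine (h1.mul ?_).mul ?_ <;> fun_prop

theorem integrable_plateDensity {γ : ℂ} (hγ : 0 < γ.re) {b : En m → ℂ} (hb : Continuous b)
    (hsupp : ∀ w, 1 < ‖w‖ → b w = 0) {P : PhaseParam m} (hP : P ∈ phaseDomain m) :
    Integrable (plateDensity γ b P) :=
  (integrable_plateBound hγ hb hsupp).mono'
    ((continuous_plateDensity hγ hb).comp (Continuous.prodMk_right P)).aestronglyMeasurable
    (Eventually.of_forall fun z => norm_plateDensity_le hγ hsupp hP z)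

theorem continuousOn_plateProfile {α : ℂ} (hα : 1 < α.re) {b : En m → ℂ} (hb : Continuous b)
    (hsupp : ∀ w, 1 < ‖w‖ → b w = 0) : ContinuousOn (plateProfile α b) (phaseDomain m) := by
  have hre : 0 < (α - 1).re := by simpa using hα
  refine continuousOn_const.mul (continuousOn_of_dominated (bound := plateBound (α - 1).re b)
    (fun P hP => (integrable_plateDensity hre hb hsupp hP).aestronglyMeasurable)
    (fun P hP => Eventually.of_forall fun z => norm_plateDensity_le hre hsupp hP z)
    (integrable_plateBound hre hb hsupp) (Eventually.of_forall fun z => ?_))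
  exact ((continuous_plateDensity hre hb).comp (Continuous.prodMk_left z)).continuousOn

/-- The exponential integral over `w` that appears in the limit `δ → 0` of `plateProfile`. -/
noncomputable def plateLimit (b : En m → ℂ) (t A : ℝ) (v : En m) (κ : ℝ) : ℂ :=
  ∫ w, b w * (Real.exp ((A + 2 * inner ℝ v w - κ * ‖w‖ ^ 2) / (2 * t)) : ℂ)

theorem integral_posPow_affine {α : ℂ} (hα : 1 < α.re) {a : ℝ} (ha : 0 < a) (c : ℝ) :
    ∫ s : ℝ, posPow (α - 1) (c + a * s) * (Real.exp (-s) : ℂ) =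
      (a : ℂ) ^ (α - 1) * Complex.Gamma α * (Real.exp (c / a) : ℂ) := by
  have hre : 0 < (α - 1).re := by simpa using hα
  have h := integral_add_right_eq_self (μ := volume)
    (fun u : ℝ => posPow (α - 1) (a * u) * (Real.exp (-(u - c / a)) : ℂ)) (c / a)
  have e1 : (fun s : ℝ => posPow (α - 1) (a * (s + c / a)) *
      (Real.exp (-(s + c / a - c / a)) : ℂ)) =
      fun s => posPow (α - 1) (c + a * s) * (Real.exp (-s) : ℂ) := by
    funext s
    rw [mul_add, mul_div_cancel₀ _ ha.ne', add_sub_cancel_right, add_comm]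
  have e2 : (fun u : ℝ => posPow (α - 1) (a * u) * (Real.exp (-(u - c / a)) : ℂ)) =
      fun u => (a : ℂ) ^ (α - 1) * (Real.exp (c / a) : ℂ) * (Ioi (0 : ℝ)).indicator
        (fun x => ((Real.exp (-x) : ℝ) : ℂ) * (x : ℂ) ^ (α - 1)) u := by
    funext u
    rcases le_or_gt u 0 with h0 | h0
    · rw [posPow_of_nonpos (ne_zero_of_re_pos hre) (mul_nonpos_of_nonneg_of_nonpos ha.le h0),
        indicator_of_notMem (show u ∉ Ioi (0 : ℝ) by simpa using h0), zero_mul, mul_zero]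
    · rw [indicator_of_mem (show u ∈ Ioi (0 : ℝ) from h0), posPow_mul ha, posPow,
        max_eq_left h0.le, show -(u - c / a) = c / a + -u by ring, Real.exp_add,
        Complex.ofReal_mul]
      ring
  rw [e1, e2, integral_const_mul, integral_indicator measurableSet_Ioi] at h
  rw [h, Complex.Gamma_eq_integral (by linarith), Complex.GammaIntegral]
  ring

/-- At `δ = 0` the phase is affine in `s`, so that the integral in `s` is a Gamma integral, and the
factor `Γ(α)⁻¹` cancels. -/
theorem plateProfile_zero {α : ℂ} (hα : 1 < α.re) {b : En m → ℂ} (hb : Continuous b)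
    (hsupp : ∀ w, 1 < ‖w‖ → b w = 0) {t A κ : ℝ} {v : En m}
    (hP : ((0, t, A, v, κ) : PhaseParam m) ∈ phaseDomain m) :
    plateProfile α b (0, t, A, v, κ) = ((2 * t : ℝ) : ℂ) ^ (α - 1) * plateLimit b t A v κ := by
  have hre : 0 < (α - 1).re := by simpa using hα
  have ht : 0 < 2 * t := by
    have : 1 / 2 ≤ t := hP.2.1.1
    linarith
  have hint := integrable_plateDensity hre hb hsupp hP
  rw [Measure.volume_eq_prod] at hint
  rw [plateProfile, Measure.volume_eq_prod, integral_prod_symm _ hint]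
  have e : ∀ w : En m, ∫ s : ℝ, plateDensity (α - 1) b (0, t, A, v, κ) (s, w) =
      ((2 * t : ℝ) : ℂ) ^ (α - 1) * Complex.Gamma α *
        (b w * (Real.exp ((A + 2 * inner ℝ v w - κ * ‖w‖ ^ 2) / (2 * t)) : ℂ)) := by
    intro w
    have h := integral_posPow_affine hα ht (A + 2 * inner ℝ v w - κ * ‖w‖ ^ 2)
    calc ∫ s : ℝ, plateDensity (α - 1) b (0, t, A, v, κ) (s, w)
        = ∫ s : ℝ, (posPow (α - 1) ((A + 2 * inner ℝ v w - κ * ‖w‖ ^ 2) + 2 * t * s) *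
            (Real.exp (-s) : ℂ)) * b w := by
          congr 1
          funext s
          simp only [plateDensity, phase]
          congr 3
          ring
      _ = _ := by
          rw [integral_mul_const, h]
          ring
  have hΓ : Complex.Gamma α ≠ 0 := Complex.Gamma_ne_zero_of_re_pos (by linarith)
  simp only [e]
  rw [integral_const_mul, plateLimit]
  field_simp

/-- The configurations `(δ, ε, t, x)` in which a `δ × ε` plate meets the sphere of radius `t` about
`x` tangentially, up to errors controlled by `κ`. -/
structure Tangential (κ δ ε t : ℝ) (x : En (m + 1)) : Prop where
  pos : 0 < δ
  le : δ ≤ κ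
  le_mul : δ ≤ κ * ε
  sq_le : ε ^ 2 ≤ δ
  one_le : 1 ≤ t
  le_two : t ≤ 2
  coord_pos : 0 < x 0
  near : |t ^ 2 - ‖x‖ ^ 2| ≤ δ
  tail_le : ε * ‖tailE x‖ ≤ δ

theorem Tangential.mono {κ κ' δ ε t : ℝ} {x : En (m + 1)} (h : Tangential κ δ ε t x)
    (hκ : κ ≤ κ') (hε : 0 < ε) : Tangential κ' δ ε t x :=
  { h with
    le := h.le.trans hκ
    le_mul := h.le_mul.trans (by gcongr) }

theorem Tangential.eps_pos {κ δ ε t : ℝ} {x : En (m + 1)} (h : Tangential κ δ ε t x) :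
    0 < ε := by
  have h1 := h.pos
  have h2 := h.le
  have h3 := h.le_mul
  by_contra! hε
  nlinarith

theorem Tangential.tail_norm_le {κ δ ε t : ℝ} {x : En (m + 1)} (h : Tangential κ δ ε t x) :
    ‖tailE x‖ ≤ κ := by
  have h1 := h.tail_le.trans h.le_mul
  rw [mul_comm κ] at h1
  exact le_of_mul_le_mul_left h1 h.eps_pos

theorem Tangential.abs_sub_le {κ δ ε t : ℝ} {x : En (m + 1)} (h : Tangential κ δ ε t x)
    (hκ : κ ≤ 1 / 4) : |x 0 - t| ≤ 2 * κ := by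
  have h1 := abs_le.1 h.near
  have h2 := h.tail_norm_le
  have h3 := norm_sq_split x
  have h4 := h.one_le
  have h5 := h.coord_pos
  have h6 := h.le
  have h7 := norm_nonneg (tailE x)
  have h8 : ‖tailE x‖ ^ 2 ≤ κ := by nlinarith
  have h9 := sq_nonneg ‖tailE x‖
  have h10 := h.pos
  rw [abs_le]
  constructor <;> nlinarith

/-- The phase parameters of a tangential configuration. -/
noncomputable def phaseParam (δ ε t : ℝ) (x : En (m + 1)) : PhaseParam m :=
  (δ, x 0, (t ^ 2 - ‖x‖ ^ 2) / δ, (ε / δ) • tailE x, ε ^ 2 / δ)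

theorem Tangential.mem {κ δ ε t : ℝ} {x : En (m + 1)} (h : Tangential κ δ ε t x)
    {δ' ξ : ℝ} (hδ' : δ' ∈ Icc (0 : ℝ) 1) (hξ : ξ ∈ Icc (1 / 2 : ℝ) 3) :
    ((δ', ξ, (t ^ 2 - ‖x‖ ^ 2) / δ, (ε / δ) • tailE x, ε ^ 2 / δ) : PhaseParam m) ∈
      phaseDomain m := by
  have hδ := h.pos
  have hε := h.eps_pos
  have h1 := abs_le.1 h.near
  refine ⟨hδ', hξ, ⟨?_, ?_⟩, ?_, ?_, ?_⟩
  · simp only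
    rw [le_div_iff₀ hδ]
    linarith
  · simp only
    rw [div_le_iff₀ hδ]
    linarith
  · simp only [mem_closedBall_zero_iff]
    rw [norm_smul, Real.norm_eq_abs, abs_of_pos (by positivity), div_mul_eq_mul_div,
      div_le_one hδ]
    exact h.tail_le
  · simp only
    positivity
  · simp only
    rw [div_le_one hδ]
    exact h.sq_le

theorem Tangential.phaseParam_mem {κ δ ε t : ℝ} {x : En (m + 1)} (h : Tangential κ δ ε t x)
    (hκ : κ ≤ 1 / 4) : phaseParam δ ε t x ∈ phaseDomain m := by
  have h1 := abs_le.1 (h.abs_sub_le hκ)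
  refine h.mem ⟨h.pos.le, h.le.trans (by linarith)⟩ ⟨?_, ?_⟩
  · linarith [h.one_le]
  · linarith [h.le_two]

/-- The plate mean, normalized to have a limit as `δ → 0`. -/
noncomputable def normalizedPlateMean (δ ε t : ℝ) (x : En (m + 1)) (α : ℂ) (b : En m → ℂ) : ℂ :=
  ((δ / t ^ 2 : ℝ) : ℂ) ^ (1 - α) * ((t ^ (m + 1) / (δ * ε ^ m) : ℝ) : ℂ) *
    plateMean δ ε t x α b

/-- The substitution `y = (x - z) / t`, `z = (δ s, ε w)`, which turns `1 - |y|²` into `δ / t²` times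
the phase. -/
theorem normalizedPlateMean_eq_profile {α : ℂ} (hα : 1 < α.re) {b : En m → ℂ}
    (hb : ContDiff ℝ ∞ b) {δ ε t : ℝ} (hδ : 0 < δ) (hε : 0 < ε) (ht : 0 < t) (x : En (m + 1)) :
    normalizedPlateMean δ ε t x α b = plateProfile α b (phaseParam δ ε t x) := by
  have hs : 0 < δ / t ^ 2 := by positivity
  have hs0 : ((δ / t ^ 2 : ℝ) : ℂ) ≠ 0 := by exact_mod_cast hs.ne'
  rw [normalizedPlateMean, plateMean,
    ballMean_eq_integral (contDiff_plate_translate δ ε t x hb) hα, plateProfile]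
  set G : En (m + 1) → ℂ := fun y => posPow (α - 1) (1 - ‖y‖ ^ 2) * plate δ ε b (x - t • y)
    with hG
  have h1 : ∫ z, G (t⁻¹ • (x - z)) = ((t ^ (m + 1) : ℝ) : ℂ) * ∫ y, G y := by
    rw [integral_sub_left_eq_self (fun z => G (t⁻¹ • z)) volume x,
      Measure.integral_comp_inv_smul_of_nonneg volume G ht.le, finrank_euclideanSpace_fin,
      Complex.real_smul]
  have h2 : ∀ z : ℝ × En m, G (t⁻¹ • (x - consE (δ * z.1, ε • z.2))) =
      ((δ / t ^ 2 : ℝ) : ℂ) ^ (α - 1) * plateDensity (α - 1) b (phaseParam δ ε t x) z := by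
    intro z
    have e1 : x - t • t⁻¹ • (x - consE (δ * z.1, ε • z.2)) = consE (δ * z.1, ε • z.2) := by
      rw [smul_smul, mul_inv_cancel₀ ht.ne', one_smul, sub_sub_cancel]
    have e2 : 1 - ‖t⁻¹ • (x - consE (δ * z.1, ε • z.2))‖ ^ 2 =
        δ / t ^ 2 * phase (phaseParam δ ε t x) z := by
      rw [norm_smul, mul_pow, norm_sub_sq_real, inner_split, norm_sq_split (consE _),
        norm_inv, Real.norm_eq_abs, abs_of_pos ht]
      simp only [consE_zero, tailE_consE, phase, phaseParam, real_inner_smul_left,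
        real_inner_smul_right, norm_smul, Real.norm_eq_abs, abs_of_pos hε]
      field_simp
      ring
    simp only [hG]
    rw [e1, e2, posPow_mul hs, plateDensity, plate, tailE_consE, consE_zero, smul_smul,
      inv_mul_cancel₀ hε.ne', one_smul, mul_div_cancel_left₀ _ hδ.ne']
    ring
  rw [integral_consE_scaled _ hδ hε] at h1
  simp only [h2] at h1
  rw [integral_const_mul, Complex.real_smul] at h1
  have h3 : ((t ^ (m + 1) / (δ * ε ^ m) : ℝ) : ℂ) * ∫ y, G y =
      ((δ / t ^ 2 : ℝ) : ℂ) ^ (α - 1) *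
        ∫ z, plateDensity (α - 1) b (phaseParam δ ε t x) z := by
    have h4 : ((δ * ε ^ m : ℝ) : ℂ) ≠ 0 := by
      exact_mod_cast (show δ * ε ^ m ≠ 0 by positivity)
    rw [Complex.ofReal_div, div_mul_eq_mul_div, ← h1, mul_div_cancel_left₀ _ h4]
  have h5 : ((δ / t ^ 2 : ℝ) : ℂ) ^ (1 - α) * ((δ / t ^ 2 : ℝ) : ℂ) ^ (α - 1) = 1 := by
    rw [← Complex.cpow_add _ _ hs0]
    simp
  calc _ = (Complex.Gamma α)⁻¹ * (((δ / t ^ 2 : ℝ) : ℂ) ^ (1 - α) *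
        (((t ^ (m + 1) / (δ * ε ^ m) : ℝ) : ℂ) * ∫ y, G y)) := by ring
    _ = (Complex.Gamma α)⁻¹ * ((((δ / t ^ 2 : ℝ) : ℂ) ^ (1 - α) * ((δ / t ^ 2 : ℝ) : ℂ) ^ (α - 1)) *
        ∫ z, plateDensity (α - 1) b (phaseParam δ ε t x) z) := by
        rw [h3]
        ring
    _ = _ := by rw [h5, one_mul]

theorem normalizedPlateMean_rec {δ ε t : ℝ} (hδ : 0 < δ) (hε : 0 < ε) (ht : 0 < t)
    (x : En (m + 1)) (α : ℂ) {b : En m → ℂ} (hb : ContDiff ℝ ∞ b) :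
    normalizedPlateMean δ ε t x α b =
      (((m + 1 : ℕ) : ℂ) / 2 + α) * (δ / t ^ 2 : ℝ) * normalizedPlateMean δ ε t x (α + 1) b +
      (1 / (4 * t ^ 2) : ℝ) * (normalizedPlateMean δ ε t x (α + 2) b +
        ((δ / ε) ^ 2 : ℝ) * normalizedPlateMean δ ε t x (α + 2) (lap b)) := by
  have hs : 0 < δ / t ^ 2 := by positivity
  have hs0 : ((δ / t ^ 2 : ℝ) : ℂ) ≠ 0 := by exact_mod_cast hs.ne'
  have e1 : ((δ / t ^ 2 : ℝ) : ℂ) ^ (1 - α) =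
      (δ / t ^ 2 : ℝ) * ((δ / t ^ 2 : ℝ) : ℂ) ^ (1 - (α + 1)) := by
    rw [show 1 - α = 1 + (1 - (α + 1)) by ring, Complex.cpow_add _ _ hs0, Complex.cpow_one]
  have e2 : ((δ / t ^ 2 : ℝ) : ℂ) ^ (1 - (α + 1)) =
      (δ / t ^ 2 : ℝ) * ((δ / t ^ 2 : ℝ) : ℂ) ^ (1 - (α + 2)) := by
    rw [show 1 - (α + 1) = 1 + (1 - (α + 2)) by ring, Complex.cpow_add _ _ hs0, Complex.cpow_one]
  simp only [normalizedPlateMean]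
  rw [plateMean_rec δ ε t x α hb, e1, e2]
  have hδ0 : (δ : ℂ) ≠ 0 := by exact_mod_cast hδ.ne'
  have hε0 : (ε : ℂ) ≠ 0 := by exact_mod_cast hε.ne'
  have ht0 : (t : ℂ) ≠ 0 := by exact_mod_cast ht.ne'
  push_cast
  field_simp

/-! ### Lower bounds for plate means of every order -/

/-- The limit of the normalized plate mean, at the parameters of a given configuration. -/
noncomputable def plateTarget (δ ε t : ℝ) (x : En (m + 1)) (α : ℂ) (b : En m → ℂ) : ℂ :=
  ((2 * t : ℝ) : ℂ) ^ (α - 1) *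
    plateLimit b t ((t ^ 2 - ‖x‖ ^ 2) / δ) ((ε / δ) • tailE x) (ε ^ 2 / δ)

theorem Tangential.exponent_bounds {κ δ ε t : ℝ} {x : En (m + 1)} (h : Tangential κ δ ε t x)
    {w : En m} (hw : ‖w‖ ≤ 1) :
    |((t ^ 2 - ‖x‖ ^ 2) / δ + 2 * inner ℝ ((ε / δ) • tailE x) w - ε ^ 2 / δ * ‖w‖ ^ 2) /
      (2 * t)| ≤ 2 := by
  have hmem := h.mem (δ' := 0) (ξ := 1) (by norm_num) (by norm_num)
  obtain ⟨-, -, ⟨hA1, hA2⟩, hv, ⟨hκ1, hκ2⟩⟩ := hmem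
  simp only [mem_closedBall_zero_iff] at hv hA1 hA2 hκ1 hκ2
  have h1 := abs_le.1 ((abs_real_inner_le_norm ((ε / δ) • tailE x) w).trans
    (mul_le_one₀ hv (norm_nonneg _) hw))
  have h2 : 0 ≤ ε ^ 2 / δ * ‖w‖ ^ 2 := by positivity
  have h3 : ε ^ 2 / δ * ‖w‖ ^ 2 ≤ 1 :=
    mul_le_one₀ hκ2 (by positivity) (pow_le_one₀ (norm_nonneg _) hw)
  have ht := h.one_le
  rw [abs_div, abs_of_pos (show 0 < 2 * t by linarith), div_le_iff₀ (by linarith), abs_le]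
  constructor <;> linarith

theorem norm_plateLimit_le {b : En m → ℂ} (hb : Continuous b)
    (hsupp : ∀ w, 1 < ‖w‖ → b w = 0) {κ δ ε t : ℝ} {x : En (m + 1)}
    (h : Tangential κ δ ε t x) :
    ‖plateLimit b t ((t ^ 2 - ‖x‖ ^ 2) / δ) ((ε / δ) • tailE x) (ε ^ 2 / δ)‖ ≤
      Real.exp 2 * ∫ w, ‖b w‖ := by
  rw [← integral_const_mul]
  refine norm_integral_le_of_norm_le ((integrable_of_unit_support hb hsupp).norm.const_mul _)
    (Eventually.of_forall fun w => ?_)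
  rw [norm_mul, Complex.norm_real, Real.norm_eq_abs, Real.abs_exp, mul_comm]
  rcases lt_or_ge 1 ‖w‖ with hw | hw
  · simp [hsupp _ hw]
  · gcongr
    exact (abs_le.1 (h.exponent_bounds hw)).2

theorem norm_two_mul_cpow_le {t : ℝ} (h1 : 1 ≤ t) (h2 : t ≤ 2) (γ : ℂ) :
    ‖((2 * t : ℝ) : ℂ) ^ γ‖ ≤ 4 ^ |γ.re| := by
  rw [Complex.norm_cpow_eq_rpow_re_of_pos (by linarith)]
  calc (2 * t) ^ γ.re ≤ (2 * t) ^ |γ.re| :=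
        Real.rpow_le_rpow_of_exponent_le (by linarith) (le_abs_self _)
    _ ≤ 4 ^ |γ.re| := Real.rpow_le_rpow (by linarith) (by linarith) (abs_nonneg _)

theorem le_norm_two_mul_cpow {t : ℝ} (h1 : 1 ≤ t) (h2 : t ≤ 2) (γ : ℂ) :
    4 ^ (-|γ.re|) ≤ ‖((2 * t : ℝ) : ℂ) ^ γ‖ := by
  rw [Complex.norm_cpow_eq_rpow_re_of_pos (by linarith)]
  calc (4 : ℝ) ^ (-|γ.re|) ≤ (2 * t) ^ (-|γ.re|) :=
        Real.rpow_le_rpow_of_nonpos (by linarith) (by linarith) (by simp)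
    _ ≤ (2 * t) ^ γ.re :=
        Real.rpow_le_rpow_of_exponent_le (by linarith) (neg_abs_le _)

theorem norm_plateTarget_le {b : En m → ℂ} (hb : Continuous b)
    (hsupp : ∀ w, 1 < ‖w‖ → b w = 0) (α : ℂ) {κ δ ε t : ℝ} {x : En (m + 1)}
    (h : Tangential κ δ ε t x) :
    ‖plateTarget δ ε t x α b‖ ≤ 4 ^ |(α - 1).re| * (Real.exp 2 * ∫ w, ‖b w‖) := by
  rw [plateTarget, norm_mul]
  exact mul_le_mul (norm_two_mul_cpow_le h.one_le h.le_two _) (norm_plateLimit_le hb hsupp h)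
    (norm_nonneg _) (by positivity)

theorem plateTarget_add_two {δ ε t : ℝ} (ht : 0 < t) (x : En (m + 1)) (α : ℂ) (b : En m → ℂ) :
    (1 / (4 * t ^ 2) : ℝ) * plateTarget δ ε t x (α + 2) b = plateTarget δ ε t x α b := by
  have h0 : ((2 * t : ℝ) : ℂ) ≠ 0 := by exact_mod_cast (show 2 * t ≠ 0 by positivity)
  have ht0 : (t : ℂ) ≠ 0 := by exact_mod_cast ht.ne'
  have e : ((2 * t : ℝ) : ℂ) ^ (α + 2 - 1) = ((2 * t : ℝ) : ℂ) ^ (α - 1) * (2 * t : ℝ) ^ 2 := by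
    rw [show α + 2 - 1 = α - 1 + (2 : ℕ) by push_cast; ring, Complex.cpow_add _ _ h0,
      Complex.cpow_natCast]
  rw [plateTarget, plateTarget, e]
  push_cast
  field_simp
  ring

/-- Normalized plate means of every order converge, uniformly over tangential configurations. For
`Re α > 1` this is continuity in the parameters; the Laplacian recursion, in which the derivatives
of `b` come with the small factor `(δ / ε)²`, carries it down to all `α`. -/
theorem normalizedPlateMean_tendsto (α : ℂ) {b : En m → ℂ} (hb : ContDiff ℝ ∞ b)
    (hsupp : ∀ w, 1 < ‖w‖ → b w = 0) {η : ℝ} (hη : 0 < η) :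
    ∃ κ, 0 < κ ∧ κ ≤ 1 / 4 ∧ ∀ (δ ε t : ℝ) (x : En (m + 1)), Tangential κ δ ε t x →
      ‖normalizedPlateMean δ ε t x α b - plateTarget δ ε t x α b‖ ≤ η := by
  obtain ⟨k, hk⟩ := exists_nat_gt (1 - α.re)
  induction k generalizing α b η with
  | zero =>
    have hα : 1 < α.re := by simp at hk; linarith
    have huc := isCompact_phaseDomain.uniformContinuousOn_of_continuous
      (continuousOn_plateProfile hα hb.continuous hsupp)
    rw [Metric.uniformContinuousOn_iff] at huc
    obtain ⟨r, hr, hlt⟩ := huc η hη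
    refine ⟨min (1 / 4) (r / 4), by positivity, min_le_left _ _, fun δ ε t x h => ?_⟩
    have hκ4 : min (1 / 4) (r / 4) ≤ 1 / 4 := min_le_left _ _
    have hκr : min (1 / 4) (r / 4) ≤ r / 4 := min_le_right _ _
    have h1 := h.one_le
    have hmem := h.phaseParam_mem hκ4
    have hmem0 := h.mem (δ' := 0) (ξ := t) (by norm_num) ⟨by linarith, by linarith [h.le_two]⟩
    have hd := hlt _ hmem _ hmem0 (by
      simp only [phaseParam, Prod.dist_eq, dist_self, Real.dist_eq, sub_zero]
      have a1 : |δ| < r := by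
        rw [abs_of_pos h.pos]
        linarith [h.le]
      have a2 : |x 0 - t| < r := by linarith [h.abs_sub_le hκ4]
      simp [a1, a2])
    rw [normalizedPlateMean_eq_profile hα hb h.pos h.eps_pos (by linarith), plateTarget,
      ← plateProfile_zero hα hb.continuous hsupp hmem0, ← dist_eq_norm]
    exact hd.le
  | succ k ih =>
    push_cast at hk
    have hk1 : 1 - (α + 1).re < k := by simp; linarith
    have hk2 : 1 - (α + 2).re < k := by simp; linarith
    have hlap := contDiff_lap hb
    have hlap0 := lap_eq_zero hsupp
    obtain ⟨κ₁, hκ₁, -, h₁⟩ := ih (α + 1) hb hsupp one_pos hk1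
    obtain ⟨κ₂, hκ₂, -, h₂⟩ := ih (α + 2) hb hsupp hη hk2
    obtain ⟨κ₃, hκ₃, -, h₃⟩ := ih (α + 2) hlap hlap0 one_pos hk2
    set M₁ : ℝ := 1 + 4 ^ |(α + 1 - 1).re| * (Real.exp 2 * ∫ w, ‖b w‖) with hM₁
    set M₃ : ℝ := 1 + 4 ^ |(α + 2 - 1).re| * (Real.exp 2 * ∫ w, ‖lap b w‖) with hM₃
    have hM₁0 : 0 ≤ M₁ := by
      have : 0 ≤ ∫ w, ‖b w‖ := integral_nonneg fun w => norm_nonneg _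
      positivity
    have hM₃0 : 0 ≤ M₃ := by
      have : 0 ≤ ∫ w, ‖lap b w‖ := integral_nonneg fun w => norm_nonneg _
      positivity
    set D : ℝ := ‖(((m + 1 : ℕ) : ℂ) / 2 + α)‖ with hD
    have hD0 : 0 ≤ D := norm_nonneg _
    refine ⟨min (1 / 4) (min (min κ₁ κ₂) (min κ₃ (η / (2 * (D * M₁ + M₃ + 1))))), by positivity,
      min_le_left _ _, fun δ ε t x h => ?_⟩
    set κ := min (1 / 4) (min (min κ₁ κ₂) (min κ₃ (η / (2 * (D * M₁ + M₃ + 1))))) with hκ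
    have hκ4 : κ ≤ 1 / 4 := min_le_left _ _
    have hκ1 : κ ≤ κ₁ := (min_le_right _ _).trans ((min_le_left _ _).trans (min_le_left _ _))
    have hκ2 : κ ≤ κ₂ := (min_le_right _ _).trans ((min_le_left _ _).trans (min_le_right _ _))
    have hκ3 : κ ≤ κ₃ := (min_le_right _ _).trans ((min_le_right _ _).trans (min_le_left _ _))
    have hκη : κ ≤ η / (2 * (D * M₁ + M₃ + 1)) :=
      (min_le_right _ _).trans ((min_le_right _ _).trans (min_le_right _ _))
    have hδ := h.pos
    have hε := h.eps_pos
    have ht1 := h.one_le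
    have ht0 : 0 < t := by linarith
    have hκ0 : 0 < κ := lt_of_lt_of_le hδ h.le
    have b₁ : ‖normalizedPlateMean δ ε t x (α + 1) b‖ ≤ M₁ :=
      (norm_le_norm_sub_add _ (plateTarget δ ε t x (α + 1) b)).trans
        (add_le_add (h₁ δ ε t x (h.mono hκ1 hε)) (norm_plateTarget_le hb.continuous hsupp _ h))
    have b₃ : ‖normalizedPlateMean δ ε t x (α + 2) (lap b)‖ ≤ M₃ :=
      (norm_le_norm_sub_add _ (plateTarget δ ε t x (α + 2) (lap b))).trans
        (add_le_add (h₃ δ ε t x (h.mono hκ3 hε))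
          (norm_plateTarget_le hlap.continuous hlap0 _ h))
    have b₂ := h₂ δ ε t x (h.mono hκ2 hε)
    have e : normalizedPlateMean δ ε t x α b - plateTarget δ ε t x α b =
        (((m + 1 : ℕ) : ℂ) / 2 + α) * (δ / t ^ 2 : ℝ) * normalizedPlateMean δ ε t x (α + 1) b +
        (1 / (4 * t ^ 2) : ℝ) *
          ((normalizedPlateMean δ ε t x (α + 2) b - plateTarget δ ε t x (α + 2) b) +
          ((δ / ε) ^ 2 : ℝ) * normalizedPlateMean δ ε t x (α + 2) (lap b)) := by
      rw [normalizedPlateMean_rec hδ hε ht0 x α hb, ← plateTarget_add_two ht0 x α b]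
      ring
    have c1 : δ / t ^ 2 ≤ κ := (div_le_self hδ.le (one_le_pow₀ ht1)).trans h.le
    have c2 : 1 / (4 * t ^ 2) ≤ 1 / 4 := by
      gcongr
      nlinarith
    have c3 : (δ / ε) ^ 2 ≤ κ := by
      have : δ / ε ≤ κ := (div_le_iff₀ hε).2 h.le_mul
      have : 0 ≤ δ / ε := by positivity
      nlinarith
    have c4 : κ * (D * M₁ + M₃) ≤ η / 2 := by
      rw [le_div_iff₀ (by positivity)] at hκη
      nlinarith [mul_nonneg hD0 hM₁0]
    rw [e]
    calc _ ≤ D * κ * M₁ + 1 / 4 * (η + κ * M₃) := by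
          refine (norm_add_le _ _).trans (add_le_add ?_ ?_)
          · rw [norm_mul, norm_mul, Complex.norm_real, Real.norm_eq_abs,
              abs_of_nonneg (by positivity)]
            gcongr
          · rw [norm_mul, Complex.norm_real, Real.norm_eq_abs, abs_of_nonneg (by positivity)]
            refine mul_le_mul c2 ((norm_add_le _ _).trans (add_le_add b₂ ?_)) (norm_nonneg _)
              (by norm_num)
            rw [norm_mul, Complex.norm_real, Real.norm_eq_abs, abs_of_nonneg (by positivity)]
            gcongr
      _ ≤ η := by nlinarith [mul_nonneg hκ0.le hM₃0]

/-- A fixed bump function supported in the closed unit ball. -/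
noncomputable def unitBump (m : ℕ) : ContDiffBump (0 : En m) := ⟨1 / 2, 1, by norm_num, by norm_num⟩

/-- `unitBump` with complex values. -/
noncomputable def bumpC (w : En m) : ℂ := (unitBump m w : ℂ)

theorem contDiff_bumpC : ContDiff ℝ ∞ (bumpC (m := m)) :=
  Complex.ofRealCLM.contDiff.comp (unitBump m).contDiff

theorem bumpC_eq_zero (w : En m) (hw : 1 < ‖w‖) : bumpC w = 0 := by
  rw [bumpC, (unitBump m).zero_of_le_dist (by simpa [unitBump] using hw.le), Complex.ofReal_zero]

theorem integrable_unitBump : Integrable fun w => unitBump m w := (unitBump m).integrable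

theorem integral_unitBump_pos : 0 < ∫ w, unitBump m w := (unitBump m).integral_pos

theorem le_norm_plateLimit {κ δ ε t : ℝ} {x : En (m + 1)} (h : Tangential κ δ ε t x) :
    Real.exp (-2) * ∫ w, unitBump m w ≤
      ‖plateLimit bumpC t ((t ^ 2 - ‖x‖ ^ 2) / δ) ((ε / δ) • tailE x) (ε ^ 2 / δ)‖ := by
  set E : En m → ℝ := fun w => ((t ^ 2 - ‖x‖ ^ 2) / δ + 2 * inner ℝ ((ε / δ) • tailE x) w -
    ε ^ 2 / δ * ‖w‖ ^ 2) / (2 * t) with hE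
  have hEc : Continuous E := by
    simp only [hE]
    fun_prop
  have e : plateLimit bumpC t ((t ^ 2 - ‖x‖ ^ 2) / δ) ((ε / δ) • tailE x) (ε ^ 2 / δ) =
      ((∫ w, unitBump m w * Real.exp (E w) : ℝ) : ℂ) := by
    rw [plateLimit, ← integral_complex_ofReal]
    simp only [bumpC, Complex.ofReal_mul, hE]
  have hint : Integrable fun w => unitBump m w * Real.exp (E w) := by
    refine Continuous.integrable_of_hasCompactSupport ?_ ?_
    · exact (unitBump m).continuous.mul (Real.continuous_exp.comp hEc)
    · exact (unitBump m).hasCompactSupport.mul_right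
  rw [e, Complex.norm_real, Real.norm_eq_abs, ← integral_const_mul]
  refine le_trans (integral_mono (integrable_unitBump.const_mul _) hint fun w => ?_) (le_abs_self _)
  simp only
  rcases lt_or_ge 1 ‖w‖ with hw | hw
  · have := (unitBump m).zero_of_le_dist (x := w) (by simpa [unitBump] using hw.le)
    rw [this]
    simp
  · rw [mul_comm]
    refine mul_le_mul_of_nonneg_left (Real.exp_le_exp.2 ?_) (unitBump m).nonneg
    exact (abs_le.1 (h.exponent_bounds hw)).1

/-- Plate means of every order are as large as scaling predicts. The limit does not vanish because
`plateLimit` of a nonnegative bump is the integral of a positive function. -/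
theorem plateMean_lower (α : ℂ) :
    ∃ κ c : ℝ, 0 < κ ∧ κ ≤ 1 / 4 ∧ 0 < c ∧ ∀ (δ ε t : ℝ) (x : En (m + 1)), Tangential κ δ ε t x →
      c * (δ ^ α.re * ε ^ m) ≤ ‖plateMean δ ε t x α bumpC‖ := by
  set d : ℝ := 4 ^ (-|(α - 1).re|) * (Real.exp (-2) * ∫ w, unitBump m w) with hd
  have hd0 : 0 < d := by
    have := integral_unitBump_pos (m := m)
    positivity
  obtain ⟨κ, hκ, hκ4, hlim⟩ := normalizedPlateMean_tendsto (m := m) α contDiff_bumpC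
    bumpC_eq_zero (half_pos hd0)
  refine ⟨κ, d / 2 * (4 ^ (-|(α - 1).re|) / 2 ^ (m + 1)), hκ, hκ4, by positivity,
    fun δ ε t x h => ?_⟩
  have hδ := h.pos
  have hε := h.eps_pos
  have ht1 := h.one_le
  have ht2 := h.le_two
  have ht0 : 0 < t := by linarith
  have h1 : d ≤ ‖plateTarget δ ε t x α bumpC‖ := by
    rw [plateTarget, norm_mul]
    have := integral_unitBump_pos (m := m)
    exact mul_le_mul (le_norm_two_mul_cpow ht1 ht2 _) (le_norm_plateLimit h) (by positivity)
      (norm_nonneg _)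
  have h2 : d / 2 ≤ ‖normalizedPlateMean δ ε t x α bumpC‖ := by
    have h3 := norm_sub_norm_le (plateTarget δ ε t x α bumpC)
      (normalizedPlateMean δ ε t x α bumpC)
    rw [norm_sub_rev] at h3
    linarith [hlim δ ε t x h]
  have hs : 0 < δ / t ^ 2 := by positivity
  rw [normalizedPlateMean, norm_mul, norm_mul, Complex.norm_cpow_eq_rpow_re_of_pos hs,
    Complex.norm_real, Real.norm_eq_abs, abs_of_pos (by positivity)] at h2
  set N := ‖plateMean δ ε t x α bumpC‖ with hN
  have hN0 : 0 ≤ N := norm_nonneg _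
  have e1 : (1 - α).re = -(α - 1).re := by simp
  rw [e1, Real.rpow_neg hs.le, Real.div_rpow hδ.le (by positivity)] at h2
  set a := (α - 1).re with ha
  have e2 : α.re = a + 1 := by simp [ha]
  have hta : (t ^ 2) ^ a ≤ 4 ^ |a| :=
    (Real.rpow_le_rpow_of_exponent_le (one_le_pow₀ ht1) (le_abs_self _)).trans
      (Real.rpow_le_rpow (by positivity) (by nlinarith) (abs_nonneg _))
  have htm : t ^ (m + 1) ≤ 2 ^ (m + 1) := pow_le_pow_left₀ ht0.le ht2 _
  have hδa := Real.rpow_pos_of_pos hδ a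
  have h4 : d / 2 ≤ 4 ^ |a| / δ ^ a * (2 ^ (m + 1) / (δ * ε ^ m)) * N := by
    refine h2.trans (mul_le_mul_of_nonneg_right (mul_le_mul ?_ (by gcongr) (by positivity)
      (by positivity)) hN0)
    rw [inv_div]
    gcongr
  have h5 : 4 ^ |a| / δ ^ a * (2 ^ (m + 1) / (δ * ε ^ m)) * N *
      (4 ^ (-|a|) / 2 ^ (m + 1) * (δ ^ α.re * ε ^ m)) = N := by
    rw [e2, Real.rpow_add hδ, Real.rpow_one, Real.rpow_neg (by norm_num)]
    field_simp
  calc _ = d / 2 * (4 ^ (-|a|) / 2 ^ (m + 1) * (δ ^ α.re * ε ^ m)) := by ring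
    _ ≤ _ := mul_le_mul_of_nonneg_right h4 (by positivity)
    _ = N := h5

/-! ### Plates as test functions -/

/-- The Schwartz function obtained from a plate by cutting it off where the ball means considered
below do not see it. -/
noncomputable def cutPlate (δ ε : ℝ) (z : En (m + 1)) : ℂ :=
  ((leftCutoff (z 0 / δ) * leftCutoff (3 - z 0) : ℝ) : ℂ) * plate δ ε bumpC z

theorem contDiff_cutPlate (δ ε : ℝ) : ContDiff ℝ ∞ (cutPlate (m := m) δ ε) := by
  have h0 : ContDiff ℝ ∞ fun z : En (m + 1) => z 0 :=
    (EuclideanSpace.proj (𝕜 := ℝ) (0 : Fin (m + 1))).contDiff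
  refine ContDiff.mul (Complex.ofRealCLM.contDiff.comp (ContDiff.mul ?_ ?_))
    (contDiff_plate δ ε contDiff_bumpC)
  · exact contDiff_leftCutoff.comp (h0.div_const δ)
  · exact contDiff_leftCutoff.comp (contDiff_const.sub h0)

theorem cutPlate_eq_zero {δ ε : ℝ} (hδ : 0 < δ) (hδ1 : δ ≤ 1) (hε : 0 < ε) (hε1 : ε ≤ 1)
    {z : En (m + 1)} (hz : 8 < ‖z‖) : cutPlate δ ε z = 0 := by
  rw [cutPlate]
  rcases le_or_gt (z 0 / δ) (-4) with h1 | h1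
  · rw [leftCutoff_eq_zero h1, zero_mul, Complex.ofReal_zero, zero_mul]
  rcases le_or_gt (3 - z 0) (-4) with h2 | h2
  · rw [leftCutoff_eq_zero h2, mul_zero, Complex.ofReal_zero, zero_mul]
  rw [plate, bumpC_eq_zero, mul_zero, mul_zero]
  rw [norm_smul, norm_inv, Real.norm_eq_abs, abs_of_pos hε, lt_inv_mul_iff₀ hε, mul_one]
  have h3 := norm_sq_split z
  rw [lt_div_iff₀ hδ] at h1
  have h4 : z 0 ^ 2 ≤ 49 := by nlinarith
  by_contra! h5
  have h6 : ‖tailE z‖ ^ 2 ≤ 1 := pow_le_one₀ (norm_nonneg _) (h5.trans hε1)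
  nlinarith

theorem leftCutoff_mul_exp_le (s : ℝ) :
    leftCutoff s * Real.exp (-s) ≤ (Ioi (-4 : ℝ)).indicator (fun s => Real.exp (-s)) s := by
  rcases le_or_gt s (-4) with h | h
  · rw [leftCutoff_eq_zero h, zero_mul]
    exact indicator_nonneg (fun s _ => (Real.exp_pos _).le) s
  · rw [indicator_of_mem (show s ∈ Ioi (-4 : ℝ) from h)]
    exact mul_le_of_le_one_left (Real.exp_pos _).le (leftCutoff_le_one _)

theorem norm_cutPlate_eq (δ ε : ℝ) (z : En (m + 1)) :
    ‖cutPlate δ ε z‖ = leftCutoff (z 0 / δ) * Real.exp (-(z 0 / δ)) * leftCutoff (3 - z 0) *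
      unitBump m (ε⁻¹ • tailE z) := by
  rw [cutPlate, plate, bumpC, norm_mul, norm_mul, Complex.norm_real, Complex.norm_real,
    Complex.norm_real, Real.norm_eq_abs, Real.norm_eq_abs, Real.norm_eq_abs, Real.abs_exp,
    abs_of_nonneg (unitBump m).nonneg,
    abs_of_nonneg (mul_nonneg (leftCutoff_nonneg _) (leftCutoff_nonneg _))]
  ring

theorem norm_cutPlate_le (δ ε : ℝ) (z : En (m + 1)) : ‖cutPlate δ ε z‖ ≤ Real.exp 4 := by
  have h1 : leftCutoff (z 0 / δ) * Real.exp (-(z 0 / δ)) ≤ Real.exp 4 := by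
    refine (leftCutoff_mul_exp_le _).trans ?_
    refine indicator_le' (g := fun _ => Real.exp 4) (fun s hs => ?_)
      (fun s _ => (Real.exp_pos _).le) _
    have : -4 < s := hs
    exact Real.exp_le_exp.2 (by linarith)
  rw [norm_cutPlate_eq]
  calc _ ≤ Real.exp 4 * 1 * 1 :=
        mul_le_mul (mul_le_mul h1 (leftCutoff_le_one _) (leftCutoff_nonneg _) (Real.exp_pos _).le)
          (unitBump m).le_one (unitBump m).nonneg (by positivity)
    _ = _ := by ring

theorem hasCompactSupport_cutPlate {δ ε : ℝ} (hδ : 0 < δ) (hδ1 : δ ≤ 1) (hε : 0 < ε)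
    (hε1 : ε ≤ 1) : HasCompactSupport (cutPlate (m := m) δ ε) :=
  HasCompactSupport.intro (isCompact_closedBall 0 8) fun z hz =>
    cutPlate_eq_zero hδ hδ1 hε hε1 (by simpa using hz)

theorem lintegral_cutPlate_le {δ ε : ℝ} (hδ : 0 < δ) (hδ1 : δ ≤ 1) (hε : 0 < ε) (hε1 : ε ≤ 1) :
    ∫⁻ z : En (m + 1), ‖cutPlate δ ε z‖ₑ ≤
      ENNReal.ofReal (Real.exp 4 * (∫ w, unitBump m w) * (δ * ε ^ m)) := by
  have hint : Integrable (cutPlate (m := m) δ ε) :=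
    (contDiff_cutPlate δ ε).continuous.integrable_of_hasCompactSupport
      (hasCompactSupport_cutPlate hδ hδ1 hε hε1)
  rw [← ofReal_integral_norm_eq_lintegral_enorm hint]
  refine ENNReal.ofReal_le_ofReal ?_
  rw [integral_consE_scaled _ hδ hε, smul_eq_mul, mul_comm]
  refine mul_le_mul_of_nonneg_right ?_ (by positivity)
  have h1 : ∫ s : ℝ, (Ioi (-4 : ℝ)).indicator (fun s => Real.exp (-s)) s = Real.exp 4 := by
    rw [integral_indicator measurableSet_Ioi, integral_exp_neg_Ioi, neg_neg]
  have h2 : Integrable ((Ioi (-4 : ℝ)).indicator fun s => Real.exp (-s)) :=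
    (integrable_indicator_iff measurableSet_Ioi).2 (integrableOn_exp_neg_Ioi _)
  rw [← h1, ← integral_prod_mul, ← Measure.volume_eq_prod]
  refine integral_mono_of_nonneg (Eventually.of_forall fun z => norm_nonneg _)
    (h2.mul_prod integrable_unitBump) (Eventually.of_forall fun z => ?_)
  simp only [norm_cutPlate_eq, consE_zero, tailE_consE, smul_smul, inv_mul_cancel₀ hε.ne',
    one_smul, mul_div_cancel_left₀ _ hδ.ne']
  refine mul_le_mul_of_nonneg_right ?_ (unitBump m).nonneg
  exact (mul_le_of_le_one_right (mul_nonneg (leftCutoff_nonneg _) (Real.exp_pos _).le)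
    (leftCutoff_le_one _)).trans (leftCutoff_mul_exp_le _)

/-- `cutPlate` as a Schwartz function. -/
noncomputable def plateFun {δ ε : ℝ} (hδ : 0 < δ) (hδ1 : δ ≤ 1) (hε : 0 < ε) (hε1 : ε ≤ 1) :
    𝓢(En (m + 1), ℂ) :=
  (hasCompactSupport_cutPlate hδ hδ1 hε hε1).toSchwartzMap (contDiff_cutPlate δ ε)

/-- The ball means of the cut-off plate in a tangential configuration are those of the plate. -/
theorem steinMean_plateFun {κ δ ε t : ℝ} {x : En (m + 1)} (h : Tangential κ δ ε t x)
    (hκ : κ ≤ 1 / 4) (hδ1 : δ ≤ 1) (hε1 : ε ≤ 1) (α : ℂ) :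
    steinMean (m + 1) α t (plateFun h.pos hδ1 h.eps_pos hε1) x = plateMean δ ε t x α bumpC := by
  have hδ := h.pos
  have hε := h.eps_pos
  have ht1 := h.one_le
  have ht2 := h.le_two
  rw [steinMean_eq_ballMean, plateMean]
  refine ballMean_congr ((contDiff_cutPlate δ ε).comp
    (contDiff_const.sub (contDiff_id.const_smul t)))
    (contDiff_plate_translate δ ε t x contDiff_bumpC) (fun y hy => ?_) α
  change cutPlate δ ε (x - t • y) = _
  set z := x - t • y with hz
  rw [cutPlate]
  rcases lt_or_ge 1 ‖ε⁻¹ • tailE z‖ with hw | hw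
  · rw [plate, bumpC_eq_zero _ hw, mul_zero, mul_zero]
  rw [norm_smul, norm_inv, Real.norm_eq_abs, abs_of_pos hε, inv_mul_le_iff₀ hε, mul_one] at hw
  have hx0 := abs_le.1 (h.abs_sub_le hκ)
  have hnear := abs_le.1 h.near
  have hxz : ‖x - z‖ ^ 2 ≤ t ^ 2 := by
    have : x - z = t • y := by rw [hz, sub_sub_cancel]
    rw [this, norm_smul, mul_pow, Real.norm_eq_abs, sq_abs]
    exact mul_le_of_le_one_right (sq_nonneg t) (pow_le_one₀ (norm_nonneg _) hy)
  have hsplit := norm_sq_split (x - z)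
  rw [norm_sub_sq_real, inner_split] at hxz
  have hin : inner ℝ (tailE x) (tailE z) ≤ δ :=
    calc inner ℝ (tailE x) (tailE z) ≤ ‖tailE x‖ * ‖tailE z‖ := real_inner_le_norm _ _
      _ ≤ ‖tailE x‖ * ε := by gcongr
      _ ≤ δ := by
        rw [mul_comm]
        exact h.tail_le
  -- a point of the ball of radius `t` about `x` whose tail is at most `ε` has `z 0 ≥ -3 δ`
  have hlow : -3 * δ ≤ 2 * (x 0 * z 0) := by nlinarith [sq_nonneg ‖z‖]
  have h1 : -3 ≤ z 0 / δ := by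
    rw [le_div_iff₀ hδ]
    rcases le_or_gt 0 (z 0) with h0 | h0
    · nlinarith
    · nlinarith
  have h2 : -3 ≤ 3 - z 0 := by
    have h3 : (x 0 - z 0) ^ 2 ≤ 2 ^ 2 := by
      have h4 := norm_sq_split (x - z)
      rw [norm_sub_sq_real, inner_split] at h4
      have h5 : (x - z) 0 = x 0 - z 0 := rfl
      rw [h5] at h4
      nlinarith [sq_nonneg ‖tailE (x - z)‖]
    have h6 := abs_le_of_sq_le_sq' h3 (by norm_num)
    linarith
  rw [leftCutoff_eq_one h1, leftCutoff_eq_one h2]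
  simp

/-- The maximal inequality tested on plates. -/
theorem plate_inequality {p q : ℝ≥0∞} (hp : 1 ≤ p) (hq : 1 ≤ q) {α : ℂ} {C : ℝ≥0}
    (hC : ∀ f : 𝓢(En (m + 1), ℂ),
      eLpNorm (localSteinMaximal (m + 1) α f) q volume ≤ C * eLpNorm f p volume) :
    ∃ κ c b : ℝ, 0 < κ ∧ κ ≤ 1 / 4 ∧ 0 < c ∧ ∀ δ ε τ : ℝ, 0 < δ → 0 < ε → δ ≤ κ → ε ^ 2 ≤ δ →
      0 < τ → ∀ T : Set (En (m + 1)), MeasurableSet T → ENNReal.ofReal τ ≤ volume T →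
      (∀ x ∈ T, ∃ t, Tangential κ δ ε t x) →
      c * (δ ^ α.re * ε ^ m) * τ ^ recip q ≤ b * (δ * ε ^ m) ^ recip p := by
  obtain ⟨κ, c, hκ, hκ4, hc, hlow⟩ := plateMean_lower (m := m) α
  have hI := integral_unitBump_pos (m := m)
  refine ⟨κ, c, C * (Real.exp 4 * (Real.exp 4 * ∫ w, unitBump m w) ^ recip p), hκ, hκ4, hc,
    fun δ ε τ hδ hε hδκ hεδ hτ T hT hTτ hx => ?_⟩
  have hδ1 : δ ≤ 1 := by linarith
  have hε1 : ε ≤ 1 := by nlinarith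
  have h := test_bound hp hq hC (plateFun hδ hδ1 hε hε1) (K := Real.exp 4)
    (I := Real.exp 4 * (∫ w, unitBump m w) * (δ * ε ^ m)) (c := c * (δ ^ α.re * ε ^ m)) (τ := τ)
    (T := T) (Real.one_le_exp (by norm_num)) (by positivity) (fun y => norm_cutPlate_le δ ε y)
    (lintegral_cutPlate_le hδ hδ1 hε hε1) (by positivity) hT hτ hTτ fun x hxT => by
      obtain ⟨t, ht⟩ := hx x hxT
      refine ⟨t, ⟨ht.one_le, ht.le_two⟩, ?_⟩
      rw [steinMean_plateFun ht hκ4]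
      exact hlow δ ε t x ht
  rw [Real.mul_rpow (by positivity) (by positivity)] at h
  linarith

theorem measurableSet_split (s : Set ℝ) (B : Set (En m)) (hs : MeasurableSet s)
    (hB : MeasurableSet B) : MeasurableSet {x : En (m + 1) | x 0 ∈ s ∧ tailE x ∈ B} :=
  ((EuclideanSpace.proj (𝕜 := ℝ) (0 : Fin (m + 1))).continuous.measurable hs).inter
    (tailE.continuous.measurable hB)

theorem volume_closedBall_scale {r : ℝ} (hr : 0 ≤ r) :
    volume (Metric.closedBall (0 : En m) r) =
      ENNReal.ofReal (r ^ m * volume.real (Metric.closedBall (0 : En m) 1)) := by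
  have h := Measure.addHaar_closedBall_mul (volume : Measure (En m)) 0 hr zero_le_one
  rw [mul_one, finrank_euclideanSpace_fin] at h
  rw [h, ENNReal.ofReal_mul (by positivity), measureReal_def,
    ENNReal.ofReal_toReal measure_closedBall_lt_top.ne]

theorem volume_unit_closedBall_pos : 0 < volume.real (Metric.closedBall (0 : En m) 1) :=
  ENNReal.toReal_pos (Metric.measure_closedBall_pos volume 0 one_pos).ne'
    measure_closedBall_lt_top.ne

/-- The tube of length `1` along which a `δ × √δ` plate is tangent to spheres of radii between
`1` and `2`. -/
def tube (m : ℕ) (δ : ℝ) : Set (En (m + 1)) :=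
  {x | x 0 ∈ Icc (1 : ℝ) 2 ∧ tailE x ∈ Metric.closedBall 0 (√δ)}

theorem measurableSet_tube (δ : ℝ) : MeasurableSet (tube m δ) :=
  measurableSet_split _ _ measurableSet_Icc Metric.isClosed_closedBall.measurableSet

theorem volume_tube (δ : ℝ) : volume (tube m δ) =
    ENNReal.ofReal (√δ ^ m * volume.real (Metric.closedBall (0 : En m) 1)) := by
  rw [tube, volume_split, volume_closedBall_scale (Real.sqrt_nonneg _), Real.volume_Icc]
  norm_num

theorem tangential_of_mem_tube {κ δ : ℝ} (hκ : 0 < κ) (hκ4 : κ ≤ 1 / 4) (hδ : 0 < δ)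
    (hδκ : δ ≤ κ ^ 2) {x : En (m + 1)} (hx : x ∈ tube m δ) : Tangential κ δ (√δ) (x 0) x := by
  obtain ⟨⟨h1, h2⟩, h3⟩ := hx
  rw [mem_closedBall_zero_iff] at h3
  have hs : 0 < √δ := Real.sqrt_pos.2 hδ
  have hss : √δ * √δ = δ := Real.mul_self_sqrt hδ.le
  have hsκ : √δ ≤ κ := Real.sqrt_le_iff.2 ⟨hκ.le, hδκ⟩
  have h4 : ‖tailE x‖ ^ 2 ≤ δ := by
    rw [← hss, ← sq]
    exact pow_le_pow_left₀ (norm_nonneg _) h3 2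
  refine ⟨hδ, by nlinarith, by nlinarith, by rw [sq, hss], h1, h2, by linarith, ?_, ?_⟩
  · rw [norm_sq_split, abs_le]
    constructor <;> linarith [sq_nonneg ‖tailE x‖]
  · calc √δ * ‖tailE x‖ ≤ √δ * √δ := by gcongr
      _ = δ := hss

/-- The necessary condition given by Knapp plates, of size `δ × √δ`. -/
theorem re_ge_of_knapp {p q : ℝ≥0∞} (hp : 1 ≤ p) (hq : 1 ≤ q) {α : ℂ} {C : ℝ≥0}
    (hC : ∀ f : 𝓢(En (m + 1), ℂ),
      eLpNorm (localSteinMaximal (m + 1) α f) q volume ≤ C * eLpNorm f p volume) :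
    (1 + m / 2 : ℝ) * recip p ≤ α.re + m / 2 + m / 2 * recip q := by
  obtain ⟨κ, c, b, hκ, hκ4, hc, h⟩ := plate_inequality hp hq hC
  set v := volume.real (Metric.closedBall (0 : En m) 1) with hv
  have hv0 : 0 < v := volume_unit_closedBall_pos
  refine exponent_le_of_small (a := c * v ^ recip q) (b := b) (δ₀ := κ ^ 2) (by positivity)
    (by positivity) fun δ hδ hδκ => ?_
  have hs : 0 < √δ := Real.sqrt_pos.2 hδ
  have h1 := h δ (√δ) (√δ ^ m * v) hδ hs (by nlinarith) (by rw [Real.sq_sqrt hδ.le]) (by positivity)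
    (tube m δ) (measurableSet_tube δ) (volume_tube δ).ge
    fun x hx => ⟨x 0, tangential_of_mem_tube hκ hκ4 hδ hδκ hx⟩
  have e : √δ ^ m = δ ^ (m / 2 : ℝ) := by
    rw [Real.sqrt_eq_rpow, ← Real.rpow_natCast, ← Real.rpow_mul hδ.le]
    congr 1
    ring
  have e2 : δ * δ ^ (m / 2 : ℝ) = δ ^ (1 + m / 2 : ℝ) := by rw [Real.rpow_add hδ, Real.rpow_one]
  rw [e, e2, Real.mul_rpow (by positivity) hv0.le, ← Real.rpow_mul hδ.le, ← Real.rpow_mul hδ.le]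
    at h1
  rw [Real.rpow_add hδ, Real.rpow_add hδ]
  linarith

/-- The necessary condition given by bumps at scale `δ`: plates of size `δ × δ / κ` with `κ` a
fixed constant. -/
theorem re_ge_of_bump {p q : ℝ≥0∞} (hp : 1 ≤ p) (hq : 1 ≤ q) {α : ℂ} {C : ℝ≥0}
    (hC : ∀ f : 𝓢(En (m + 1), ℂ),
      eLpNorm (localSteinMaximal (m + 1) α f) q volume ≤ C * eLpNorm f p volume) :
    (m + 1 : ℝ) * recip p ≤ α.re + m := by
  obtain ⟨κ, c, b, hκ, hκ4, hc, h⟩ := plate_inequality hp hq hC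
  set v := volume.real (Metric.closedBall (0 : En m) 1) with hv
  have hv0 : 0 < v := volume_unit_closedBall_pos
  set T : Set (En (m + 1)) := {x | x 0 ∈ Icc (1 : ℝ) (3 / 2) ∧ tailE x ∈ Metric.closedBall 0 κ}
    with hT
  set τ : ℝ := 1 / 2 * (κ ^ m * v) with hτ
  have hTv : volume T = ENNReal.ofReal τ := by
    rw [hT, volume_split, volume_closedBall_scale hκ.le, Real.volume_Icc,
      ← ENNReal.ofReal_mul (by norm_num)]
    norm_num [hτ, hv]
  have hτ0 : 0 < τ := by positivity
  refine exponent_le_of_small (a := c * (κ⁻¹ ^ m * τ ^ recip q)) (b := b * (κ⁻¹ ^ m) ^ recip p)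
    (δ₀ := κ ^ 2) (by positivity) (by positivity) fun δ hδ hδκ => ?_
  have hδκ' : δ ≤ κ := by nlinarith
  have h1 := h δ (δ * κ⁻¹) τ hδ (by positivity) hδκ' ?_ hτ0 T
    (measurableSet_split _ _ measurableSet_Icc Metric.isClosed_closedBall.measurableSet) hTv.ge
    fun x hx => ⟨‖x‖, ?_⟩
  · have e : δ * (δ * κ⁻¹) ^ m = δ ^ (m + 1 : ℝ) * κ⁻¹ ^ m := by
      rw [Real.rpow_add hδ, Real.rpow_one, Real.rpow_natCast]
      ring
    rw [e, Real.mul_rpow (x := δ ^ (m + 1 : ℝ)) (by positivity) (by positivity),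
      ← Real.rpow_mul hδ.le] at h1
    rw [Real.rpow_add hδ, Real.rpow_natCast]
    calc _ = c * (δ ^ α.re * (δ * κ⁻¹) ^ m) * τ ^ recip q := by ring
      _ ≤ _ := h1
      _ = _ := by ring
  · rw [mul_pow, inv_pow, sq δ, mul_assoc]
    refine mul_le_of_le_one_right hδ.le ?_
    rwa [← div_eq_mul_inv, div_le_one (by positivity)]
  · obtain ⟨⟨h2, h3⟩, h4⟩ := hx
    rw [mem_closedBall_zero_iff] at h4
    have h5 := norm_sq_split x
    have h6 : ‖tailE x‖ ^ 2 ≤ (1 / 4) ^ 2 :=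
      pow_le_pow_left₀ (norm_nonneg _) (h4.trans hκ4) 2
    refine ⟨hδ, hδκ', le_of_eq (by field_simp), ?_, ?_, ?_, by linarith, by simpa using hδ.le, ?_⟩
    · rw [mul_pow, inv_pow, sq δ, mul_assoc]
      refine mul_le_of_le_one_right hδ.le ?_
      rwa [← div_eq_mul_inv, div_le_one (by positivity)]
    · by_contra! h7
      nlinarith [sq_nonneg ‖tailE x‖, norm_nonneg x]
    · by_contra! h7
      nlinarith
    · calc δ * κ⁻¹ * ‖tailE x‖ ≤ δ * κ⁻¹ * κ := by gcongr
        _ = δ := by field_simp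

/-! ### Sums of far translates -/

/-- The sum of `N` translates of `f` with spacing `L` in the direction `e`. -/
noncomputable def translateSum (f : 𝓢(En n, ℂ)) (L : ℝ) (e : En n) (N : ℕ) (z : En n) : ℂ :=
  ∑ k ∈ Finset.range N, f (z - (k * L) • e)

theorem contDiff_translateSum (f : 𝓢(En n, ℂ)) (L : ℝ) (e : En n) (N : ℕ) :
    ContDiff ℝ ∞ (translateSum f L e N) :=
  ContDiff.sum fun _ _ => (f.smooth _).comp (contDiff_id.sub contDiff_const)

theorem le_norm_sub_of_ne {L : ℝ} (hL : 0 ≤ L) {e : En n} (he : ‖e‖ = 1) {j k : ℕ} (hjk : j ≠ k) :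
    L ≤ ‖((j * L) • e - (k * L) • e : En n)‖ := by
  rw [← sub_smul, norm_smul, he, mul_one, ← sub_mul, Real.norm_eq_abs, abs_mul, abs_of_nonneg hL]
  have h : (1 : ℝ) ≤ |(j : ℝ) - k| := by
    have : (1 : ℤ) ≤ |(j : ℤ) - k| := Int.one_le_abs (sub_ne_zero.2 (by exact_mod_cast hjk))
    exact_mod_cast this
  nlinarith

theorem eq_zero_of_translate_near {f : 𝓢(En n, ℂ)} {R R' L : ℝ} (hf : ∀ z, R < ‖z‖ → f z = 0)
    (hL : R + R' < L) (hL0 : 0 ≤ L) {e : En n} (he : ‖e‖ = 1) {j k : ℕ} (hjk : j ≠ k) {z : En n}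
    (hz : ‖z - (k * L) • e‖ ≤ R') : f (z - (j * L) • e) = 0 := by
  refine hf _ ?_
  have h1 := le_norm_sub_of_ne hL0 he hjk
  have h2 : ((j * L) • e - (k * L) • e : En n) = (z - (k * L) • e) - (z - (j * L) • e) := by abel
  rw [h2] at h1
  linarith [norm_sub_le (z - (k * L) • e) (z - (j * L) • e)]

theorem translateSum_eq_of_near {f : 𝓢(En n, ℂ)} {R R' L : ℝ} (hf : ∀ z, R < ‖z‖ → f z = 0)
    (hL : R + R' < L) (hL0 : 0 ≤ L) {e : En n} (he : ‖e‖ = 1) {N k : ℕ} (hk : k < N) {z : En n}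
    (hz : ‖z - (k * L) • e‖ ≤ R') : translateSum f L e N z = f (z - (k * L) • e) :=
  Finset.sum_eq_single_of_mem k (Finset.mem_range.2 hk) fun _ _ hj =>
    eq_zero_of_translate_near hf hL hL0 he hj hz

theorem norm_translateSum_le {f : 𝓢(En n, ℂ)} {R L K : ℝ} (hf : ∀ z, R < ‖z‖ → f z = 0)
    (hL : R + R < L) (hL0 : 0 ≤ L) {e : En n} (he : ‖e‖ = 1) (hK : ∀ z, ‖f z‖ ≤ K) (N : ℕ)
    (z : En n) : ‖translateSum f L e N z‖ ≤ K := by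
  by_cases h : ∃ k, k < N ∧ ‖z - (k * L) • e‖ ≤ R
  · obtain ⟨k, hk, hz⟩ := h
    rw [translateSum_eq_of_near hf hL hL0 he hk hz]
    exact hK _
  · push Not at h
    rw [translateSum, Finset.sum_eq_zero fun k hk => hf _ (h k (Finset.mem_range.1 hk)), norm_zero]
    exact (norm_nonneg _).trans (hK 0)

theorem hasCompactSupport_translateSum {f : 𝓢(En n, ℂ)} {R L : ℝ} (hf : ∀ z, R < ‖z‖ → f z = 0)
    (hL0 : 0 ≤ L) {e : En n} (he : ‖e‖ = 1) (N : ℕ) :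
    HasCompactSupport (translateSum f L e N) := by
  refine HasCompactSupport.intro (isCompact_closedBall 0 (R + N * L)) fun z hz => ?_
  refine Finset.sum_eq_zero fun k hk => hf _ ?_
  rw [mem_closedBall_zero_iff, not_le] at hz
  have h1 : ‖(k * L) • e‖ ≤ N * L := by
    rw [norm_smul, he, mul_one, Real.norm_eq_abs, abs_of_nonneg (by positivity)]
    have : (k : ℝ) ≤ N := by exact_mod_cast (Finset.mem_range.1 hk).le
    gcongr
  linarith [norm_sub_norm_le z ((k * L) • e)]

theorem lintegral_translateSum_le (f : 𝓢(En n, ℂ)) (L : ℝ) (e : En n) (N : ℕ) :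
    ∫⁻ z, ‖translateSum f L e N z‖ₑ ≤ N * ∫⁻ z, ‖f z‖ₑ := by
  have hm : ∀ k : ℕ, Measurable fun z => ‖f (z - (k * L) • e)‖ₑ := fun k =>
    (f.continuous.comp (continuous_id.sub continuous_const)).measurable.enorm
  calc ∫⁻ z, ‖translateSum f L e N z‖ₑ
      ≤ ∫⁻ z, ∑ k ∈ Finset.range N, ‖f (z - (k * L) • e)‖ₑ :=
        lintegral_mono fun z => enorm_sum_le _ _
    _ = ∑ k ∈ Finset.range N, ∫⁻ z, ‖f (z - (k * L) • e)‖ₑ :=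
        lintegral_finsetSum _ fun k _ => hm k
    _ = _ := by
        simp only [lintegral_sub_right_eq_self (fun z => ‖f z‖ₑ)]
        simp

/-- Testing on sums of `N` far translates and letting `N → ∞` shows `1 / q ≤ 1 / p`, provided the
maximal function of a single compactly supported `f` is not almost everywhere zero. -/
theorem recip_le_of_translates {p q : ℝ≥0∞} (hp : 1 ≤ p) (hq : 1 ≤ q) {α : ℂ} {C : ℝ≥0}
    (hC : ∀ f : 𝓢(En n, ℂ), eLpNorm (localSteinMaximal n α f) q volume ≤ C * eLpNorm f p volume)
    {e : En n} (he : ‖e‖ = 1) (f : 𝓢(En n, ℂ)) {R K I c τ : ℝ} (hR : 0 ≤ R)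
    (hf : ∀ z, R < ‖z‖ → f z = 0) (hK : 1 ≤ K) (hI : 0 < I) (hfK : ∀ y, ‖f y‖ ≤ K)
    (hfI : ∫⁻ y, ‖f y‖ₑ ≤ ENNReal.ofReal I) (hc : 0 < c) {T : Set (En n)} (hT : MeasurableSet T)
    (hTR : T ⊆ Metric.closedBall 0 R) (hτ : 0 < τ) (hTτ : ENNReal.ofReal τ ≤ volume T)
    (hM : ∀ x ∈ T, ∃ t ∈ Icc (1 : ℝ) 2, c ≤ ‖steinMean n α t f x‖) :
    recip q ≤ recip p := by
  -- the spacing keeps apart the translates of `f` as seen from balls of radius at most `2`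
  set L : ℝ := 2 * R + 3 with hL
  have hL0 : 0 ≤ L := by positivity
  refine exponent_le_of_atTop (a := c * τ ^ recip q) (b := C * (K * I ^ recip p)) (by positivity) ?_
  filter_upwards [eventually_gt_atTop 0] with N hN
  have hN0 : (0 : ℝ) < N := by exact_mod_cast hN
  set F : 𝓢(En n, ℂ) := (hasCompactSupport_translateSum hf hL0 he N).toSchwartzMap
    (contDiff_translateSum f L e N) with hF
  have hFz : ∀ z, F z = translateSum f L e N z := fun z => rfl
  set S : ℕ → Set (En n) := fun k => (fun x => x - (k * L) • e) ⁻¹' T with hS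
  have hSm : ∀ k, MeasurableSet (S k) := fun k => (measurable_id.sub_const _) hT
  have hSv : ∀ k, volume (S k) = volume T := fun k => by
    simp only [hS, sub_eq_add_neg]
    exact measure_preimage_add_right volume _ T
  have hdisj : (Finset.range N : Set ℕ).PairwiseDisjoint S := by
    intro j _ k _ hjk
    refine disjoint_left.2 fun x hj hk => ?_
    have h1 := hTR hj
    have h2 := hTR hk
    rw [mem_closedBall_zero_iff] at h1 h2
    have h3 := le_norm_sub_of_ne hL0 he hjk
    have h4 : ((j * L) • e - (k * L) • e : En n) = (x - (k * L) • e) - (x - (j * L) • e) := by abel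
    rw [h4] at h3
    linarith [norm_sub_le (x - (k * L) • e) (x - (j * L) • e)]
  have h := test_bound hp hq hC F (K := K) (I := N * I) (c := c) (τ := N * τ)
    (T := ⋃ k ∈ Finset.range N, S k) hK (by positivity)
    (fun y => by
      rw [hFz]
      exact norm_translateSum_le hf (by linarith) hL0 he hfK N y)
    (by
      simp only [hFz]
      refine (lintegral_translateSum_le f L e N).trans ?_
      rw [ENNReal.ofReal_mul hN0.le, ENNReal.ofReal_natCast]
      gcongr)
    hc.le (Finset.measurableSet_biUnion _ fun k _ => hSm k) (by positivity)
    (by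
      rw [measure_biUnion_finset hdisj fun k _ => hSm k]
      simp only [hSv, Finset.sum_const, Finset.card_range, nsmul_eq_mul]
      rw [ENNReal.ofReal_mul hN0.le, ENNReal.ofReal_natCast]
      gcongr)
    fun x hx => by
      simp only [mem_iUnion, Finset.mem_range] at hx
      obtain ⟨k, hk, hxk⟩ := hx
      obtain ⟨t, ht, hct⟩ := hM _ hxk
      refine ⟨t, ht, hct.trans_eq ?_⟩
      have hxR := hTR hxk
      rw [mem_closedBall_zero_iff] at hxR
      rw [steinMean_eq_ballMean, steinMean_eq_ballMean]
      congr 1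
      refine ballMean_congr ?_ ?_ (fun y hy => ?_) α
      · exact (f.smooth _).comp (contDiff_const.sub (contDiff_id.const_smul t))
      · exact (F.smooth _).comp (contDiff_const.sub (contDiff_id.const_smul t))
      · have e1 : x - (k * L) • e - t • y = x - t • y - (k * L) • e := by abel
        have h1 : ‖t • y‖ ≤ 2 := by
          rw [norm_smul, Real.norm_eq_abs, abs_of_pos (by linarith [ht.1])]
          nlinarith [ht.2, ht.1, norm_nonneg y]
        rw [hFz, translateSum_eq_of_near hf (R' := R + 2) (by linarith) hL0 he hk, e1]
        rw [← e1]
        exact (norm_sub_le _ _).trans (add_le_add hxR h1)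
  rw [Real.mul_rpow hN0.le hτ.le, Real.mul_rpow hN0.le hI.le] at h
  linarith

theorem le_of_recip_le {p q : ℝ≥0∞} (hp : 1 ≤ p) (hq : 1 ≤ q) (h : recip q ≤ recip p) : p ≤ q := by
  have h1 : p⁻¹ ≠ ⊤ := ENNReal.inv_ne_top.2 (zero_lt_one.trans_le hp).ne'
  have h2 : q⁻¹ ≠ ⊤ := ENNReal.inv_ne_top.2 (zero_lt_one.trans_le hq).ne'
  exact ENNReal.inv_le_inv.1 ((ENNReal.toReal_le_toReal h2 h1).1 h)

/-- The maximal inequality forces `p ≤ q`, by testing on far translates of a plate. -/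
theorem exponent_le_of_bounded {p q : ℝ≥0∞} (hp : 1 ≤ p) (hq : 1 ≤ q) {α : ℂ} {C : ℝ≥0}
    (hC : ∀ f : 𝓢(En (m + 1), ℂ),
      eLpNorm (localSteinMaximal (m + 1) α f) q volume ≤ C * eLpNorm f p volume) : p ≤ q := by
  obtain ⟨κ, c, hκ, hκ4, hc, hlow⟩ := plateMean_lower (m := m) α
  have hI := integral_unitBump_pos (m := m)
  set δ : ℝ := κ ^ 2 with hδdef
  have hδ : 0 < δ := by positivity
  have hs : 0 < √δ := Real.sqrt_pos.2 hδ
  have hδ1 : δ ≤ 1 := by nlinarith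
  have hs1 : √δ ≤ 1 := Real.sqrt_le_one.2 hδ1
  have hv := volume_unit_closedBall_pos (m := m)
  refine le_of_recip_le hp hq (recip_le_of_translates hp hq hC
    (e := EuclideanSpace.single 0 1) (by simp) (plateFun hδ hδ1 hs hs1) (R := 8)
    (K := Real.exp 4) (I := Real.exp 4 * (∫ w, unitBump m w) * (δ * √δ ^ m))
    (c := c * (δ ^ α.re * √δ ^ m)) (T := tube m δ)
    (τ := √δ ^ m * volume.real (Metric.closedBall (0 : En m) 1)) (by norm_num)
    (fun z hz => cutPlate_eq_zero hδ hδ1 hs hs1 hz) (Real.one_le_exp (by norm_num))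
    (by positivity) (fun y => norm_cutPlate_le _ _ y) (lintegral_cutPlate_le hδ hδ1 hs hs1)
    (by positivity) (measurableSet_tube δ) (fun x hx => ?_) (by positivity) (volume_tube δ).ge
    fun x hx => ?_)
  · obtain ⟨⟨h1, h2⟩, h3⟩ := hx
    rw [mem_closedBall_zero_iff] at h3 ⊢
    have h4 := norm_sq_split x
    have h5 : ‖tailE x‖ ^ 2 ≤ 1 := pow_le_one₀ (norm_nonneg _) (h3.trans hs1)
    by_contra! h6
    nlinarith
  · have ht := tangential_of_mem_tube hκ hκ4 hδ le_rfl hx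
    refine ⟨x 0, ⟨ht.one_le, ht.le_two⟩, ?_⟩
    rw [steinMean_plateFun ht hκ4]
    exact hlow _ _ _ _ ht

end SteinMeans

theorem theorem1p1 (n : ℕ) (hn : 2 ≤ n) (p q : ℝ≥0∞) (hp : 1 ≤ p) (hq : 1 ≤ q) (α : ℂ)
    (hbdd : ∃ C : ℝ≥0, ∀ f : 𝓢(En n, ℂ),
      eLpNorm (localSteinMaximal n α f) q volume ≤ C * eLpNorm f p volume) :
    p ≤ q ∧ steinSigma n p q ≤ α.re := by
  obtain ⟨C, hC⟩ := hbdd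
  obtain ⟨m, rfl⟩ : ∃ m, n = m + 1 := ⟨n - 1, by omega⟩
  refine ⟨SteinMeans.exponent_le_of_bounded hp hq hC, max_le ?_ (max_le ?_ ?_)⟩
  · exact SteinMeans.re_ge_of_shell (by omega) hp hq hC
  · have h := SteinMeans.re_ge_of_knapp hp hq hC
    push_cast
    linarith
  · have h := SteinMeans.re_ge_of_bump hp hq hC
    push_cast
    linarith
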